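/- **Setting.** Let $\Omega\subset\mathbb R^2$ be a polygonal domain, $\mathcal T_0$ a fixed conforming triangulation of $\overline\Omega$ with a newest vertex chosen in each triangle, and $\mathcal T$ a (possibly non-conforming) refinement of $\mathcal T_0$ obtained by finitely many successive newest-vertex bisections of elements. Nodes of $\mathcal T$ are the vertices of its triangles; a node is *proper* if it is a vertex of every triangle containing it, and *hanging* otherwise. The global index $\lambda$ of a proper node is $0$; that of a hanging node created by halving an edge $[\boldsymbol x',\boldsymbol x'']$ is $\max(\lambda(\boldsymbol x'),\lambda(\boldsymbol x''))+1$. For an integer $\Lambda\ge1$, $\mathcal T$ is *$\Lambda$-admissible* if $\lambda\le\Lambda$ at all nodes. For $E\in\mathcal T$ let $h_E=|E|^{1/2}$, let $\mathcal N_E$ be the set of nodes on $\partial E$ and $\mathcal E_E$ the set of edges of $E$ (segments of $\partial E$ between consecutive nodes). **Discrete spaces.** For each $E\in\mathcal T$ let $\mathbb V_E\subset C^0(E)\cap H^1(E)$ be a linear space with $\dim\mathbb V_E=|\mathcal N_E|$, $\mathbb P_1(E)\subseteq\mathbb V_E$, whose traces on $\partial E$ are exactly the continuous functions on $\partial E$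 that are affine on each $e\in\mathcal E_E$. Put $s_E(v,w)=\sum_{\boldsymbol x\in\mathcal N_E}v(\boldsymbol x)w(\boldsymbol x)$ and assume, with constants $C_s\ge c_s>0$ independent of $E$ and $\mathcal T$, $$c_s|v|_{1,E}^2\le \min_{k\in\mathbb R}s_E(v-k,v-k)\le C_s|v|_{1,E}^2\qquad\forall v\in\mathbb V_E .$$ Let $\mathbb V_{\mathcal T}=\{v\in H^1_0(\Omega): v|_E\in\mathbb V_E\ \forall E\in\mathcal T\}$. Let $\mathcal I_Ev\in\mathbb P_1(E)$ interpolate $v$ at the three vertices of $E$, and let $\Pi^\nabla_Ev\in\mathbb P_1(E)$ be defined by $\int_E\nabla(v-\Pi^\nabla_Ev)\cdot\nabla q=0$ for all $q\in\mathbb P_1(E)$ and $\int_{\partial E}(v-\Pi^\nabla_Ev)=0$. **Discrete problem.** Let $\mathcal D=(A,c,f)$ be data on $\Omega$ with $A\in L^\infty$ symmetric and uniformly positive definite, $0\le c\in L^\infty$, $f\in L^2$, constant on each $E\in\mathcal T$ with values $(A_E,c_E,f_E)$. For $\gamma>0$ set $$\mathcal B_{\mathcal T}(v,w)=\sum_{E}\int_E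 (A_E\nabla\Pi^\nabla_Ev)\cdot\nabla\Pi^\nabla_Ew+\gamma S_{\mathcal T}(v,w)+\sum_E c_E\int_E\Pi^\nabla_Ev\,\Pi^\nabla_Ew,$$ $$S_{\mathcal T}(v,w)=\sum_{E}s_E(v-\mathcal I_Ev,w-\mathcal I_Ew),$$ and let $u_{\mathcal T}\in\mathbb V_{\mathcal T}$ be the Galerkin solution: $\mathcal B_{\mathcal T}(u_{\mathcal T},v)=\sum_E f_E\int_E\Pi^\nabla_Ev$ for all $v\in\mathbb V_{\mathcal T}$. **Estimator.** Let $$\eta_{\mathcal T}^2(v,\mathcal D)=\sum_{E\in\mathcal T}\Big(h_E^2\|f_E-c_E\Pi^\nabla_Ev\|_{0,E}^2+\tfrac12\sum_{e\in\mathcal E_E}h_E\|j_{\mathcal T}(e;v,\mathcal D)\|_{0,e}^2\Big),$$ where $j_{\mathcal T}(e;v,\mathcal D)=(A_{E_1}\nabla\Pi^\nabla_{E_1}v)\cdot\boldsymbol n_1+(A_{E_2}\nabla\Pi^\nabla_{E_2}v)\cdot\boldsymbol n_2$ if $e$ is shared by $E_1,E_2$, with $\boldsymbol n_i$ the unit normal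 to $e$ outward with respect to $E_i$, and $j_{\mathcal T}(e;v,\mathcal D)=0$ if $e\subset\partial\Omega$. **Claim.** There exists a constant $C_B>0$, depending only on $\Omega$, $\mathcal T_0$, $\Lambda$, $c_s$, $C_s$ (in particular not on $\mathcal T$, the spaces $\mathbb V_E$, the data $\mathcal D$, $u_{\mathcal T}$ or $\gamma$), such that for every $\Lambda$-admissible $\mathcal T$, all local spaces and data as above and every $\gamma>0$, $$\gamma^2S_{\mathcal T}(u_{\mathcal T},u_{\mathcal T})\le C_B\,\eta_{\mathcal T}^2(u_{\mathcal T},\mathcal D).$$ -/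

import Mathlib

open MeasureTheory Filter Topology
open scoped ContDiff

namespace VEM

noncomputable section

open scoped Classical

/-- Points (and vectors) of the Euclidean plane. -/
abbrev Pt : Type := EuclideanSpace ℝ (Fin 2)

/-! ### Sobolev spaces -/

/-- `φ` is a smooth function on the plane with compact support contained in `U`. -/
def IsTestFunction (U : Set Pt) (φ : Pt → ℝ) : Prop :=
  ContDiff ℝ ∞ φ ∧ HasCompactSupport φ ∧ tsupport φ ⊆ U

/-- `g` is the weak gradient of `v` on the open set `U`. -/
def HasWeakGrad (U : Set Pt) (v : Pt → ℝ) (g : Pt → Pt) : Prop :=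
  ∀ φ : Pt → ℝ, IsTestFunction U φ → ∀ i : Fin 2,
    ∫ x in U, v x * gradient φ x i = - ∫ x in U, g x i * φ x

/-- `v ∈ H¹(U)` and `g` is its weak gradient, square integrable on `U`. -/
def IsH1With (U : Set Pt) (v : Pt → ℝ) (g : Pt → Pt) : Prop :=
  MemLp v 2 (volume.restrict U) ∧ MemLp g 2 (volume.restrict U) ∧ HasWeakGrad U v g

/-- `v ∈ H¹(U)`. -/
def MemH1 (U : Set Pt) (v : Pt → ℝ) : Prop := ∃ g, IsH1With U v g

/-- The weak gradient of `v ∈ H¹(U)` (unique up to null subsets of `U`); zero if `v ∉ H¹(U)`. -/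
def weakGrad (U : Set Pt) (v : Pt → ℝ) : Pt → Pt :=
  if h : MemH1 U v then h.choose else 0

/-- `v ∈ H¹₀(U)`: the closure of the test functions on `U` with respect to the norm of `H¹(U)`. -/
def MemH10 (U : Set Pt) (v : Pt → ℝ) : Prop :=
  ∃ g : Pt → Pt, IsH1With U v g ∧
    ∃ φ : ℕ → Pt → ℝ, (∀ n, IsTestFunction U (φ n)) ∧
      Tendsto (fun n => eLpNorm (fun x => φ n x - v x) 2 (volume.restrict U)) atTop (𝓝 0) ∧
      Tendsto (fun n => eLpNorm (fun x => gradient (φ n) x - g x) 2 (volume.restrict U))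
        atTop (𝓝 0)

/-! ### Triangles and newest-vertex bisection -/

/-- A triangle, given by its vertices, with a distinguished newest vertex `peak`. The edge opposite
to the newest vertex, `[left, right]`, is the one to be halved. -/
structure Tri where
  peak : Pt
  left : Pt
  right : Pt

namespace Tri

/-- The three vertices. -/
def verts (E : Tri) : Finset Pt := {E.peak, E.left, E.right}

/-- The closed triangle. -/
def carrier (E : Tri) : Set Pt := convexHull ℝ (E.verts : Set Pt)

/-- The three vertices are not aligned. -/
def Nondegenerate (E : Tri) : Prop := AffineIndependent ℝ ![E.peak, E.left, E.right]

/-- The sides of the triangle (as closed segments). -/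
def sides (E : Tri) : Set (Set Pt) :=
  {s | ∃ a ∈ E.verts, ∃ b ∈ E.verts, a ≠ b ∧ s = segment ℝ a b}

/-- The midpoint of the side opposite to the newest vertex. -/
def mid (E : Tri) : Pt := midpoint ℝ E.left E.right

/-- First child in the newest-vertex bisection. -/
def child₁ (E : Tri) : Tri := ⟨E.mid, E.peak, E.left⟩

/-- Second child in the newest-vertex bisection. -/
def child₂ (E : Tri) : Tri := ⟨E.mid, E.peak, E.right⟩

/-- The area `|E|`. -/
def area (E : Tri) : ℝ := volume.real E.carrier

/-- The size `h_E = |E|^{1/2}`. -/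
def h (E : Tri) : ℝ := Real.sqrt E.area

end Tri

/-- `Ω` is a polygonal domain (open, connected, with boundary made of finitely many segments) and
`T₀` is a conforming triangulation of its closure: two distinct triangles have
different vertex sets and meet exactly in the convex hull of their common vertices (that is, in a
common side, in a common vertex, or not at all), and `∂Ω` is a union of sides of triangles. -/
structure IsConformingTriangulation (Ω : Set Pt) (T₀ : Finset Tri) : Prop where
  isOpen : IsOpen Ω
  isConnected : IsConnected Ω
  nondegenerate : ∀ E ∈ T₀, E.Nondegenerate
  verts_ne : ∀ E ∈ T₀, ∀ E' ∈ T₀, E ≠ E' → E.verts ≠ E'.verts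
  inter_eq : ∀ E ∈ T₀, ∀ E' ∈ T₀, E ≠ E' →
    E.carrier ∩ E'.carrier = convexHull ℝ ((E.verts ∩ E'.verts : Finset Pt) : Set Pt)
  closure_eq : closure Ω = ⋃ E ∈ T₀, E.carrier
  frontier_eq : ∃ S : Set (Set Pt), S ⊆ (⋃ E ∈ T₀, E.sides) ∧ frontier Ω = ⋃₀ S

/-- `IsRefinement T₀ T H`: the triangulation `T` is obtained from `T₀` by a finite number of
successive newest-vertex bisections of elements, and `H` is the collection of all the triangles
that have been bisected in the process. -/
inductive IsRefinement (T₀ : Finset Tri) : Finset Tri → Finset Tri → Prop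
  | initial : IsRefinement T₀ T₀ ∅
  | bisect (T H : Finset Tri) (E : Tri) : IsRefinement T₀ T H → E ∈ T →
      IsRefinement T₀ (T.erase E ∪ {E.child₁, E.child₂}) (insert E H)

/-! ### Nodes, edges, global index -/

/-- The set of nodes of `T`: all vertices of all triangles of `T`. -/
def nodes (T : Finset Tri) : Finset Pt := T.biUnion Tri.verts

/-- A proper node is a vertex of all the triangles that contain it. -/
def IsProperNode (T : Finset Tri) (x : Pt) : Prop :=
  x ∈ nodes T ∧ ∀ E ∈ T, x ∈ E.carrier → x ∈ E.verts

/-- A hanging node is a node that is not proper. -/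
def IsHangingNode (T : Finset Tri) (x : Pt) : Prop := x ∈ nodes T ∧ ¬ IsProperNode T x

/-- `IsGlobalIndex T H x k`: the node `x` of `T` has global index `k`; here `H` is the collection of
the triangles bisected to produce `T`. A proper node has index `0`; a hanging node, created by
halving the edge `[E.left, E.right]` of a triangle `E ∈ H`, has index one more than the maximum of
the indices of `E.left` and `E.right`. -/
inductive IsGlobalIndex (T H : Finset Tri) : Pt → ℕ → Prop
  | proper (x : Pt) : IsProperNode T x → IsGlobalIndex T H x 0
  | hanging (E : Tri) (k l : ℕ) : E ∈ H → IsHangingNode T E.mid →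
      IsGlobalIndex T H E.left k → IsGlobalIndex T H E.right l →
      IsGlobalIndex T H E.mid (max k l + 1)

/-- `Λ`-admissibility: all the nodes have global index at most `Λ`. -/
def IsAdmissible (Λ : ℕ) (T H : Finset Tri) : Prop :=
  ∀ x ∈ nodes T, ∃ k ≤ Λ, IsGlobalIndex T H x k

/-- `𝒩_E`: the nodes of `T` sitting on `∂E`. -/
def nodesOn (T : Finset Tri) (E : Tri) : Finset Pt :=
  (nodes T).filter (fun x => x ∈ frontier E.carrier)

/-- `ℰ_E`: the edges of the polygon `E`, i.e. the segments contained in `∂E` that join two nodes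
and have no further node in between. -/
def edges (T : Finset Tri) (E : Tri) : Finset (Set Pt) :=
  ((nodesOn T E ×ˢ nodesOn T E).filter (fun p =>
    p.1 ≠ p.2 ∧ segment ℝ p.1 p.2 ⊆ frontier E.carrier ∧
      ∀ z ∈ nodes T, z ∉ openSegment ℝ p.1 p.2)).image (fun p => segment ℝ p.1 p.2)

/-! ### Affine polynomials, local virtual element spaces -/

/-- `ℙ₁`: the affine polynomials on the plane. -/
abbrev P1 : Type := Pt →ᵃ[ℝ] ℝ

/-- The (constant) gradient of an affine polynomial. -/
def grad1 (p : P1) : Pt :=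
  !₂[p.linear (EuclideanSpace.single 0 1), p.linear (EuclideanSpace.single 1 1)]

/-- The restriction to `E` of the function `v` belongs to the space `W` of continuous functions on
the closed triangle `E`. -/
def RestrictsInto (E : Tri) (W : Submodule ℝ C(E.carrier, ℝ)) (v : Pt → ℝ) : Prop :=
  ∃ w ∈ W, ∀ x : E.carrier, w x = v x

/-- `g` is continuous on `∂E` and affine on each edge of `E`, i.e. `g` belongs to `𝕍_{∂E}`. -/
def IsBoundaryFunction (T : Finset Tri) (E : Tri) (g : Pt → ℝ) : Prop :=
  ContinuousOn g (frontier E.carrier) ∧ ∀ e ∈ edges T E, ∃ p : P1, ∀ x ∈ e, g x = p x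

/-- The conditions on the local space `𝕍_E`, a space of continuous functions on `E` contained in
`H¹(E)`: its dimension is `|𝒩_E|`, it contains the affine polynomials, and the traces on `∂E` of its
members are exactly the members of `𝕍_{∂E}`. -/
structure IsLocalVEMSpace (T : Finset Tri) (E : Tri) (W : Submodule ℝ C(E.carrier, ℝ)) : Prop where
  memH1 : ∀ v : Pt → ℝ, RestrictsInto E W v → MemH1 (interior E.carrier) v
  finrank_eq : Module.finrank ℝ W = (nodesOn T E).card
  affine_mem : ∀ p : P1, RestrictsInto E W p
  trace_eq : ∀ g : Pt → ℝ, IsBoundaryFunction T E g ↔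
    ∃ v : Pt → ℝ, RestrictsInto E W v ∧ ∀ x ∈ frontier E.carrier, v x = g x

/-- `|v|²_{1,E}`. -/
def h1SeminormSq (E : Tri) (v : Pt → ℝ) : ℝ :=
  ∫ x in interior E.carrier, ‖weakGrad (interior E.carrier) v x‖ ^ 2

/-- The form `s_E(v,w) = ∑_{x ∈ 𝒩_E} v(x) w(x)`. -/
def sLoc (T : Finset Tri) (E : Tri) (v w : Pt → ℝ) : ℝ :=
  ∑ x ∈ nodesOn T E, v x * w x

/-- Stability on `𝕍_E / ℝ`: the square of the `H¹`-seminorm is equivalent, with constants `c_s` and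
`C_s`, to the quadratic form induced by `s_E` on the quotient space, that is, to the minimum of
`s_E(v - k, v - k)` over all constants `k`. -/
def IsStable (c_s C_s : ℝ) (T : Finset Tri) (E : Tri) (W : Submodule ℝ C(E.carrier, ℝ)) : Prop :=
  ∀ v : Pt → ℝ, RestrictsInto E W v →
    (∀ k : ℝ, c_s * h1SeminormSq E v ≤ sLoc T E (fun x => v x - k) (fun x => v x - k)) ∧
    (∃ k : ℝ, sLoc T E (fun x => v x - k) (fun x => v x - k) ≤ C_s * h1SeminormSq E v)

/-- The global discrete space `𝕍_T`, given the family `V` of the local spaces `𝕍_E`; its members are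
represented by functions that are defined at every point of the closed domain. -/
def MemVT (Ω : Set Pt) (T : Finset Tri) (V : (E : Tri) → Submodule ℝ C(E.carrier, ℝ))
    (v : Pt → ℝ) : Prop :=
  MemH10 Ω v ∧ ∀ E ∈ T, RestrictsInto E (V E) v

/-! ### Projection and interpolation -/

/-- The conditions that define the projection `p = Π^∇_E v`: orthogonality of the gradients, and
equality of the means on `∂E` (with respect to arc length). -/
def IsPiNabla (E : Tri) (v : Pt → ℝ) (p : P1) : Prop :=
  (∀ q : P1, ∫ x in interior E.carrier,
      inner ℝ (weakGrad (interior E.carrier) v x - grad1 p) (grad1 q) = 0) ∧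
  ∫ x in frontier E.carrier, (v x - p x) ∂(Measure.hausdorffMeasure 1) = 0

/-- `Π^∇_E v`, the affine polynomial determined by `IsPiNabla`. -/
def piNabla (E : Tri) (v : Pt → ℝ) : P1 := Classical.epsilon (IsPiNabla E v)

/-- `ℐ_E v`, the Lagrange interpolant of `v` at the vertices of `E`: the affine polynomial that
agrees with `v` at the three vertices. -/
def lagrange (E : Tri) (v : Pt → ℝ) : P1 :=
  Classical.epsilon (fun p : P1 => ∀ x ∈ E.verts, p x = v x)

/-! ### Data, discrete forms, Galerkin solution -/

/-- Values of the data `(A, c, f)`. -/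
structure Coeff where
  A : Matrix (Fin 2) (Fin 2) ℝ
  c : ℝ
  f : ℝ

/-- Assumptions on the data on `Ω`: `A` is bounded, symmetric and uniformly positive definite, `c` is
bounded and nonnegative, and `f` is square integrable. -/
structure IsData (Ω : Set Pt) (D : Pt → Coeff) : Prop where
  memLp_A : ∀ i j, MemLp (fun x => (D x).A i j) ⊤ (volume.restrict Ω)
  memLp_c : MemLp (fun x => (D x).c) ⊤ (volume.restrict Ω)
  memLp_f : MemLp (fun x => (D x).f) 2 (volume.restrict Ω)
  symm_A : ∀ᵐ x ∂(volume.restrict Ω), (D x).A.IsSymm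
  posDef_A : ∃ α : ℝ, 0 < α ∧ ∀ᵐ x ∂(volume.restrict Ω), ∀ ξ : Pt,
    α * ‖ξ‖ ^ 2 ≤ inner ℝ (Matrix.toEuclideanLin (D x).A ξ) ξ
  nonneg_c : ∀ᵐ x ∂(volume.restrict Ω), 0 ≤ (D x).c

/-- The data are constant in each element `E` of `T`, with value `DT E = (A_E, c_E, f_E)`. -/
def IsPiecewiseConstant (T : Finset Tri) (D : Pt → Coeff) (DT : Tri → Coeff) : Prop :=
  ∀ E ∈ T, ∀ᵐ x ∂(volume.restrict E.carrier), D x = DT E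

/-- `a_T(v,w)`. -/
def aT (T : Finset Tri) (DT : Tri → Coeff) (v w : Pt → ℝ) : ℝ :=
  ∑ E ∈ T, ∫ _x in E.carrier,
    inner ℝ (Matrix.toEuclideanLin (DT E).A (grad1 (piNabla E v))) (grad1 (piNabla E w))

/-- `m_T(v,w)`. -/
def mT (T : Finset Tri) (DT : Tri → Coeff) (v w : Pt → ℝ) : ℝ :=
  ∑ E ∈ T, (DT E).c * ∫ x in E.carrier, piNabla E v x * piNabla E w x

/-- The global stabilizing form
`S_T(v,w) = ∑_E S_E(v,w)`, with `S_E(v,w) = s_E(v - ℐ_E v, w - ℐ_E w)`. -/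
def stabT (T : Finset Tri) (v w : Pt → ℝ) : ℝ :=
  ∑ E ∈ T, sLoc T E (fun x => v x - lagrange E v x) (fun x => w x - lagrange E w x)

/-- `ℬ_T(v,w) = a_T(v,w) + γ S_T(v,w) + m_T(v,w)`. -/
def BT (T : Finset Tri) (DT : Tri → Coeff) (γ : ℝ) (v w : Pt → ℝ) : ℝ :=
  aT T DT v w + γ * stabT T v w + mT T DT v w

/-- The discrete load `ℱ_T(v)`. -/
def FT (T : Finset Tri) (DT : Tri → Coeff) (v : Pt → ℝ) : ℝ :=
  ∑ E ∈ T, (DT E).f * ∫ x in E.carrier, piNabla E v x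

/-- `u` is the solution in `𝕍_T` of the discrete problem. -/
def IsGalerkinSolution (Ω : Set Pt) (T : Finset Tri)
    (V : (E : Tri) → Submodule ℝ C(E.carrier, ℝ)) (DT : Tri → Coeff) (γ : ℝ)
    (u : Pt → ℝ) : Prop :=
  MemVT Ω T V u ∧ ∀ v, MemVT Ω T V v → BT T DT γ u v = FT T DT v

/-! ### The residual estimator -/

/-- The internal residual `f_E - c_E Π^∇_E v`. -/
def residual (DT : Tri → Coeff) (E : Tri) (v : Pt → ℝ) (x : Pt) : ℝ :=
  (DT E).f - (DT E).c * piNabla E v x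

/-- `ν` is the unit normal vector to the edge `e` of `E` pointing outward with respect to `E`: `E`
lies in the half-plane bounded by the line through `e` with outward direction `ν`. -/
def IsOutwardNormal (E : Tri) (e : Set Pt) (ν : Pt) : Prop :=
  ‖ν‖ = 1 ∧ ∀ x ∈ e, ∀ y ∈ E.carrier, inner ℝ ν (y - x) ≤ 0

/-- The outward unit normal to the edge `e` of `E`. -/
def outwardNormal (E : Tri) (e : Set Pt) : Pt := Classical.epsilon (IsOutwardNormal E e)

/-- The jump residual over the edge `e`: zero if `e ⊆ ∂Ω`, and otherwise the sum of the outward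
fluxes of `A ∇ Π^∇_T v` from the (two) elements sharing `e`. -/
def jump (Ω : Set Pt) (T : Finset Tri) (DT : Tri → Coeff) (e : Set Pt) (v : Pt → ℝ) : ℝ :=
  if e ⊆ frontier Ω then 0
  else ∑ E ∈ T.filter (fun E => e ∈ edges T E),
    inner ℝ (Matrix.toEuclideanLin (DT E).A (grad1 (piNabla E v))) (outwardNormal E e)

/-- The local estimator `η_T²(E; v, D)`. -/
def etaLocSq (Ω : Set Pt) (T : Finset Tri) (DT : Tri → Coeff) (E : Tri) (v : Pt → ℝ) : ℝ :=
  E.h ^ 2 * (∫ x in E.carrier, residual DT E v x ^ 2) +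
    1 / 2 * ∑ e ∈ edges T E,
      E.h * ∫ _x in e, jump Ω T DT e v ^ 2 ∂(Measure.hausdorffMeasure 1)

/-- The global estimator `η_T²(v, D)`. -/
def etaSq (Ω : Set Pt) (T : Finset Tri) (DT : Tri → Coeff) (v : Pt → ℝ) : ℝ :=
  ∑ E ∈ T, etaLocSq Ω T DT E v

end

end VEM

open VEM

namespace VEM

noncomputable section

open scoped Classical

/-! ### Barycentric coordinates in the plane -/

/-! Let `w` be the conforming piecewise affine function, zero on ∂Ω, that agrees with `u` at the
proper nodes, and test the discrete equation with `z = u - w`. On every element `w` is affine, so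
`z` and `u` have the same interpolation error at the nodes and S(u,z) = S(u,u). Since ∇Πz is the
mean of ∇z, Green's formula turns the stiffness term into edge terms, and the equation reads γ
S(u,u) = Σ_E ∫_E (f - cΠu) Πz - Σ_e j(e) ∫_e z (`residual_identity`).

On ∂E the function `z` is affine between consecutive nodes, hence bounded by its nodal values; up to
a shape constant so is Πz on E (`IsPiNabla.abs_apply_le`). Cauchy–Schwarz then gives (γ S(u,u))² ≤ C
(Σ_E Σ_x z(x)²) η² (`sq_residual_le`).

It remains to bound Σ_E Σ_x z(x)² by C S(u,u) (`sum_sq_nodes_le`). At proper nodes `z` vanishes. A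
hanging node is the midpoint of two nodes of smaller index lying on one side of an element E; an
affine function reproduces midpoints, so z(x) is a combination of interpolation errors on E plus the
average of `z` at the two parents. Induction on the global index stops at Λ, and the constants stay
bounded because an element carries boundedly many nodes and a point belongs to boundedly many
elements. Division of γ² S² ≤ C S η² by S concludes.

Two groups of facts support this. The first is combinatorial: an edge whose midpoint hangs on E lies
in a side of E (`IsRefinement.edge_subset_side`), which reduces to nestedness of dyadic intervals
and also makes `w` well defined. The second is analytic: `w` belongs to H¹₀ (`memH10_of_lipschitz`),
continuous H¹₀ functions vanish on boundary sides (`Tri.trace_eq_zero`), and the divergence theorem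
holds on a triangle for weak gradients (`Tri.green`). -/

/-- Twice the signed area of the triangle with vertices `a`, `b`, `c`. -/
def det3 (a b c : Pt) : ℝ := (b 0 - a 0) * (c 1 - a 1) - (b 1 - a 1) * (c 0 - a 0)

theorem lineMap_coord (a b : Pt) (t : ℝ) (i : Fin 2) :
    (AffineMap.lineMap a b t : Pt) i = a i + t * (b i - a i) := by
  simp [AffineMap.lineMap_apply]; ring

theorem midpoint_coord (a b : Pt) (i : Fin 2) : (midpoint ℝ a b : Pt) i = (a i + b i) / 2 := by
  rw [midpoint, lineMap_coord]; simp; ring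

theorem pt_ext {x y : Pt} (h0 : x 0 = y 0) (h1 : x 1 = y 1) : x = y := by
  ext i; fin_cases i
  · exact h0
  · exact h1

theorem mem_segment_iff_lineMap {a b x : Pt} :
    x ∈ segment ℝ a b ↔ ∃ t ∈ Set.Icc (0 : ℝ) 1, AffineMap.lineMap a b t = x := by
  rw [segment_eq_image_lineMap]; rfl

theorem mem_convexHull_triple {a b c x : Pt} :
    x ∈ convexHull ℝ ({a, b, c} : Set Pt) ↔
      ∃ α β γ : ℝ, 0 ≤ α ∧ 0 ≤ β ∧ 0 ≤ γ ∧ α + β + γ = 1 ∧ α • a + β • b + γ • c = x := by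
  rw [convexHull_insert (by simp), convexHull_pair]
  simp only [convexJoin_singleton_left, Set.mem_iUnion, exists_prop]
  constructor
  · rintro ⟨y, ⟨p, q, hp, hq, hpq, rfl⟩, ⟨r, s, hr, hs, hrs, rfl⟩⟩
    refine ⟨r, s * p, s * q, hr, by positivity, by positivity, ?_, ?_⟩
    · rw [add_assoc, ← mul_add, hpq, mul_one, hrs]
    · simp only [smul_add, smul_smul, add_assoc]
  · rintro ⟨α, β, γ, hα, hβ, hγ, hs, rfl⟩
    rcases eq_or_lt_of_le (add_nonneg hβ hγ) with h | h
    · have hβ0 : β = 0 := by linarith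
      have hγ0 : γ = 0 := by linarith
      have hα1 : α = 1 := by linarith
      refine ⟨b, left_mem_segment ℝ b c, ?_⟩
      subst hβ0 hγ0 hα1
      simpa using left_mem_segment ℝ a b
    · refine ⟨(β / (β + γ)) • b + (γ / (β + γ)) • c,
        ⟨_, _, by positivity, by positivity, by field_simp, rfl⟩,
        ⟨α, β + γ, hα, h.le, by linarith, ?_⟩⟩
      simp only [smul_add, smul_smul]
      rw [mul_div_cancel₀ _ h.ne', mul_div_cancel₀ _ h.ne', add_assoc]

namespace Tri

/-- Twice the signed area of the triangle. -/
def D (E : Tri) : ℝ := det3 E.peak E.left E.right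
/-- Barycentric coordinate relative to the newest vertex. -/
def cP (E : Tri) (x : Pt) : ℝ := det3 E.left E.right x / E.D
/-- Barycentric coordinate relative to the left vertex. -/
def cL (E : Tri) (x : Pt) : ℝ := det3 E.right E.peak x / E.D
/-- Barycentric coordinate relative to the right vertex. -/
def cR (E : Tri) (x : Pt) : ℝ := det3 E.peak E.left x / E.D

variable {E : Tri}

theorem mem_verts {x : Pt} : x ∈ E.verts ↔ x = E.peak ∨ x = E.left ∨ x = E.right := by
  simp [verts]

theorem carrier_eq : E.carrier = convexHull ℝ ({E.peak, E.left, E.right} : Set Pt) := by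
  simp [carrier, verts]

theorem D_ne_zero (h : E.Nondegenerate) : E.D ≠ 0 := by
  intro h0
  rw [Nondegenerate, affineIndependent_iff_linearIndependent_vsub ℝ _ (0 : Fin 3)] at h
  have h2 : LinearIndependent ℝ ![E.left - E.peak, E.right - E.peak] := by
    have hinj : Function.Injective
        (fun i : Fin 2 => (⟨i.succ, Fin.succ_ne_zero i⟩ : {x : Fin 3 // x ≠ 0})) := by
      intro i j hij
      simpa using hij
    have h3 := h.comp _ hinj
    have e : ![E.left - E.peak, E.right - E.peak] =
        (fun i : {x : Fin 3 // x ≠ 0} => ![E.peak, E.left, E.right] i -ᵥ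
          ![E.peak, E.left, E.right] 0) ∘
        (fun i : Fin 2 => (⟨i.succ, Fin.succ_ne_zero i⟩ : {x : Fin 3 // x ≠ 0})) := by
      funext i; fin_cases i <;> simp
    rw [e]; exact h3
  rw [LinearIndependent.pair_iff] at h2
  simp only [D, det3] at h0
  -- If `D = 0`, the combination of the two edge vectors with these coefficients vanishes: one of
  -- its coordinates cancels identically, the other one is `±D`. Both choices of `i` then force all
  -- the coordinates of the edge vectors to be zero.
  have key := fun i : Fin 2 => h2 (E.right i - E.peak i) (-(E.left i - E.peak i))
  have k0 := key 0
  have k1 := key 1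
  have e0 : E.right 0 - E.peak 0 = 0 ∧ -(E.left 0 - E.peak 0) = 0 := by
    apply k0
    apply pt_ext
    · simp; ring
    · simp; linarith
  have e1 : E.right 1 - E.peak 1 = 0 ∧ -(E.left 1 - E.peak 1) = 0 := by
    apply k1
    apply pt_ext
    · simp; linarith
    · simp; ring
  have := h2 1 0 (by
    apply pt_ext
    · simp; linarith [e0.2]
    · simp; linarith [e1.2])
  exact one_ne_zero this.1

theorem coord_sum (hE : E.D ≠ 0) (x : Pt) : E.cP x + E.cL x + E.cR x = 1 := by
  simp only [cP, cL, cR]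
  rw [← add_div, ← add_div, div_eq_one_iff_eq hE]
  simp only [D, det3]; ring

theorem coord_smul (hE : E.D ≠ 0) (x : Pt) : E.cP x • E.peak + E.cL x • E.left + E.cR x • E.right = x := by
  apply pt_ext <;>
  · simp only [cP, cL, cR, PiLp.add_apply, PiLp.smul_apply, smul_eq_mul]
    field_simp
    simp only [D, det3]; ring

theorem cP_lineMap (x y : Pt) (t : ℝ) :
    E.cP (AffineMap.lineMap x y t) = (1 - t) * E.cP x + t * E.cP y := by
  simp only [cP, det3, lineMap_coord]; ring

theorem cL_lineMap (x y : Pt) (t : ℝ) :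
    E.cL (AffineMap.lineMap x y t) = (1 - t) * E.cL x + t * E.cL y := by
  simp only [cL, det3, lineMap_coord]; ring

theorem cR_lineMap (x y : Pt) (t : ℝ) :
    E.cR (AffineMap.lineMap x y t) = (1 - t) * E.cR x + t * E.cR y := by
  simp only [cR, det3, lineMap_coord]; ring

theorem coord_comb (hE : E.D ≠ 0) {α β γ : ℝ} (h : α + β + γ = 1) :
    E.cP (α • E.peak + β • E.left + γ • E.right) = α ∧
    E.cL (α • E.peak + β • E.left + γ • E.right) = β ∧
    E.cR (α • E.peak + β • E.left + γ • E.right) = γ := by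
  obtain rfl : α = 1 - β - γ := by linarith
  simp only [cP, cL, cR]
  refine ⟨?_, ?_, ?_⟩ <;>
  · rw [div_eq_iff hE]
    simp only [D, det3, PiLp.add_apply, PiLp.smul_apply, smul_eq_mul]; ring

theorem coord_peak (hE : E.D ≠ 0) : E.cP E.peak = 1 ∧ E.cL E.peak = 0 ∧ E.cR E.peak = 0 := by
  simpa using coord_comb hE (α := 1) (β := 0) (γ := 0) (by norm_num)

theorem coord_left (hE : E.D ≠ 0) : E.cP E.left = 0 ∧ E.cL E.left = 1 ∧ E.cR E.left = 0 := by
  simpa using coord_comb hE (α := 0) (β := 1) (γ := 0) (by norm_num)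

theorem coord_right (hE : E.D ≠ 0) : E.cP E.right = 0 ∧ E.cL E.right = 0 ∧ E.cR E.right = 1 := by
  simpa using coord_comb hE (α := 0) (β := 0) (γ := 1) (by norm_num)

theorem mem_carrier_iff (hE : E.D ≠ 0) {x : Pt} :
    x ∈ E.carrier ↔ 0 ≤ E.cP x ∧ 0 ≤ E.cL x ∧ 0 ≤ E.cR x := by
  rw [carrier_eq, mem_convexHull_triple]
  constructor
  · rintro ⟨α, β, γ, hα, hβ, hγ, hs, rfl⟩
    obtain ⟨h1, h2, h3⟩ := coord_comb hE hs
    rw [h1, h2, h3]; exact ⟨hα, hβ, hγ⟩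
  · rintro ⟨h1, h2, h3⟩
    exact ⟨_, _, _, h1, h2, h3, coord_sum hE x, coord_smul hE x⟩

theorem eq_peak (hE : E.D ≠ 0) {x : Pt} (h1 : E.cL x = 0) (h2 : E.cR x = 0) : x = E.peak := by
  have h3 : E.cP x = 1 := by have := coord_sum hE x; linarith
  rw [← coord_smul hE x, h1, h2, h3]; simp

theorem eq_left (hE : E.D ≠ 0) {x : Pt} (h1 : E.cP x = 0) (h2 : E.cR x = 0) : x = E.left := by
  have h3 : E.cL x = 1 := by have := coord_sum hE x; linarith
  rw [← coord_smul hE x, h1, h2, h3]; simp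

theorem eq_right (hE : E.D ≠ 0) {x : Pt} (h1 : E.cP x = 0) (h2 : E.cL x = 0) : x = E.right := by
  have h3 : E.cR x = 1 := by have := coord_sum hE x; linarith
  rw [← coord_smul hE x, h1, h2, h3]; simp

theorem peak_ne_left (hE : E.D ≠ 0) : E.peak ≠ E.left := fun h => by
  have := (coord_peak hE).1; rw [h, (coord_left hE).1] at this; norm_num at this

theorem peak_ne_right (hE : E.D ≠ 0) : E.peak ≠ E.right := fun h => by
  have := (coord_peak hE).1; rw [h, (coord_right hE).1] at this; norm_num at this

theorem left_ne_right (hE : E.D ≠ 0) : E.left ≠ E.right := fun h => by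
  have := (coord_left hE).2.1; rw [h, (coord_right hE).2.1] at this; norm_num at this

theorem card_verts (hE : E.D ≠ 0) : E.verts.card = 3 :=
  Finset.card_eq_three.2 ⟨_, _, _, peak_ne_left hE, peak_ne_right hE, left_ne_right hE, rfl⟩

theorem verts_subset_carrier {x : Pt} (hx : x ∈ E.verts) : x ∈ E.carrier :=
  subset_convexHull ℝ _ (by exact_mod_cast hx)

theorem convex_carrier : Convex ℝ E.carrier := convex_convexHull ℝ _

theorem isCompact_carrier : IsCompact E.carrier :=
  (E.verts.finite_toSet).isCompact_convexHull ℝ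

theorem continuous_cP : Continuous E.cP := by unfold cP det3; fun_prop
theorem continuous_cL : Continuous E.cL := by unfold cL det3; fun_prop
theorem continuous_cR : Continuous E.cR := by unfold cR det3; fun_prop

theorem mem_interior_iff (hE : E.D ≠ 0) {x : Pt} :
    x ∈ interior E.carrier ↔ 0 < E.cP x ∧ 0 < E.cL x ∧ 0 < E.cR x := by
  constructor
  · intro hx
    -- From an interior point one can move slightly away from any vertex `y`. The coordinate `c` of
    -- that vertex becomes `(1 - t) c + t` with `t < 0`, and can remain nonnegative only if `c > 0`.
    have key : ∀ y : Pt, ∃ t : ℝ, t < 0 ∧ AffineMap.lineMap x y t ∈ E.carrier := by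
      intro y
      have hc : Continuous fun t : ℝ => (AffineMap.lineMap x y t : Pt) :=
        AffineMap.lineMap_continuous
      have h0 : (fun t : ℝ => (AffineMap.lineMap x y t : Pt)) ⁻¹' (interior E.carrier) ∈ 𝓝 (0 : ℝ) :=
        hc.continuousAt.preimage_mem_nhds (by simpa using isOpen_interior.mem_nhds hx)
      obtain ⟨ε, hε, h⟩ := Metric.mem_nhds_iff.1 h0
      refine ⟨-(ε / 2), by linarith, interior_subset (h ?_)⟩
      rw [Metric.mem_ball, Real.dist_eq, sub_zero, abs_neg, abs_of_pos (by linarith)]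
      linarith
    refine ⟨?_, ?_, ?_⟩
    · obtain ⟨t, ht, hm⟩ := key E.peak
      have := ((mem_carrier_iff hE).1 hm).1
      rw [cP_lineMap, (coord_peak hE).1] at this
      nlinarith
    · obtain ⟨t, ht, hm⟩ := key E.left
      have := ((mem_carrier_iff hE).1 hm).2.1
      rw [cL_lineMap, (coord_left hE).2.1] at this
      nlinarith
    · obtain ⟨t, ht, hm⟩ := key E.right
      have := ((mem_carrier_iff hE).1 hm).2.2
      rw [cR_lineMap, (coord_right hE).2.2] at this
      nlinarith
  · intro h
    have ho : IsOpen {y : Pt | 0 < E.cP y ∧ 0 < E.cL y ∧ 0 < E.cR y} :=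
      (isOpen_lt continuous_const continuous_cP).inter
        ((isOpen_lt continuous_const continuous_cL).inter
          (isOpen_lt continuous_const continuous_cR))
    exact interior_maximal (fun y hy => (mem_carrier_iff hE).2 ⟨hy.1.le, hy.2.1.le, hy.2.2.le⟩)
      ho h

theorem mem_frontier_iff (hE : E.D ≠ 0) {x : Pt} :
    x ∈ frontier E.carrier ↔ x ∈ E.carrier ∧ (E.cP x = 0 ∨ E.cL x = 0 ∨ E.cR x = 0) := by
  rw [frontier, isCompact_carrier.isClosed.closure_eq, Set.mem_sdiff, mem_interior_iff hE]
  constructor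
  · rintro ⟨h, h'⟩
    refine ⟨h, ?_⟩
    by_contra! hc
    obtain ⟨h1, h2, h3⟩ := (mem_carrier_iff hE).1 h
    exact h' ⟨h1.lt_of_ne' hc.1, h2.lt_of_ne' hc.2.1, h3.lt_of_ne' hc.2.2⟩
  · rintro ⟨h, h'⟩
    refine ⟨h, fun hc => ?_⟩
    rcases h' with h' | h' | h' <;> rw [h'] at hc <;> simp at hc

theorem mem_segment_left_right (hE : E.D ≠ 0) {x : Pt} :
    x ∈ segment ℝ E.left E.right ↔ x ∈ E.carrier ∧ E.cP x = 0 := by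
  constructor
  · intro hx
    refine ⟨E.convex_carrier.segment_subset (verts_subset_carrier (mem_verts.2 (by simp)))
      (verts_subset_carrier (mem_verts.2 (by simp))) hx, ?_⟩
    obtain ⟨t, -, rfl⟩ := mem_segment_iff_lineMap.1 hx
    rw [cP_lineMap, (coord_left hE).1, (coord_right hE).1]; ring
  · rintro ⟨hx, h0⟩
    obtain ⟨-, h2, h3⟩ := (mem_carrier_iff hE).1 hx
    have := coord_sum hE x
    have h := coord_smul hE x
    rw [h0, zero_smul, zero_add] at h
    exact ⟨_, _, h2, h3, by linarith, h⟩

theorem mem_segment_peak_right (hE : E.D ≠ 0) {x : Pt} :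
    x ∈ segment ℝ E.peak E.right ↔ x ∈ E.carrier ∧ E.cL x = 0 := by
  constructor
  · intro hx
    refine ⟨E.convex_carrier.segment_subset (verts_subset_carrier (mem_verts.2 (by simp)))
      (verts_subset_carrier (mem_verts.2 (by simp))) hx, ?_⟩
    obtain ⟨t, -, rfl⟩ := mem_segment_iff_lineMap.1 hx
    rw [cL_lineMap, (coord_peak hE).2.1, (coord_right hE).2.1]; ring
  · rintro ⟨hx, h0⟩
    obtain ⟨h1, -, h3⟩ := (mem_carrier_iff hE).1 hx
    have := coord_sum hE x
    have h := coord_smul hE x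
    rw [h0, zero_smul, add_zero] at h
    exact ⟨_, _, h1, h3, by linarith, h⟩

theorem mem_segment_peak_left (hE : E.D ≠ 0) {x : Pt} :
    x ∈ segment ℝ E.peak E.left ↔ x ∈ E.carrier ∧ E.cR x = 0 := by
  constructor
  · intro hx
    refine ⟨E.convex_carrier.segment_subset (verts_subset_carrier (mem_verts.2 (by simp)))
      (verts_subset_carrier (mem_verts.2 (by simp))) hx, ?_⟩
    obtain ⟨t, -, rfl⟩ := mem_segment_iff_lineMap.1 hx
    rw [cR_lineMap, (coord_peak hE).2.2, (coord_left hE).2.2]; ring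
  · rintro ⟨hx, h0⟩
    obtain ⟨h1, h2, -⟩ := (mem_carrier_iff hE).1 hx
    have := coord_sum hE x
    have h := coord_smul hE x
    rw [h0, zero_smul, add_zero] at h
    exact ⟨_, _, h1, h2, by linarith, h⟩

/-! ### Children -/

theorem D_child₁ : E.child₁.D = E.D / 2 := by
  simp only [D, det3, child₁, mid, midpoint_coord]; ring

theorem D_child₂ : E.child₂.D = -(E.D / 2) := by
  simp only [D, det3, child₂, mid, midpoint_coord]; ring

/-- The median from the newest vertex is the line `cL = cR`, so each child is cut out of its parent
by the sign of `cL - cR`. Nestedness and the contact between siblings are read off these formulas.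
-/
theorem coord_child₁ (hE : E.D ≠ 0) (x : Pt) : E.child₁.cP x = 2 * E.cR x ∧
    E.child₁.cL x = E.cP x ∧ E.child₁.cR x = E.cL x - E.cR x := by
  simp only [cP, cL, cR, D_child₁]
  refine ⟨?_, ?_, ?_⟩ <;> field_simp <;> simp only [det3, child₁, mid, midpoint_coord] <;> ring

theorem coord_child₂ (hE : E.D ≠ 0) (x : Pt) : E.child₂.cP x = 2 * E.cL x ∧
    E.child₂.cL x = E.cP x ∧ E.child₂.cR x = E.cR x - E.cL x := by
  simp only [cP, cL, cR, D_child₂]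
  refine ⟨?_, ?_, ?_⟩ <;> field_simp <;> simp only [det3, child₂, mid, midpoint_coord] <;> ring

theorem D_child₁_ne (hE : E.D ≠ 0) : E.child₁.D ≠ 0 := by
  rw [D_child₁]; exact div_ne_zero hE two_ne_zero

theorem D_child₂_ne (hE : E.D ≠ 0) : E.child₂.D ≠ 0 := by
  rw [D_child₂]; exact neg_ne_zero.2 (div_ne_zero hE two_ne_zero)

theorem mem_child₁ (hE : E.D ≠ 0) {x : Pt} :
    x ∈ E.child₁.carrier ↔ x ∈ E.carrier ∧ E.cR x ≤ E.cL x := by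
  obtain ⟨h1, h2, h3⟩ := coord_child₁ hE x
  rw [mem_carrier_iff (D_child₁_ne hE), mem_carrier_iff hE, h1, h2, h3]
  constructor
  · rintro ⟨a, b, c⟩; refine ⟨⟨?_, ?_, ?_⟩, ?_⟩ <;> linarith
  · rintro ⟨⟨a, b, c⟩, d⟩; refine ⟨?_, ?_, ?_⟩ <;> linarith

theorem mem_child₂ (hE : E.D ≠ 0) {x : Pt} :
    x ∈ E.child₂.carrier ↔ x ∈ E.carrier ∧ E.cL x ≤ E.cR x := by
  obtain ⟨h1, h2, h3⟩ := coord_child₂ hE x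
  rw [mem_carrier_iff (D_child₂_ne hE), mem_carrier_iff hE, h1, h2, h3]
  constructor
  · rintro ⟨a, b, c⟩; refine ⟨⟨?_, ?_, ?_⟩, ?_⟩ <;> linarith
  · rintro ⟨⟨a, b, c⟩, d⟩; refine ⟨?_, ?_, ?_⟩ <;> linarith

theorem carrier_eq_children (hE : E.D ≠ 0) :
    E.carrier = E.child₁.carrier ∪ E.child₂.carrier := by
  ext x
  rw [Set.mem_union, mem_child₁ hE, mem_child₂ hE, ← and_or_left]
  simp [le_total]

theorem coord_mid (hE : E.D ≠ 0) : E.cP E.mid = 0 ∧ E.cL E.mid = 1 / 2 ∧ E.cR E.mid = 1 / 2 := by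
  have : E.mid = (0 : ℝ) • E.peak + (1 / 2 : ℝ) • E.left + (1 / 2 : ℝ) • E.right := by
    apply pt_ext <;> simp [mid, midpoint_coord] <;> ring
  rw [this]; exact coord_comb hE (by norm_num)

theorem mid_not_mem_verts (hE : E.D ≠ 0) : E.mid ∉ E.verts := by
  rw [mem_verts]
  obtain ⟨h1, h2, h3⟩ := coord_mid hE
  rintro (h | h | h) <;> rw [h] at h1 h2 h3
  · rw [(coord_peak hE).1] at h1; norm_num at h1
  · rw [(coord_left hE).2.1] at h2; norm_num at h2
  · rw [(coord_right hE).2.2] at h3; norm_num at h3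

theorem mid_mem_carrier (hE : E.D ≠ 0) : E.mid ∈ E.carrier := by
  obtain ⟨h1, h2, h3⟩ := coord_mid hE
  rw [mem_carrier_iff hE, h1, h2, h3]; norm_num

end Tri

/-! ### The forest of newest-vertex bisections -/

/-- `Desc F E`: the triangle `E` is obtained from `F` by successive bisections. -/
inductive Desc : Tri → Tri → Prop
  | refl (E : Tri) : Desc E E
  | left {F E : Tri} : Desc F.child₁ E → Desc F E
  | right {F E : Tri} : Desc F.child₂ E → Desc F E

namespace Desc

theorem trans {F G E : Tri} (h : Desc F G) (h' : Desc G E) : Desc F E := by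
  induction h with
  | refl => exact h'
  | left _ ih => exact left (ih h')
  | right _ ih => exact right (ih h')

theorem D_ne {F E : Tri} (h : Desc F E) (hF : F.D ≠ 0) : E.D ≠ 0 := by
  induction h with
  | refl => exact hF
  | left _ ih => exact ih (Tri.D_child₁_ne hF)
  | right _ ih => exact ih (Tri.D_child₂_ne hF)

theorem subset {F E : Tri} (h : Desc F E) (hF : F.D ≠ 0) : E.carrier ⊆ F.carrier := by
  induction h with
  | refl => exact subset_rfl
  | left _ ih =>
    exact (ih (Tri.D_child₁_ne hF)).trans fun x hx => ((Tri.mem_child₁ hF).1 hx).1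
  | right _ ih =>
    exact (ih (Tri.D_child₂_ne hF)).trans fun x hx => ((Tri.mem_child₂ hF).1 hx).1

/-- Bisection never loses a vertex: the only vertex of `F` missing from a child lies strictly on the
other side of the median, hence outside that child and all its descendants. -/
theorem vert_mem {F E : Tri} (h : Desc F E) (hF : F.D ≠ 0) {v : Pt} (hv : v ∈ F.verts)
    (hvE : v ∈ E.carrier) : v ∈ E.verts := by
  induction h with
  | refl => exact hv
  | @left F E h ih =>
    refine ih (Tri.D_child₁_ne hF) ?_ hvE
    have h1 := ((Tri.mem_child₁ hF).1 (h.subset (Tri.D_child₁_ne hF) hvE)).2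
    rcases Tri.mem_verts.1 hv with rfl | rfl | rfl
    · simp [Tri.mem_verts, Tri.child₁]
    · simp [Tri.mem_verts, Tri.child₁]
    · rw [(Tri.coord_right hF).2.1, (Tri.coord_right hF).2.2] at h1; norm_num at h1
  | @right F E h ih =>
    refine ih (Tri.D_child₂_ne hF) ?_ hvE
    have h1 := ((Tri.mem_child₂ hF).1 (h.subset (Tri.D_child₂_ne hF) hvE)).2
    rcases Tri.mem_verts.1 hv with rfl | rfl | rfl
    · simp [Tri.mem_verts, Tri.child₂]
    · rw [(Tri.coord_left hF).2.1, (Tri.coord_left hF).2.2] at h1; norm_num at h1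
    · simp [Tri.mem_verts, Tri.child₂]

end Desc

/-- The point with parameter `t` on `[a, b]` belongs to a side of `E` which is a dyadic subinterval
of `[a, b]`. -/
def OnDyadicSide (a b : Pt) (E : Tri) (t : ℝ) (n k : ℕ) : Prop :=
  k + 1 ≤ 2 ^ n ∧ (AffineMap.lineMap a b ((k : ℝ) / 2 ^ n) : Pt) ∈ E.verts ∧
    (AffineMap.lineMap a b (((k : ℝ) + 1) / 2 ^ n) : Pt) ∈ E.verts ∧
    (k : ℝ) / 2 ^ n ≤ t ∧ t ≤ ((k : ℝ) + 1) / 2 ^ n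

theorem lineMap_first_half (a b : Pt) (t : ℝ) :
    (AffineMap.lineMap a (midpoint ℝ a b) t : Pt) = AffineMap.lineMap a b (t / 2) := by
  apply pt_ext <;> simp only [lineMap_coord, midpoint_coord] <;> ring

theorem lineMap_second_half (a b : Pt) (t : ℝ) :
    (AffineMap.lineMap (midpoint ℝ a b) b t : Pt) = AffineMap.lineMap a b ((1 + t) / 2) := by
  apply pt_ext <;> simp only [lineMap_coord, midpoint_coord] <;> ring

theorem OnDyadicSide.first_half {a b : Pt} {E : Tri} {t : ℝ} {n k : ℕ}
    (h : OnDyadicSide a (midpoint ℝ a b) E t n k) : OnDyadicSide a b E (t / 2) (n + 1) k := by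
  obtain ⟨h1, h2, h3, h4, h5⟩ := h
  rw [lineMap_first_half, div_div, ← pow_succ] at h2 h3
  refine ⟨by rw [pow_succ]; omega, h2, h3, ?_, ?_⟩
  · rw [pow_succ, ← div_div]; linarith
  · rw [pow_succ, ← div_div]; linarith

theorem OnDyadicSide.second_half {a b : Pt} {E : Tri} {t : ℝ} {n k : ℕ}
    (h : OnDyadicSide (midpoint ℝ a b) b E t n k) :
    OnDyadicSide a b E ((1 + t) / 2) (n + 1) (2 ^ n + k) := by
  obtain ⟨h1, h2, h3, h4, h5⟩ := h
  rw [lineMap_second_half] at h2 h3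
  have e1 : (((2 ^ n + k : ℕ) : ℝ)) / 2 ^ (n + 1) = (1 + k / 2 ^ n) / 2 := by
    push_cast; rw [pow_succ]; field_simp
  have e2 : (((2 ^ n + k : ℕ) : ℝ) + 1) / 2 ^ (n + 1) = (1 + (k + 1) / 2 ^ n) / 2 := by
    push_cast; rw [pow_succ]; field_simp; ring
  refine ⟨by rw [pow_succ]; omega, by rwa [e1], by rwa [e2], ?_, ?_⟩
  · rw [e1]; linarith
  · rw [e2]; linarith

/-- Induction on the generation. A side of `F` through the newest vertex is a side of one child and
meets the other child only at the newest vertex, which stays a vertex and is excluded by `hx'`. The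
bisection edge is shared between the children as two halves, and the dyadic level grows by one. -/
theorem Desc.onDyadicSide {F E : Tri} (h : Desc F E) (hF : F.D ≠ 0) {a b : Pt} (ha : a ∈ F.verts)
    (hb : b ∈ F.verts) (hab : a ≠ b) {t : ℝ} (ht : t ∈ Set.Icc (0 : ℝ) 1)
    (hx : (AffineMap.lineMap a b t : Pt) ∈ E.carrier)
    (hx' : (AffineMap.lineMap a b t : Pt) ∉ E.verts) : ∃ n k, OnDyadicSide a b E t n k := by
  induction h generalizing a b t with
  | refl => exact ⟨0, 0, by simp, by simpa using ha, by simpa using hb, by simpa using ht.1,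
      by simpa using ht.2⟩
  | @left F E h ih =>
    have hc := Tri.D_child₁_ne hF
    have hm := (Tri.mem_child₁ hF).1 (h.subset hc hx)
    have P1 : F.peak ∈ F.child₁.verts := by simp [Tri.mem_verts, Tri.child₁]
    have P2 : F.left ∈ F.child₁.verts := by simp [Tri.mem_verts, Tri.child₁]
    have P3 : F.mid ∈ F.child₁.verts := by simp [Tri.mem_verts, Tri.child₁]
    -- On `child₁` one has `cR ≤ cL`, so `cL = 0` leaves only the newest vertex.
    have nolow : F.cL (AffineMap.lineMap a b t) = 0 → False := fun h0 => by
      have h1 : F.cR (AffineMap.lineMap a b t) = 0 :=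
        le_antisymm (hm.2.trans h0.le) ((Tri.mem_carrier_iff hF).1 hm.1).2.2
      rw [Tri.eq_peak hF h0 h1] at hx hx'
      exact hx' (h.vert_mem hc P1 hx)
    have hlm : F.left ≠ F.mid := fun e => Tri.mid_not_mem_verts hF (e ▸ Tri.mem_verts.2 (by simp))
    rcases Tri.mem_verts.1 ha with rfl | rfl | rfl <;> rcases Tri.mem_verts.1 hb with rfl | rfl | rfl
    · exact absurd rfl hab
    · exact ih hc P1 P2 hab ht hx hx'
    · exact (nolow (by rw [Tri.cL_lineMap, (Tri.coord_peak hF).2.1, (Tri.coord_right hF).2.1]; ring)).elim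
    · exact ih hc P2 P1 hab ht hx hx'
    · exact absurd rfl hab
    · have h2 := hm.2
      rw [Tri.cL_lineMap, Tri.cR_lineMap, (Tri.coord_left hF).2.1, (Tri.coord_left hF).2.2,
        (Tri.coord_right hF).2.1, (Tri.coord_right hF).2.2] at h2
      have e : (AffineMap.lineMap F.left F.right t : Pt) = AffineMap.lineMap F.left F.mid (2 * t) := by
        rw [Tri.mid, lineMap_first_half]; congr 1; ring
      rw [e] at hx hx'
      obtain ⟨n, k, hk⟩ := ih hc P2 P3 hlm ⟨by linarith [ht.1], by linarith⟩ hx hx'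
      have := hk.first_half
      rw [mul_div_cancel_left₀ t two_ne_zero] at this
      exact ⟨_, _, this⟩
    · exact (nolow (by rw [Tri.cL_lineMap, (Tri.coord_peak hF).2.1, (Tri.coord_right hF).2.1]; ring)).elim
    · have h2 := hm.2
      rw [Tri.cL_lineMap, Tri.cR_lineMap, (Tri.coord_left hF).2.1, (Tri.coord_left hF).2.2,
        (Tri.coord_right hF).2.1, (Tri.coord_right hF).2.2] at h2
      have e : (AffineMap.lineMap F.right F.left t : Pt) =
          AffineMap.lineMap F.mid F.left (2 * t - 1) := by
        rw [Tri.mid, midpoint_comm, lineMap_second_half]; congr 1; ring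
      rw [e] at hx hx'
      obtain ⟨n, k, hk⟩ := ih hc P3 P2 hlm.symm ⟨by linarith, by linarith [ht.2]⟩ hx hx'
      rw [Tri.mid, midpoint_comm] at hk
      have := hk.second_half
      rw [show (1 + (2 * t - 1)) / 2 = t by ring] at this
      exact ⟨_, _, this⟩
    · exact absurd rfl hab
  | @right F E h ih =>
    have hc := Tri.D_child₂_ne hF
    have hm := (Tri.mem_child₂ hF).1 (h.subset hc hx)
    have P1 : F.peak ∈ F.child₂.verts := by simp [Tri.mem_verts, Tri.child₂]
    have P2 : F.right ∈ F.child₂.verts := by simp [Tri.mem_verts, Tri.child₂]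
    have P3 : F.mid ∈ F.child₂.verts := by simp [Tri.mem_verts, Tri.child₂]
    have nolow : F.cR (AffineMap.lineMap a b t) = 0 → False := fun h0 => by
      have h1 : F.cL (AffineMap.lineMap a b t) = 0 :=
        le_antisymm (hm.2.trans h0.le) ((Tri.mem_carrier_iff hF).1 hm.1).2.1
      rw [Tri.eq_peak hF h1 h0] at hx hx'
      exact hx' (h.vert_mem hc P1 hx)
    have hlm : F.right ≠ F.mid := fun e => Tri.mid_not_mem_verts hF (e ▸ Tri.mem_verts.2 (by simp))
    rcases Tri.mem_verts.1 ha with rfl | rfl | rfl <;> rcases Tri.mem_verts.1 hb with rfl | rfl | rfl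
    · exact absurd rfl hab
    · exact (nolow (by rw [Tri.cR_lineMap, (Tri.coord_peak hF).2.2, (Tri.coord_left hF).2.2]; ring)).elim
    · exact ih hc P1 P2 hab ht hx hx'
    · exact (nolow (by rw [Tri.cR_lineMap, (Tri.coord_peak hF).2.2, (Tri.coord_left hF).2.2]; ring)).elim
    · exact absurd rfl hab
    · have h2 := hm.2
      rw [Tri.cL_lineMap, Tri.cR_lineMap, (Tri.coord_left hF).2.1, (Tri.coord_left hF).2.2,
        (Tri.coord_right hF).2.1, (Tri.coord_right hF).2.2] at h2
      have e : (AffineMap.lineMap F.left F.right t : Pt) =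
          AffineMap.lineMap F.mid F.right (2 * t - 1) := by
        rw [Tri.mid, lineMap_second_half]; congr 1; ring
      rw [e] at hx hx'
      obtain ⟨n, k, hk⟩ := ih hc P3 P2 hlm.symm ⟨by linarith, by linarith [ht.2]⟩ hx hx'
      have := hk.second_half
      rw [show (1 + (2 * t - 1)) / 2 = t by ring] at this
      exact ⟨_, _, this⟩
    · exact ih hc P2 P1 hab ht hx hx'
    · have h2 := hm.2
      rw [Tri.cL_lineMap, Tri.cR_lineMap, (Tri.coord_left hF).2.1, (Tri.coord_left hF).2.2,
        (Tri.coord_right hF).2.1, (Tri.coord_right hF).2.2] at h2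
      have e : (AffineMap.lineMap F.right F.left t : Pt) = AffineMap.lineMap F.right F.mid (2 * t) := by
        rw [Tri.mid, midpoint_comm, lineMap_first_half]; congr 1; ring
      rw [e] at hx hx'
      obtain ⟨n, k, hk⟩ := ih hc P2 P3 hlm ⟨by linarith [ht.1], by linarith⟩ hx hx'
      rw [Tri.mid, midpoint_comm] at hk
      have := hk.first_half
      rw [mul_div_cancel_left₀ t two_ne_zero] at this
      exact ⟨_, _, this⟩
    · exact absurd rfl hab

/-! ### Pairs of triangles of the forest -/

/-- Two distinct triangles meeting exactly in the convex hull of their common vertices. -/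
def Compat (F₁ F₂ : Tri) : Prop :=
  F₁.verts ≠ F₂.verts ∧
    F₁.carrier ∩ F₂.carrier = convexHull ℝ ((F₁.verts ∩ F₂.verts : Finset Pt) : Set Pt)

/-- Siblings meet along the median, where the third coordinate of `child₁`, namely `cL - cR`,
vanishes. -/
theorem compat_children {F : Tri} (hF : F.D ≠ 0) : Compat F.child₁ F.child₂ := by
  have hi : F.child₁.verts ∩ F.child₂.verts = {F.mid, F.peak} := by
    ext x
    have h1 := F.peak_ne_left hF
    have h2 := F.left_ne_right hF
    have h3 : F.left ≠ F.mid := fun e => Tri.mid_not_mem_verts hF (e ▸ Tri.mem_verts.2 (by simp))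
    simp only [Finset.mem_inter, Tri.mem_verts, Tri.child₁, Tri.child₂, Finset.mem_insert,
      Finset.mem_singleton]
    constructor
    · rintro ⟨h | h | h, h' | h' | h'⟩ <;> simp_all
    · rintro (h | h) <;> simp [h]
  constructor
  · intro h
    rw [← h, Finset.inter_self] at hi
    have h3 := Tri.card_verts (Tri.D_child₁_ne hF)
    rw [hi] at h3
    have := Finset.card_le_two (a := F.mid) (b := F.peak)
    omega
  · rw [hi]
    simp only [Finset.coe_insert, Finset.coe_singleton, convexHull_pair]
    ext x
    have := Tri.mem_segment_peak_left (Tri.D_child₁_ne hF) (x := x)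
    rw [(Tri.coord_child₁ hF x).2.2] at this
    change x ∈ segment ℝ F.mid F.peak ↔ _ at this
    rw [this, Set.mem_inter_iff, Tri.mem_child₁ hF, Tri.mem_child₂ hF]
    constructor
    · rintro ⟨⟨h1, h2⟩, -, h3⟩; exact ⟨⟨h1, h2⟩, by linarith⟩
    · rintro ⟨⟨h1, h2⟩, h3⟩; exact ⟨⟨h1, h2⟩, h1, by linarith⟩

/-- Two triangles of the forest which descend from two compatible triangles. -/
def Separated (E₁ E₂ : Tri) : Prop :=
  ∃ F₁ F₂, Desc F₁ E₁ ∧ Desc F₂ E₂ ∧ F₁.D ≠ 0 ∧ F₂.D ≠ 0 ∧ Compat F₁ F₂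

theorem Compat.symm {F₁ F₂ : Tri} (h : Compat F₁ F₂) : Compat F₂ F₁ :=
  ⟨h.1.symm, by rw [Set.inter_comm, Finset.inter_comm]; exact h.2⟩

theorem Separated.symm {E₁ E₂ : Tri} : Separated E₁ E₂ → Separated E₂ E₁ :=
  fun ⟨F₁, F₂, h1, h2, h3, h4, h5⟩ => ⟨F₂, F₁, h2, h1, h4, h3, h5.symm⟩

/-- A common point of two compatible triangles is a common vertex or belongs to a common side. -/
theorem Compat.cases {F₁ F₂ : Tri} (h : Compat F₁ F₂) (h₁ : F₁.D ≠ 0) (h₂ : F₂.D ≠ 0) {x : Pt}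
    (hx₁ : x ∈ F₁.carrier) (hx₂ : x ∈ F₂.carrier) :
    (x ∈ F₁.verts ∧ x ∈ F₂.verts) ∨ ∃ a b, a ≠ b ∧ a ∈ F₁.verts ∧ b ∈ F₁.verts ∧ a ∈ F₂.verts ∧
      b ∈ F₂.verts ∧ x ∈ segment ℝ a b := by
  have hx : x ∈ F₁.carrier ∩ F₂.carrier := ⟨hx₁, hx₂⟩
  rw [h.2] at hx
  have hc : (F₁.verts ∩ F₂.verts).card < 3 := by
    by_contra hc
    push Not at hc
    have e1 : F₁.verts ∩ F₂.verts = F₁.verts :=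
      Finset.eq_of_subset_of_card_le Finset.inter_subset_left (by rw [Tri.card_verts h₁]; exact hc)
    have e2 : F₁.verts ∩ F₂.verts = F₂.verts :=
      Finset.eq_of_subset_of_card_le Finset.inter_subset_right (by rw [Tri.card_verts h₂]; exact hc)
    exact h.1 (e1.symm.trans e2)
  have hmem : ∀ y ∈ F₁.verts ∩ F₂.verts, y ∈ F₁.verts ∧ y ∈ F₂.verts := fun y hy =>
    Finset.mem_inter.1 hy
  generalize F₁.verts ∩ F₂.verts = S at hx hc hmem
  interval_cases hS : S.card
  · rw [Finset.card_eq_zero] at hS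
    subst hS; simp at hx
  · obtain ⟨y, rfl⟩ := Finset.card_eq_one.1 hS
    simp only [Finset.coe_singleton, convexHull_singleton, Set.mem_singleton_iff] at hx
    subst hx
    exact Or.inl (hmem _ (by simp))
  · obtain ⟨a, b, hab, rfl⟩ := Finset.card_eq_two.1 hS
    simp only [Finset.coe_insert, Finset.coe_singleton, convexHull_pair] at hx
    exact Or.inr ⟨a, b, hab, (hmem a (by simp)).1, (hmem b (by simp)).1, (hmem a (by simp)).2,
      (hmem b (by simp)).2, hx⟩

/-- The compatible ancestors meet in a vertex or a common side `[a, b]`. In the second case both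
descendants see the point through dyadic subintervals of one and the same segment, so the relative
position of two elements becomes arithmetic of dyadic intervals. -/
theorem Separated.contact {E₁ E₂ : Tri} (h : Separated E₁ E₂) {x : Pt}
    (hx₁ : x ∈ E₁.carrier) (hx₂ : x ∈ E₂.carrier) :
    (x ∈ E₁.verts ∧ x ∈ E₂.verts) ∨ ∃ a b, ∃ t : ℝ, a ≠ b ∧ AffineMap.lineMap a b t = x ∧
      (x ∉ E₁.verts → ∃ n k, OnDyadicSide a b E₁ t n k) ∧
      (x ∉ E₂.verts → ∃ n k, OnDyadicSide a b E₂ t n k) := by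
  obtain ⟨F₁, F₂, d₁, d₂, hF₁, hF₂, hc⟩ := h
  rcases hc.cases hF₁ hF₂ (d₁.subset hF₁ hx₁) (d₂.subset hF₂ hx₂) with ⟨h1, h2⟩ | h
  · exact Or.inl ⟨d₁.vert_mem hF₁ h1 hx₁, d₂.vert_mem hF₂ h2 hx₂⟩
  · obtain ⟨a, b, hab, ha₁, hb₁, ha₂, hb₂, hx⟩ := h
    obtain ⟨t, ht, rfl⟩ := mem_segment_iff_lineMap.1 hx
    exact Or.inr ⟨a, b, t, hab, rfl, d₁.onDyadicSide hF₁ ha₁ hb₁ hab ht hx₁,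
      d₂.onDyadicSide hF₂ ha₂ hb₂ hab ht hx₂⟩

/-! ### Dyadic intervals -/

/-- After clearing denominators the strict inequalities compare integers, so each of them improves
by one unit of the finer grid. -/
theorem dyadic_nested {n₁ k₁ n₂ k₂ : ℕ} {t : ℝ} (h₁ : (k₁ : ℝ) / 2 ^ n₁ < t)
    (h₁' : t < ((k₁ : ℝ) + 1) / 2 ^ n₁) (h₂ : (k₂ : ℝ) / 2 ^ n₂ < t)
    (h₂' : t < ((k₂ : ℝ) + 1) / 2 ^ n₂) (hn : n₁ ≤ n₂) :
    (k₁ : ℝ) / 2 ^ n₁ ≤ (k₂ : ℝ) / 2 ^ n₂ ∧ ((k₂ : ℝ) + 1) / 2 ^ n₂ ≤ ((k₁ : ℝ) + 1) / 2 ^ n₁ := by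
  obtain ⟨d, rfl⟩ := Nat.exists_eq_add_of_le hn
  have hp : (0 : ℝ) < 2 ^ n₁ := by positivity
  have hq : (0 : ℝ) < 2 ^ d := by positivity
  have a1 := h₁.trans h₂'
  have a2 := h₂.trans h₁'
  rw [pow_add, div_lt_div_iff₀ hp (by positivity)] at a1
  rw [pow_add, div_lt_div_iff₀ (by positivity) hp] at a2
  have b1 : (k₁ : ℝ) * 2 ^ d < k₂ + 1 := by
    refine lt_of_mul_lt_mul_right (a := (2 : ℝ) ^ n₁) ?_ hp.le
    linarith
  have b2 : (k₂ : ℝ) < (k₁ + 1) * 2 ^ d := by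
    refine lt_of_mul_lt_mul_right (a := (2 : ℝ) ^ n₁) ?_ hp.le
    linarith
  have c1 : k₁ * 2 ^ d < k₂ + 1 := by exact_mod_cast b1
  have c2 : k₂ < (k₁ + 1) * 2 ^ d := by exact_mod_cast b2
  have d1 : ((k₁ * 2 ^ d : ℕ) : ℝ) ≤ k₂ := by exact_mod_cast Nat.lt_succ_iff.1 c1
  have d2 : ((k₂ + 1 : ℕ) : ℝ) ≤ ((k₁ + 1) * 2 ^ d : ℕ) := by exact_mod_cast c2
  push_cast at d1 d2
  rw [pow_add]
  constructor
  · rw [div_le_div_iff₀ hp (by positivity)]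
    nlinarith
  · rw [div_le_div_iff₀ (by positivity) hp]
    nlinarith

/-- The midpoint of a dyadic interval is not interior to a dyadic interval of a finer level. -/
theorem dyadic_level_le {n₁ k₁ n₂ k₂ : ℕ} (h : (k₁ : ℝ) / 2 ^ n₁ < (2 * k₂ + 1) / 2 ^ (n₂ + 1))
    (h' : (2 * (k₂ : ℝ) + 1) / 2 ^ (n₂ + 1) < ((k₁ : ℝ) + 1) / 2 ^ n₁) : n₁ ≤ n₂ := by
  by_contra hn
  -- If `n₁ > n₂`, the midpoint is itself a point of the grid of level `n₁`, and cannot lie strictly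
  -- between two consecutive grid points.
  obtain ⟨d, rfl⟩ := Nat.exists_eq_add_of_le (Nat.succ_le_of_lt (not_le.1 hn))
  have hp : (0 : ℝ) < 2 ^ (n₂ + 1) := by positivity
  rw [Nat.succ_eq_add_one, pow_add _ (n₂ + 1) d] at h h'
  rw [div_lt_div_iff₀ (by positivity) hp] at h
  rw [div_lt_div_iff₀ hp (by positivity)] at h'
  have b1 : (k₁ : ℝ) < (2 * k₂ + 1) * 2 ^ d := by
    refine lt_of_mul_lt_mul_right (a := (2 : ℝ) ^ (n₂ + 1)) ?_ hp.le
    linarith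
  have b2 : (2 * (k₂ : ℝ) + 1) * 2 ^ d < k₁ + 1 := by
    refine lt_of_mul_lt_mul_right (a := (2 : ℝ) ^ (n₂ + 1)) ?_ hp.le
    linarith
  have c1 : k₁ < (2 * k₂ + 1) * 2 ^ d := by exact_mod_cast b1
  have c2 : (2 * k₂ + 1) * 2 ^ d < k₁ + 1 := by exact_mod_cast b2
  omega

theorem OnDyadicSide.strict {a b : Pt} {E : Tri} {t : ℝ} {n k : ℕ} (h : OnDyadicSide a b E t n k)
    (hx : (AffineMap.lineMap a b t : Pt) ∉ E.verts) :
    (k : ℝ) / 2 ^ n < t ∧ t < ((k : ℝ) + 1) / 2 ^ n := by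
  obtain ⟨-, h2, h3, h4, h5⟩ := h
  refine ⟨h4.lt_of_ne ?_, h5.lt_of_ne ?_⟩
  · rintro rfl; exact hx h2
  · rintro rfl; exact hx h3

theorem lineMap_mem_segment_lineMap {a b : Pt} {r s t : ℝ} (h₁ : r ≤ t) (h₂ : t ≤ s) :
    (AffineMap.lineMap a b t : Pt) ∈
      segment ℝ (AffineMap.lineMap a b r : Pt) (AffineMap.lineMap a b s) := by
  have h : t ∈ segment ℝ r s := by rw [segment_eq_Icc (h₁.trans h₂)]; exact ⟨h₁, h₂⟩
  rw [← image_segment]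
  exact ⟨t, h, rfl⟩

theorem Tri.eq_left_right_of_mid {E : Tri} (hE : E.D ≠ 0) {p q : Pt} (hp : p ∈ E.verts)
    (hq : q ∈ E.verts) (hpq : p ≠ q) (h : E.mid ∈ segment ℝ p q) :
    (p = E.left ∧ q = E.right) ∨ (p = E.right ∧ q = E.left) := by
  obtain ⟨t, ht, hm⟩ := mem_segment_iff_lineMap.1 h
  have ht0 : t ≠ 0 := by
    rintro rfl
    rw [AffineMap.lineMap_apply_zero] at hm
    exact Tri.mid_not_mem_verts hE (hm ▸ hp)
  have ht1 : t ≠ 1 := by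
    rintro rfl
    rw [AffineMap.lineMap_apply_one] at hm
    exact Tri.mid_not_mem_verts hE (hm ▸ hq)
  have h0 := (Tri.coord_mid hE).1
  rw [← hm, Tri.cP_lineMap] at h0
  have t0 : 0 < t := ht.1.lt_of_ne' ht0
  have t1 : 0 < 1 - t := by linarith [ht.2.lt_of_ne ht1]
  rcases Tri.mem_verts.1 hp with rfl | rfl | rfl <;> rcases Tri.mem_verts.1 hq with rfl | rfl | rfl <;>
    simp [(Tri.coord_peak hE).1, (Tri.coord_left hE).1, (Tri.coord_right hE).1] at h0 hpq ⊢ <;>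
    linarith

/-- A side of `E` through `E.mid` can only be the bisection edge, so the parameter is the midpoint
of its dyadic interval: an odd multiple of `2 ^ (-(n + 1))`, which remembers the level `n`. -/
theorem OnDyadicSide.param_mid {a b : Pt} {E : Tri} {t : ℝ} {n k : ℕ} (hE : E.D ≠ 0) (hab : a ≠ b)
    (h : OnDyadicSide a b E t n k) (hm : AffineMap.lineMap a b t = E.mid) :
    t = (2 * k + 1) / 2 ^ (n + 1) ∧
      (((AffineMap.lineMap a b ((k : ℝ) / 2 ^ n) : Pt) = E.left ∧
        (AffineMap.lineMap a b (((k : ℝ) + 1) / 2 ^ n) : Pt) = E.right) ∨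
      ((AffineMap.lineMap a b ((k : ℝ) / 2 ^ n) : Pt) = E.right ∧
        (AffineMap.lineMap a b (((k : ℝ) + 1) / 2 ^ n) : Pt) = E.left)) := by
  obtain ⟨h1, h2, h3, h4, h5⟩ := h
  have hne : (AffineMap.lineMap a b ((k : ℝ) / 2 ^ n) : Pt) ≠
      AffineMap.lineMap a b (((k : ℝ) + 1) / 2 ^ n) := by
    intro e
    have := AffineMap.lineMap_injective ℝ hab e
    field_simp at this
    linarith
  have hs := Tri.eq_left_right_of_mid hE h2 h3 hne (hm ▸ lineMap_mem_segment_lineMap h4 h5)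
  refine ⟨?_, hs⟩
  apply AffineMap.lineMap_injective ℝ hab
  have hmid : E.mid = midpoint ℝ (AffineMap.lineMap a b ((k : ℝ) / 2 ^ n) : Pt)
      (AffineMap.lineMap a b (((k : ℝ) + 1) / 2 ^ n)) := by
    rcases hs with ⟨e1, e2⟩ | ⟨e1, e2⟩ <;> rw [e1, e2]
    · rfl
    · rw [midpoint_comm]; rfl
  rw [hm, hmid]
  apply pt_ext <;> simp only [midpoint_coord, lineMap_coord, pow_succ] <;> field_simp <;> ring

/-- If the midpoint of the bisection edge of `E₂` sits on `E₁` but is not a vertex of `E₁`, then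
this edge is contained in a side of `E₁`. -/
theorem Separated.edge_subset_side {E₁ E₂ : Tri} (h : Separated E₁ E₂) (hE₂ : E₂.D ≠ 0)
    (hx : E₂.mid ∈ E₁.carrier) (hx' : E₂.mid ∉ E₁.verts) :
    ∃ p q, p ∈ E₁.verts ∧ q ∈ E₁.verts ∧ E₂.left ∈ segment ℝ p q ∧ E₂.right ∈ segment ℝ p q := by
  rcases h.contact hx (Tri.mid_mem_carrier hE₂) with ⟨h1, -⟩ | ⟨a, b, t, hab, hm, h1, h2⟩
  · exact absurd h1 hx'
  obtain ⟨n₁, k₁, d₁⟩ := h1 hx'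
  obtain ⟨n₂, k₂, d₂⟩ := h2 (Tri.mid_not_mem_verts hE₂)
  obtain ⟨ht, hs⟩ := d₂.param_mid hE₂ hab hm
  have s₁ := d₁.strict (by rwa [hm])
  have s₂ := d₂.strict (by rw [hm]; exact Tri.mid_not_mem_verts hE₂)
  -- The midpoint of the interval of `E₂` is interior to the interval of `E₁`, so the latter is not
  -- finer; the two intervals share an interior point and are nested.
  have hn : n₁ ≤ n₂ := by
    rw [ht] at s₁; exact dyadic_level_le s₁.1 s₁.2
  obtain ⟨i1, i2⟩ := dyadic_nested s₁.1 s₁.2 s₂.1 s₂.2 hn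
  have j := s₂.1.le.trans s₂.2.le
  refine ⟨_, _, d₁.2.1, d₁.2.2.1, ?_⟩
  have m1 := lineMap_mem_segment_lineMap (a := a) (b := b) i1 (j.trans i2)
  have m2 := lineMap_mem_segment_lineMap (a := a) (b := b) (i1.trans j) i2
  rcases hs with ⟨e1, e2⟩ | ⟨e1, e2⟩ <;> rw [e1] at m1 <;> rw [e2] at m2
  · exact ⟨m1, m2⟩
  · exact ⟨m2, m1⟩

/-- The bisection edge is determined by its midpoint. -/
theorem Separated.edge_unique {E₁ E₂ : Tri} (h : Separated E₁ E₂) (hE₁ : E₁.D ≠ 0) (hE₂ : E₂.D ≠ 0)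
    (hm : E₁.mid = E₂.mid) :
    (E₁.left = E₂.left ∧ E₁.right = E₂.right) ∨ (E₁.left = E₂.right ∧ E₁.right = E₂.left) := by
  have hx := Tri.mid_mem_carrier hE₁
  have hx' := Tri.mid_not_mem_verts hE₁
  rcases h.contact hx (hm ▸ Tri.mid_mem_carrier hE₂) with ⟨h1, -⟩ | ⟨a, b, t, hab, hmt, h1, h2⟩
  · exact absurd h1 hx'
  obtain ⟨n₁, k₁, d₁⟩ := h1 hx'
  obtain ⟨n₂, k₂, d₂⟩ := h2 (hm ▸ Tri.mid_not_mem_verts hE₂)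
  obtain ⟨ht₁, hs₁⟩ := d₁.param_mid hE₁ hab hmt
  obtain ⟨ht₂, hs₂⟩ := d₂.param_mid hE₂ hab (hmt.trans hm)
  have s₁ := d₁.strict (by rwa [hmt])
  have s₂ := d₂.strict (by rw [hmt, hm]; exact Tri.mid_not_mem_verts hE₂)
  -- The common midpoint is interior to both intervals; each level bounds the other, and equal
  -- levels with equal midpoints give equal intervals.
  have hn : n₁ ≤ n₂ := by
    rw [ht₂] at s₁; exact dyadic_level_le s₁.1 s₁.2
  have hn' : n₂ ≤ n₁ := by
    rw [ht₁] at s₂; exact dyadic_level_le s₂.1 s₂.2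
  obtain rfl := le_antisymm hn hn'
  have hk : k₁ = k₂ := by
    rw [ht₁] at ht₂
    field_simp at ht₂
    have : (k₁ : ℝ) = k₂ := by linarith
    exact_mod_cast this
  subst hk
  rcases hs₁ with ⟨e1, e2⟩ | ⟨e1, e2⟩ <;> rcases hs₂ with ⟨f1, f2⟩ | ⟨f1, f2⟩ <;>
    rw [← e1, ← e2, ← f1, ← f2] <;> simp

theorem affine_eq_lineMap {p₁ p₂ : P1} {x y : Pt} (hx : p₁ x = p₂ x) (hy : p₁ y = p₂ y) (s : ℝ) :
    p₁ (AffineMap.lineMap x y s) = p₂ (AffineMap.lineMap x y s) := by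
  rw [AffineMap.apply_lineMap, AffineMap.apply_lineMap, hx, hy]

/-- The ends of the shorter interval are vertices of `E₂` lying on `E₁`. The two polynomials agree
there, hence on the whole interval. -/
theorem affine_eq_of_nested {a b : Pt} {E₁ E₂ : Tri} {t : ℝ} {n₁ k₁ n₂ k₂ : ℕ}
    (d₁ : OnDyadicSide a b E₁ t n₁ k₁) (d₂ : OnDyadicSide a b E₂ t n₂ k₂)
    (h₁ : (AffineMap.lineMap a b t : Pt) ∉ E₁.verts)
    (h₂ : (AffineMap.lineMap a b t : Pt) ∉ E₂.verts) (hn : n₁ ≤ n₂) {p₁ p₂ : P1}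
    (h : ∀ y ∈ E₂.verts, y ∈ E₁.carrier → p₁ y = p₂ y) :
    p₁ (AffineMap.lineMap a b t) = p₂ (AffineMap.lineMap a b t) := by
  have s₁ := d₁.strict h₁
  have s₂ := d₂.strict h₂
  obtain ⟨i1, i2⟩ := dyadic_nested s₁.1 s₁.2 s₂.1 s₂.2 hn
  have j := s₂.1.le.trans s₂.2.le
  have hsub := E₁.convex_carrier.segment_subset (Tri.verts_subset_carrier d₁.2.1)
    (Tri.verts_subset_carrier d₁.2.2.1)
  have q1 := h _ d₂.2.1 (hsub (lineMap_mem_segment_lineMap i1 (j.trans i2)))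
  have q2 := h _ d₂.2.2.1 (hsub (lineMap_mem_segment_lineMap (i1.trans j) i2))
  obtain ⟨s, -, hs⟩ := mem_segment_iff_lineMap.1
    (lineMap_mem_segment_lineMap (a := a) (b := b) s₂.1.le s₂.2.le)
  rw [← hs]; exact affine_eq_lineMap q1 q2 s

/-- Two affine polynomials, on two triangles of the forest, which agree at the vertices of each of
the triangles that belong to the other one, agree on the intersection. -/
theorem Separated.affine_eq {E₁ E₂ : Tri} (h : Separated E₁ E₂) {p₁ p₂ : P1}
    (h₁ : ∀ y ∈ E₁.verts, y ∈ E₂.carrier → p₁ y = p₂ y)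
    (h₂ : ∀ y ∈ E₂.verts, y ∈ E₁.carrier → p₁ y = p₂ y) {x : Pt} (hx₁ : x ∈ E₁.carrier)
    (hx₂ : x ∈ E₂.carrier) : p₁ x = p₂ x := by
  by_cases v₁ : x ∈ E₁.verts
  · exact h₁ x v₁ hx₂
  by_cases v₂ : x ∈ E₂.verts
  · exact h₂ x v₂ hx₁
  rcases h.contact hx₁ hx₂ with ⟨h1, -⟩ | ⟨a, b, t, hab, rfl, d1, d2⟩
  · exact absurd h1 v₁
  obtain ⟨n₁, k₁, d₁⟩ := d1 v₁
  obtain ⟨n₂, k₂, d₂⟩ := d2 v₂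
  rcases le_total n₁ n₂ with hn | hn
  · exact affine_eq_of_nested d₁ d₂ v₁ v₂ hn h₂
  · exact (affine_eq_of_nested d₂ d₁ v₂ v₁ hn fun y hy hy' => (h₁ y hy hy').symm).symm

/-! ### Sides -/

theorem Tri.segment_subset_frontier {E : Tri} (hE : E.D ≠ 0) {p q : Pt} (hp : p ∈ E.verts)
    (hq : q ∈ E.verts) : segment ℝ p q ⊆ frontier E.carrier := by
  intro x hx
  rw [Tri.mem_frontier_iff hE]
  refine ⟨E.convex_carrier.segment_subset (Tri.verts_subset_carrier hp)
    (Tri.verts_subset_carrier hq) hx, ?_⟩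
  obtain ⟨t, -, rfl⟩ := mem_segment_iff_lineMap.1 hx
  rcases Tri.mem_verts.1 hp with rfl | rfl | rfl <;> rcases Tri.mem_verts.1 hq with rfl | rfl | rfl <;>
    simp [Tri.cP_lineMap, Tri.cL_lineMap, Tri.cR_lineMap, Tri.coord_peak hE, Tri.coord_left hE,
      Tri.coord_right hE]

theorem Tri.verts_subset_frontier {E : Tri} (hE : E.D ≠ 0) {p : Pt} (hp : p ∈ E.verts) :
    p ∈ frontier E.carrier :=
  Tri.segment_subset_frontier hE hp hp (left_mem_segment ℝ p p)

theorem Tri.vert_mem_segment {E : Tri} (hE : E.D ≠ 0) {a b v : Pt} (ha : a ∈ E.verts)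
    (hb : b ∈ E.verts) (hv : v ∈ E.verts) (h : v ∈ segment ℝ a b) : v = a ∨ v = b := by
  obtain ⟨t, -, ht⟩ := mem_segment_iff_lineMap.1 h
  have h1 := congrArg E.cP ht
  have h2 := congrArg E.cL ht
  have h3 := congrArg E.cR ht
  rw [Tri.cP_lineMap] at h1
  rw [Tri.cL_lineMap] at h2
  rw [Tri.cR_lineMap] at h3
  rcases Tri.mem_verts.1 ha with rfl | rfl | rfl <;> rcases Tri.mem_verts.1 hb with rfl | rfl | rfl <;>
    rcases Tri.mem_verts.1 hv with rfl | rfl | rfl <;>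
    simp [Tri.coord_peak hE, Tri.coord_left hE, Tri.coord_right hE] at h1 h2 h3 ⊢

/-- A point which is not a vertex sits on one side at most. -/
theorem Tri.side_unique {E : Tri} (hE : E.D ≠ 0) {a b a' b' x : Pt} (ha : a ∈ E.verts)
    (hb : b ∈ E.verts) (ha' : a' ∈ E.verts) (hb' : b' ∈ E.verts) (hx : x ∉ E.verts)
    (h : x ∈ segment ℝ a b) (h' : x ∈ segment ℝ a' b') :
    (a = a' ∧ b = b') ∨ (a = b' ∧ b = a') := by
  have hc := (Tri.mem_frontier_iff hE).1 (Tri.segment_subset_frontier hE ha hb h)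
  have n1 : ¬ (E.cP x = 0 ∧ E.cL x = 0) := fun h0 =>
    hx (Tri.mem_verts.2 (Or.inr (Or.inr (Tri.eq_right hE h0.1 h0.2))))
  have n2 : ¬ (E.cP x = 0 ∧ E.cR x = 0) := fun h0 =>
    hx (Tri.mem_verts.2 (Or.inr (Or.inl (Tri.eq_left hE h0.1 h0.2))))
  have n3 : ¬ (E.cL x = 0 ∧ E.cR x = 0) := fun h0 =>
    hx (Tri.mem_verts.2 (Or.inl (Tri.eq_peak hE h0.1 h0.2)))
  have aux : ∀ {p q : Pt}, p ∈ E.verts → q ∈ E.verts → x ∈ segment ℝ p q →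
      (E.cP x = 0 ∧ ((p = E.left ∧ q = E.right) ∨ (p = E.right ∧ q = E.left))) ∨
      (E.cL x = 0 ∧ ((p = E.peak ∧ q = E.right) ∨ (p = E.right ∧ q = E.peak))) ∨
      (E.cR x = 0 ∧ ((p = E.peak ∧ q = E.left) ∨ (p = E.left ∧ q = E.peak))) := by
    intro p q hp hq hpq
    have same : p ≠ q := by
      rintro rfl
      rw [segment_same] at hpq
      exact hx (by rwa [Set.mem_singleton_iff.1 hpq])
    have hsymm : x ∈ segment ℝ q p := by rwa [segment_symm]
    rcases Tri.mem_verts.1 hp with rfl | rfl | rfl <;>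
      rcases Tri.mem_verts.1 hq with rfl | rfl | rfl
    · exact absurd rfl same
    · exact Or.inr (Or.inr ⟨((Tri.mem_segment_peak_left hE).1 hpq).2, by simp⟩)
    · exact Or.inr (Or.inl ⟨((Tri.mem_segment_peak_right hE).1 hpq).2, by simp⟩)
    · exact Or.inr (Or.inr ⟨((Tri.mem_segment_peak_left hE).1 hsymm).2, by simp⟩)
    · exact absurd rfl same
    · exact Or.inl ⟨((Tri.mem_segment_left_right hE).1 hpq).2, by simp⟩
    · exact Or.inr (Or.inl ⟨((Tri.mem_segment_peak_right hE).1 hsymm).2, by simp⟩)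
    · exact Or.inl ⟨((Tri.mem_segment_left_right hE).1 hsymm).2, by simp⟩
    · exact absurd rfl same
  rcases aux ha hb h with ⟨c, h⟩ | ⟨c, h⟩ | ⟨c, h⟩ <;>
    rcases aux ha' hb' h' with ⟨c', h'⟩ | ⟨c', h'⟩ | ⟨c', h'⟩
  all_goals first
    | exact (n1 ⟨c, c'⟩).elim
    | exact (n1 ⟨c', c⟩).elim
    | exact (n2 ⟨c, c'⟩).elim
    | exact (n2 ⟨c', c⟩).elim
    | exact (n3 ⟨c, c'⟩).elim
    | exact (n3 ⟨c', c⟩).elim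
    | skip
  all_goals
    rcases h with ⟨rfl, rfl⟩ | ⟨rfl, rfl⟩ <;> rcases h' with ⟨rfl, rfl⟩ | ⟨rfl, rfl⟩ <;> simp

theorem Compat.not_mem_interior {F₁ F₂ : Tri} (h : Compat F₁ F₂) (h₁ : F₁.D ≠ 0) (h₂ : F₂.D ≠ 0)
    {x : Pt} (hx₁ : x ∈ interior F₁.carrier) (hx₂ : x ∈ F₂.carrier) : False := by
  have hf : x ∈ frontier F₁.carrier := by
    rcases h.cases h₁ h₂ (interior_subset hx₁) hx₂ with ⟨hv, -⟩ | ⟨a, b, -, ha, hb, -, -, hx⟩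
    · exact Tri.verts_subset_frontier h₁ hv
    · exact Tri.segment_subset_frontier h₁ ha hb hx
  exact hf.2 hx₁

theorem Separated.disjoint_interior {E₁ E₂ : Tri} (h : Separated E₁ E₂) :
    Disjoint (interior E₁.carrier) (interior E₂.carrier) := by
  obtain ⟨F₁, F₂, d₁, d₂, h₁, h₂, hc⟩ := h
  rw [Set.disjoint_left]
  intro x hx₁ hx₂
  exact hc.not_mem_interior h₁ h₂ (interior_mono (d₁.subset h₁) hx₁)
    (d₂.subset h₂ (interior_subset hx₂))

/-! ### Invariants of the refinement process -/

section Refinement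

variable {Ω : Set Pt} {T₀ T H : Finset Tri}

theorem IsConformingTriangulation.D_ne (h₀ : IsConformingTriangulation Ω T₀) {R : Tri}
    (hR : R ∈ T₀) : R.D ≠ 0 := Tri.D_ne_zero (h₀.nondegenerate R hR)

theorem IsConformingTriangulation.compat (h₀ : IsConformingTriangulation Ω T₀) {R R' : Tri}
    (hR : R ∈ T₀) (hR' : R' ∈ T₀) (h : R ≠ R') : Compat R R' :=
  ⟨h₀.verts_ne R hR R' hR' h, h₀.inter_eq R hR R' hR' h⟩

theorem IsRefinement.exists_root (hr : IsRefinement T₀ T H) :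
    (∀ E ∈ T, ∃ R ∈ T₀, Desc R E) ∧ ∀ E ∈ H, ∃ R ∈ T₀, Desc R E := by
  induction hr with
  | initial => exact ⟨fun E hE => ⟨E, hE, Desc.refl E⟩, by simp⟩
  | bisect T H E hr hE ih =>
    obtain ⟨R, hR, hd⟩ := ih.1 E hE
    constructor
    · intro E' hE'
      simp only [Finset.mem_union, Finset.mem_erase, Finset.mem_insert, Finset.mem_singleton] at hE'
      rcases hE' with ⟨-, h⟩ | rfl | rfl
      · exact ih.1 _ h
      · exact ⟨R, hR, hd.trans (Desc.left (Desc.refl _))⟩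
      · exact ⟨R, hR, hd.trans (Desc.right (Desc.refl _))⟩
    · intro E' hE'
      rcases Finset.mem_insert.1 hE' with rfl | h
      · exact ⟨R, hR, hd⟩
      · exact ih.2 _ h

theorem IsRefinement.D_ne (hr : IsRefinement T₀ T H) (h₀ : IsConformingTriangulation Ω T₀) {E : Tri}
    (hE : E ∈ T) : E.D ≠ 0 := by
  obtain ⟨R, hR, hd⟩ := hr.exists_root.1 E hE
  exact hd.D_ne (h₀.D_ne hR)

theorem IsRefinement.D_ne' (hr : IsRefinement T₀ T H) (h₀ : IsConformingTriangulation Ω T₀) {E : Tri}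
    (hE : E ∈ H) : E.D ≠ 0 := by
  obtain ⟨R, hR, hd⟩ := hr.exists_root.2 E hE
  exact hd.D_ne (h₀.D_ne hR)

theorem IsRefinement.exists_mem (hr : IsRefinement T₀ T H) (h₀ : IsConformingTriangulation Ω T₀)
    {R : Tri} (hR : R ∈ T₀) {x : Pt} (hx : x ∈ R.carrier) : ∃ E ∈ T, Desc R E ∧ x ∈ E.carrier := by
  induction hr with
  | initial => exact ⟨R, hR, Desc.refl R, hx⟩
  | bisect T H E hr hE ih =>
    obtain ⟨E', hE', hd, hx'⟩ := ih
    by_cases h : E' = E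
    · subst h
      rw [Tri.carrier_eq_children (hr.D_ne h₀ hE)] at hx'
      rcases hx' with h | h
      · exact ⟨_, by simp, hd.trans (Desc.left (Desc.refl _)), h⟩
      · exact ⟨_, by simp, hd.trans (Desc.right (Desc.refl _)), h⟩
    · exact ⟨E', by simp [h, hE'], hd, hx'⟩

theorem Separated.desc_left {E E' F : Tri} (h : Separated E F) (hd : Desc E E') : Separated E' F := by
  obtain ⟨F₁, F₂, h1, h2, h3⟩ := h
  exact ⟨F₁, F₂, h1.trans hd, h2, h3⟩

/-- Two elements descend either from two initial triangles, compatible by conformity, or from the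
two children of a common ancestor, compatible because they meet along the median. -/
theorem IsRefinement.separated (hr : IsRefinement T₀ T H) (h₀ : IsConformingTriangulation Ω T₀)
    {E E' : Tri} (hE : E ∈ T) (hE' : E' ∈ T) (hne : E ≠ E') : Separated E E' := by
  induction hr generalizing E E' with
  | initial =>
    exact ⟨E, E', Desc.refl _, Desc.refl _, h₀.D_ne hE, h₀.D_ne hE', h₀.compat hE hE' hne⟩
  | bisect T H F hr hF ih =>
    have hFD := hr.D_ne h₀ hF
    have s12 : Separated F.child₁ F.child₂ := ⟨_, _, Desc.refl _, Desc.refl _,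
      Tri.D_child₁_ne hFD, Tri.D_child₂_ne hFD, compat_children hFD⟩
    have d1 : Desc F F.child₁ := Desc.left (Desc.refl _)
    have d2 : Desc F F.child₂ := Desc.right (Desc.refl _)
    simp only [Finset.mem_union, Finset.mem_erase, Finset.mem_insert, Finset.mem_singleton] at hE hE'
    rcases hE with ⟨n, h⟩ | rfl | rfl <;> rcases hE' with ⟨n', h'⟩ | rfl | rfl
    · exact ih h h' hne
    · exact ((ih hF h n.symm).desc_left d1).symm
    · exact ((ih hF h n.symm).desc_left d2).symm
    · exact (ih hF h' n'.symm).desc_left d1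
    · exact absurd rfl hne
    · exact s12
    · exact (ih hF h' n'.symm).desc_left d2
    · exact s12.symm
    · exact absurd rfl hne

/-- `E` is a proper descendant of `F`. -/
def ProperDesc (F E : Tri) : Prop := Desc F.child₁ E ∨ Desc F.child₂ E

theorem ProperDesc.trans {F E G : Tri} (h : ProperDesc F E) (h' : Desc E G) : ProperDesc F G :=
  h.imp (fun h => h.trans h') fun h => h.trans h'

theorem ProperDesc.mid_mem {F E : Tri} (h : ProperDesc F E) (hF : F.D ≠ 0) (hx : F.mid ∈ E.carrier) :
    F.mid ∈ E.verts := by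
  rcases h with h | h
  · exact h.vert_mem (Tri.D_child₁_ne hF) (by simp [Tri.mem_verts, Tri.child₁]) hx
  · exact h.vert_mem (Tri.D_child₂_ne hF) (by simp [Tri.mem_verts, Tri.child₂]) hx

/-- Relative to an element, a bisected triangle is either in separated position or an ancestor. The
second case is harmless for hanging nodes, since the midpoint created by an ancestor is a vertex of
every descendant containing it. -/
theorem IsRefinement.separated_or (hr : IsRefinement T₀ T H) (h₀ : IsConformingTriangulation Ω T₀)
    {E F : Tri} (hE : E ∈ T) (hF : F ∈ H) : Separated E F ∨ ProperDesc F E := by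
  induction hr generalizing E F with
  | initial => simp at hF
  | bisect T H G hr hG ih =>
    have d1 : Desc G G.child₁ := Desc.left (Desc.refl _)
    have d2 : Desc G G.child₂ := Desc.right (Desc.refl _)
    simp only [Finset.mem_union, Finset.mem_erase, Finset.mem_insert, Finset.mem_singleton] at hE hF
    rcases hE with ⟨n, h⟩ | rfl | rfl <;> rcases hF with rfl | hF
    · exact Or.inl (hr.separated h₀ h hG n)
    · exact ih h hF
    · exact Or.inr (Or.inl (Desc.refl _))
    · exact (ih hG hF).imp (fun h => h.desc_left d1) fun h => h.trans d1
    · exact Or.inr (Or.inr (Desc.refl _))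
    · exact (ih hG hF).imp (fun h => h.desc_left d2) fun h => h.trans d2

theorem IsRefinement.separated_or' (hr : IsRefinement T₀ T H) (h₀ : IsConformingTriangulation Ω T₀)
    {F G : Tri} (hF : F ∈ H) (hG : G ∈ H) (hne : F ≠ G) :
    Separated F G ∨ ProperDesc F G ∨ ProperDesc G F := by
  induction hr generalizing F G with
  | initial => simp at hF
  | bisect T H E hr hE ih =>
    rcases Finset.mem_insert.1 hF with rfl | hF' <;> rcases Finset.mem_insert.1 hG with rfl | hG'
    · exact absurd rfl hne
    · exact (hr.separated_or h₀ hE hG').imp id Or.inr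
    · exact (hr.separated_or h₀ hE hF').imp Separated.symm Or.inl
    · exact ih hF' hG' hne

/-- This is the geometric core. Where a midpoint hangs on `E`, both parent nodes lie on the same
side of `E`, so an affine function on `E` takes at the node the average of its values at the
parents. -/
theorem IsRefinement.edge_subset_side (hr : IsRefinement T₀ T H)
    (h₀ : IsConformingTriangulation Ω T₀) {E F : Tri} (hE : E ∈ T) (hF : F ∈ H)
    (hx : F.mid ∈ E.carrier) (hx' : F.mid ∉ E.verts) :
    ∃ p q, p ∈ E.verts ∧ q ∈ E.verts ∧ F.left ∈ segment ℝ p q ∧ F.right ∈ segment ℝ p q := by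
  rcases hr.separated_or h₀ hE hF with h | h
  · exact h.edge_subset_side (hr.D_ne' h₀ hF) hx hx'
  · exact absurd (h.mid_mem (hr.D_ne' h₀ hF) hx) hx'

/-- A node may have been created by bisecting several triangles. That they share the halved edge
makes a recursion through the parents of a node unambiguous. -/
theorem IsRefinement.edge_unique (hr : IsRefinement T₀ T H)
    (h₀ : IsConformingTriangulation Ω T₀) {F G : Tri} (hF : F ∈ H) (hG : G ∈ H)
    (hm : F.mid = G.mid) :
    (F.left = G.left ∧ F.right = G.right) ∨ (F.left = G.right ∧ F.right = G.left) := by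
  have hFD := hr.D_ne' h₀ hF
  have hGD := hr.D_ne' h₀ hG
  by_cases hne : F = G
  · simp [hne]
  rcases hr.separated_or' h₀ hF hG hne with h | h | h
  · exact h.edge_unique hFD hGD hm
  · have := h.mid_mem hFD (hm ▸ Tri.mid_mem_carrier hGD)
    exact absurd (hm ▸ this) (Tri.mid_not_mem_verts hGD)
  · have := h.mid_mem hGD (hm ▸ Tri.mid_mem_carrier hFD)
    exact absurd (hm ▸ this) (Tri.mid_not_mem_verts hFD)

/-! ### Nodes -/

theorem mem_nodes {x : Pt} : x ∈ nodes T ↔ ∃ E ∈ T, x ∈ E.verts := by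
  simp [nodes]

theorem mem_nodesOn {E : Tri} {x : Pt} : x ∈ nodesOn T E ↔ x ∈ nodes T ∧ x ∈ frontier E.carrier := by
  simp [nodesOn]

theorem Tri.frontier_subset {E : Tri} : frontier E.carrier ⊆ E.carrier :=
  Tri.isCompact_carrier.isClosed.frontier_subset

theorem IsGlobalIndex.mem_nodes {x : Pt} {k : ℕ} (h : IsGlobalIndex T H x k) : x ∈ nodes T := by
  cases h with
  | proper _ h => exact h.1
  | hanging _ _ _ _ h => exact h.1

theorem IsHangingNode.exists_elem {x : Pt} (h : IsHangingNode T x) :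
    ∃ E ∈ T, x ∈ E.carrier ∧ x ∉ E.verts := by
  have h2 := h.2
  rw [IsProperNode] at h2
  push Not at h2
  exact h2 h.1

/-- Iterated adjunction of all the midpoints to a finite set of points. -/
def midpointClosure (S : Finset Pt) : ℕ → Finset Pt
  | 0 => S
  | n + 1 => midpointClosure S n ∪
      ((midpointClosure S n ×ˢ midpointClosure S n).image fun p => midpoint ℝ p.1 p.2)

/-- Bound for the cardinality of the iterated adjunction of midpoints to three points. -/
def closureBound : ℕ → ℕ
  | 0 => 3
  | n + 1 => closureBound n + closureBound n * closureBound n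

theorem card_midpointClosure_le {S : Finset Pt} (hS : S.card ≤ 3) (n : ℕ) :
    (midpointClosure S n).card ≤ closureBound n := by
  induction n with
  | zero => exact hS
  | succ n ih =>
    refine (Finset.card_union_le _ _).trans (add_le_add ih (Finset.card_image_le.trans ?_))
    rw [Finset.card_product]
    exact Nat.mul_le_mul ih ih

theorem midpointClosure_mono (S : Finset Pt) : Monotone (midpointClosure S) :=
  monotone_nat_of_le_succ fun _ => Finset.subset_union_left

/-- The parents of a node hanging on `E` lie on `E` too and have smaller index, so a node of index
`k` is reached from the vertices of `E` in `k` rounds of midpoints. Hence the number of nodes on an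
element depends on Λ alone. -/
theorem IsGlobalIndex.mem_midpointClosure (hr : IsRefinement T₀ T H)
    (h₀ : IsConformingTriangulation Ω T₀) {E : Tri} (hE : E ∈ T) {x : Pt} {k : ℕ}
    (h : IsGlobalIndex T H x k) (hx : x ∈ E.carrier) : x ∈ midpointClosure E.verts k := by
  induction h with
  | proper x hp => exact hp.2 E hE hx
  | hanging F k l hF hh hk hl ihk ihl =>
    by_cases hv : F.mid ∈ E.verts
    · exact midpointClosure_mono _ (Nat.zero_le _) hv
    obtain ⟨p, q, hp, hq, h1, h2⟩ := hr.edge_subset_side h₀ hE hF hx hv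
    have hs := E.convex_carrier.segment_subset (Tri.verts_subset_carrier hp)
      (Tri.verts_subset_carrier hq)
    have m1 := midpointClosure_mono E.verts (le_max_left k l) (ihk (hs h1))
    have m2 := midpointClosure_mono E.verts (le_max_right k l) (ihl (hs h2))
    exact Finset.mem_union_right _ (Finset.mem_image.2
      ⟨(F.left, F.right), Finset.mem_product.2 ⟨m1, m2⟩, rfl⟩)

theorem card_nodesOn_le (hr : IsRefinement T₀ T H) (h₀ : IsConformingTriangulation Ω T₀) {Λ : ℕ}
    (hA : IsAdmissible Λ T H) {E : Tri} (hE : E ∈ T) : (nodesOn T E).card ≤ closureBound Λ := by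
  refine (Finset.card_le_card ?_).trans
    (card_midpointClosure_le (Tri.card_verts (hr.D_ne h₀ hE)).le Λ)
  intro x hx
  rw [mem_nodesOn] at hx
  obtain ⟨k, hk, h⟩ := hA x hx.1
  exact midpointClosure_mono _ hk (h.mem_midpointClosure hr h₀ hE (Tri.frontier_subset hx.2))

/-! ### The nodal values of the interpolant at the proper nodes -/

/-- The recursion for the values of the conforming interpolant: `u` at the proper nodes, and the
average of the values at the endpoints of the halved edge at the hanging nodes. -/
inductive NodalValue (T H : Finset Tri) (u : Pt → ℝ) : Pt → ℝ → Prop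
  | proper (x : Pt) : IsProperNode T x → NodalValue T H u x (u x)
  | hanging (E : Tri) (r s : ℝ) : E ∈ H → IsHangingNode T E.mid → NodalValue T H u E.left r →
      NodalValue T H u E.right s → NodalValue T H u E.mid ((r + s) / 2)

theorem IsGlobalIndex.exists_nodalValue {u : Pt → ℝ} {x : Pt} {k : ℕ} (h : IsGlobalIndex T H x k) :
    ∃ r, NodalValue T H u x r := by
  induction h with
  | proper x hx => exact ⟨_, NodalValue.proper x hx⟩
  | hanging E k l hE hh _ _ ih1 ih2 =>
    obtain ⟨r, hr⟩ := ih1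
    obtain ⟨s, hs⟩ := ih2
    exact ⟨_, NodalValue.hanging E r s hE hh hr hs⟩

theorem NodalValue.unique (hr : IsRefinement T₀ T H) (h₀ : IsConformingTriangulation Ω T₀)
    {u : Pt → ℝ} {x : Pt} {r r' : ℝ} (h : NodalValue T H u x r) (h' : NodalValue T H u x r') :
    r = r' := by
  induction h generalizing r' with
  | proper x hx =>
    cases h' with
    | proper => rfl
    | hanging E _ _ _ hh => exact absurd hx hh.2
  | hanging E r s hE hh h1 h2 ih1 ih2 =>
    generalize hm : E.mid = y at h'
    cases h' with
    | proper _ hx => exact absurd (hm ▸ hx) hh.2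
    | hanging F r' s' hF hh' h1' h2' =>
      rcases hr.edge_unique h₀ hE hF hm with ⟨e1, e2⟩ | ⟨e1, e2⟩
      · rw [ih1 (e1 ▸ h1'), ih2 (e2 ▸ h2')]
      · rw [ih1 (e1 ▸ h2'), ih2 (e2 ▸ h1'), add_comm]

/-- The nodal values of an affine polynomial that interpolates them at the vertices of an element. -/
theorem NodalValue.eq_affine (hr : IsRefinement T₀ T H) (h₀ : IsConformingTriangulation Ω T₀)
    {u : Pt → ℝ} {E : Tri} (hE : E ∈ T) {p : P1} (hp : ∀ v ∈ E.verts, ∀ r, NodalValue T H u v r → p v = r)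
    {x : Pt} {r : ℝ} (h : NodalValue T H u x r) (hx : x ∈ E.carrier) : p x = r := by
  induction h with
  | proper x hx' => exact hp x (hx'.2 E hE hx) _ (NodalValue.proper x hx')
  | hanging F r s hF hh h1 h2 ih1 ih2 =>
    by_cases hv : F.mid ∈ E.verts
    · exact hp _ hv _ (NodalValue.hanging F r s hF hh h1 h2)
    obtain ⟨a, b, ha, hb, m1, m2⟩ := hr.edge_subset_side h₀ hE hF hx hv
    have hs := E.convex_carrier.segment_subset (Tri.verts_subset_carrier ha)
      (Tri.verts_subset_carrier hb)
    rw [← ih1 (hs m1), ← ih2 (hs m2), Tri.mid, AffineMap.map_midpoint, midpoint_eq_smul_add]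
    simp; ring

/-! ### The boundary -/

theorem IsConformingTriangulation.exists_side (h₀ : IsConformingTriangulation Ω T₀) {x : Pt}
    (hx : x ∈ frontier Ω) : ∃ R ∈ T₀, ∃ a ∈ R.verts, ∃ b ∈ R.verts, a ≠ b ∧
      segment ℝ a b ⊆ frontier Ω ∧ x ∈ segment ℝ a b := by
  obtain ⟨S, hS, he⟩ := h₀.frontier_eq
  rw [he] at hx
  obtain ⟨s, hs, hxs⟩ := hx
  have := hS hs
  simp only [Set.mem_iUnion, exists_prop] at this
  obtain ⟨R, hR, a, ha, b, hb, hab, rfl⟩ := this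
  exact ⟨R, hR, a, ha, b, hb, hab, by rw [he]; exact Set.subset_sUnion_of_mem hs, hxs⟩

/-- A point of the interior of `R` outside Ω would be on ∂Ω, thus on a side of an initial triangle;
no such side meets the interior of `R`. -/
theorem IsConformingTriangulation.interior_subset (h₀ : IsConformingTriangulation Ω T₀) {R : Tri}
    (hR : R ∈ T₀) : interior R.carrier ⊆ Ω := by
  intro x hx
  have hc : x ∈ closure Ω := by
    rw [h₀.closure_eq]
    exact Set.mem_biUnion hR (_root_.interior_subset hx)
  by_contra hn
  have hf : x ∈ frontier Ω := by
    rw [frontier, h₀.isOpen.interior_eq]; exact ⟨hc, hn⟩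
  obtain ⟨R', hR', a, ha, b, hb, -, -, hs⟩ := h₀.exists_side hf
  have hfr := Tri.segment_subset_frontier (h₀.D_ne hR') ha hb hs
  by_cases h : R = R'
  · subst h; exact hfr.2 hx
  · exact (h₀.compat hR hR' h).not_mem_interior (h₀.D_ne hR) (h₀.D_ne hR') hx
      (Tri.frontier_subset hfr)

theorem IsConformingTriangulation.vert_mem (h₀ : IsConformingTriangulation Ω T₀) {R R' : Tri}
    (hR : R ∈ T₀) (hR' : R' ∈ T₀) {v : Pt} (hv : v ∈ R.verts) (hx : v ∈ R'.carrier) :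
    v ∈ R'.verts := by
  by_cases h : R = R'
  · exact h ▸ hv
  rcases (h₀.compat hR hR' h).cases (h₀.D_ne hR) (h₀.D_ne hR') (Tri.verts_subset_carrier hv) hx with
    h | ⟨a, b, -, ha, hb, ha', hb', hs⟩
  · exact h.2
  · rcases Tri.vert_mem_segment (h₀.D_ne hR) ha hb hv hs with rfl | rfl
    · exact ha'
    · exact hb'

/-- A side of an initial triangle intersects each triangle of the forest in a vertex or along a
side. -/
theorem IsConformingTriangulation.side_cases (h₀ : IsConformingTriangulation Ω T₀) {R R' E : Tri}
    (hR : R ∈ T₀) (hR' : R' ∈ T₀) (hd : Desc R' E) {a b x : Pt} (ha : a ∈ R.verts)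
    (hb : b ∈ R.verts) (hab : a ≠ b) (hx : x ∈ segment ℝ a b) (hxE : x ∈ E.carrier)
    (hv : x ∉ E.verts) : ∃ p q, p ∈ E.verts ∧ q ∈ E.verts ∧ p ≠ q ∧ p ∈ segment ℝ a b ∧
      q ∈ segment ℝ a b ∧ x ∈ segment ℝ p q := by
  have hx' := hd.subset (h₀.D_ne hR') hxE
  have hvR : x ∉ R.verts := fun h =>
    hv (hd.vert_mem (h₀.D_ne hR') (h₀.vert_mem hR hR' h hx') hxE)
  have hab' : a ∈ R'.verts ∧ b ∈ R'.verts := by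
    -- Since `x` is not a vertex of `R`, only one side of `R` passes through it, so the side common
    -- to `R` and `R'` must be `[a, b]`.
    by_cases h : R = R'
    · subst h; exact ⟨ha, hb⟩
    have hxR : x ∈ R.carrier := R.convex_carrier.segment_subset (Tri.verts_subset_carrier ha)
      (Tri.verts_subset_carrier hb) hx
    rcases (h₀.compat hR hR' h).cases (h₀.D_ne hR) (h₀.D_ne hR') hxR hx' with
      h | ⟨a', b', -, ha', hb', ha'', hb'', hs⟩
    · exact absurd h.1 hvR
    · rcases Tri.side_unique (h₀.D_ne hR) ha hb ha' hb' hvR hx hs with ⟨rfl, rfl⟩ | ⟨rfl, rfl⟩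
      · exact ⟨ha'', hb''⟩
      · exact ⟨hb'', ha''⟩
  obtain ⟨t, ht, rfl⟩ := mem_segment_iff_lineMap.1 hx
  obtain ⟨n, k, h1, h2, h3, h4, h5⟩ := hd.onDyadicSide (h₀.D_ne hR') hab'.1 hab'.2 hab ht hxE hv
  have e1 : ((k : ℝ) + 1) / 2 ^ n ≤ 1 := by
    rw [div_le_one (by positivity)]; exact_mod_cast h1
  have e0 : (0 : ℝ) ≤ (k : ℝ) / 2 ^ n := by positivity
  refine ⟨_, _, h2, h3, ?_, mem_segment_iff_lineMap.2 ⟨_, ⟨e0, ?_⟩, rfl⟩,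
    mem_segment_iff_lineMap.2 ⟨_, ⟨?_, e1⟩, rfl⟩, lineMap_mem_segment_lineMap h4 h5⟩
  · intro e
    have := AffineMap.lineMap_injective ℝ hab e
    field_simp at this
    linarith
  · linarith
  · linarith

/-- A midpoint on ∂Ω lies on a boundary side of an initial triangle, and the bisection edge around
it is contained in that side. Both parents are then boundary nodes, and the average of zeros is
zero. -/
theorem NodalValue.eq_zero_of_frontier (hr : IsRefinement T₀ T H)
    (h₀ : IsConformingTriangulation Ω T₀) {u : Pt → ℝ} (hu : ∀ x ∈ frontier Ω, u x = 0) {x : Pt} {r : ℝ}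
    (h : NodalValue T H u x r) (hx : x ∈ frontier Ω) : r = 0 := by
  induction h with
  | proper x hx' => exact hu x hx
  | hanging F r s hF hh h1 h2 ih1 ih2 =>
    obtain ⟨R, hR, a, ha, b, hb, hab, hsub, hxs⟩ := h₀.exists_side hx
    obtain ⟨R', hR', hd⟩ := hr.exists_root.2 F hF
    have hFD := hr.D_ne' h₀ hF
    obtain ⟨p, q, hp, hq, hpq, hps, hqs, hm⟩ := h₀.side_cases hR hR' hd ha hb hab hxs
      (Tri.mid_mem_carrier hFD) (Tri.mid_not_mem_verts hFD)
    have hlr : F.left ∈ frontier Ω ∧ F.right ∈ frontier Ω := by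
      rcases Tri.eq_left_right_of_mid hFD hp hq hpq hm with ⟨rfl, rfl⟩ | ⟨rfl, rfl⟩
      · exact ⟨hsub hps, hsub hqs⟩
      · exact ⟨hsub hqs, hsub hps⟩
    rw [ih1 hlr.1, ih2 hlr.2]; norm_num

end Refinement

/-! ### Affine parametrizations and areas -/

/-- The affine parametrization of the plane with origin `p` and axes `u`, `v`. -/
def param (p u v : Pt) (z : ℝ × ℝ) : Pt := p + (z.1 • u + z.2 • v)

theorem param_coord (p u v : Pt) (z : ℝ × ℝ) (i : Fin 2) :
    param p u v z i = p i + (z.1 * u i + z.2 * v i) := by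
  simp [param]

theorem continuous_param (p u v : Pt) : Continuous (param p u v) := by
  unfold param; fun_prop

theorem param_injective {p u v : Pt} (h : u 0 * v 1 - u 1 * v 0 ≠ 0) :
    Function.Injective (param p u v) := by
  intro z w hzw
  have h0 := congrArg (fun x : Pt => x 0) hzw
  have h1 := congrArg (fun x : Pt => x 1) hzw
  simp only [param_coord] at h0 h1
  have e1 : (z.1 - w.1) * (u 0 * v 1 - u 1 * v 0) = 0 := by linear_combination v 1 * h0 - v 0 * h1
  have e2 : (z.2 - w.2) * (u 0 * v 1 - u 1 * v 0) = 0 := by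
    linear_combination u 0 * h1 - u 1 * h0
  exact Prod.ext (sub_eq_zero.1 ((mul_eq_zero.1 e1).resolve_right h))
    (sub_eq_zero.1 ((mul_eq_zero.1 e2).resolve_right h))

theorem measurePreserving_pair :
    MeasurePreserving (fun z : ℝ × ℝ => (!₂[z.1, z.2] : Pt)) volume volume := by
  have h1 := (volume_preserving_finTwoArrow ℝ).symm
  have h2 := (EuclideanSpace.volume_preserving_symm_measurableEquiv_toLp (Fin 2)).symm
  exact h2.comp h1

/-- The linear part of the parametrization. -/
def paramLin (u v : Pt) : Pt →ₗ[ℝ] Pt where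
  toFun x := x 0 • u + x 1 • v
  map_add' x y := by simp only [PiLp.add_apply, add_smul]; abel
  map_smul' c x := by simp [smul_smul]

theorem paramLin_apply (u v x : Pt) : paramLin u v x = x 0 • u + x 1 • v := rfl

theorem det_paramLin (u v : Pt) : LinearMap.det (paramLin u v) = u 0 * v 1 - u 1 * v 0 := by
  rw [← LinearMap.det_toMatrix (EuclideanSpace.basisFun (Fin 2) ℝ).toBasis, Matrix.det_fin_two]
  simp [LinearMap.toMatrix_apply, paramLin_apply]
  ring

theorem map_param {p u v : Pt} (h : u 0 * v 1 - u 1 * v 0 ≠ 0) :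
    Measure.map (param p u v) volume =
      ENNReal.ofReal |(u 0 * v 1 - u 1 * v 0)⁻¹| • (volume : Measure Pt) := by
  have e : param p u v = (fun x => p + x) ∘ (paramLin u v) ∘
      (fun z : ℝ × ℝ => (!₂[z.1, z.2] : Pt)) := by
    funext z; simp [param, paramLin_apply]
  have hl : Measurable (paramLin u v) := (paramLin u v).continuous_of_finiteDimensional.measurable
  rw [e, ← Measure.map_map (measurable_const_add p) (hl.comp measurePreserving_pair.measurable),
    ← Measure.map_map hl measurePreserving_pair.measurable, measurePreserving_pair.map_eq,
    Measure.map_linearMap_addHaar_eq_smul_addHaar volume (by rwa [det_paramLin]), det_paramLin,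
    Measure.map_smul, map_add_left_eq_self]

theorem measurableEmbedding_param {p u v : Pt} (h : u 0 * v 1 - u 1 * v 0 ≠ 0) :
    MeasurableEmbedding (param p u v) :=
  (continuous_param p u v).measurableEmbedding (param_injective h)

theorem integral_param {p u v : Pt} (h : u 0 * v 1 - u 1 * v 0 ≠ 0) (f : Pt → ℝ) :
    ∫ x, f x = |u 0 * v 1 - u 1 * v 0| * ∫ z, f (param p u v z) := by
  rw [← (measurableEmbedding_param h).integral_map, map_param h, integral_smul_measure,
    ENNReal.toReal_ofReal (abs_nonneg _), smul_eq_mul, ← mul_assoc, ← abs_mul,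
    mul_inv_cancel₀ h, abs_one, one_mul]

/-- The reference triangle. -/
def refTri : Set (ℝ × ℝ) := {z | 0 ≤ z.1 ∧ 0 ≤ z.2 ∧ z.1 + z.2 ≤ 1}

/-- The area of the reference triangle. -/
def refArea : ℝ := volume.real refTri

theorem refArea_pos : 0 < refArea := by
  have hb : refTri ⊆ Set.Icc 0 1 ×ˢ Set.Icc 0 1 := by
    rintro ⟨s, t⟩ ⟨h1, h2, h3⟩
    simp only at h1 h2 h3
    exact ⟨⟨h1, by simp only; linarith⟩, ⟨h2, by simp only; linarith⟩⟩
  have hlt : volume refTri < ⊤ :=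
    (measure_mono hb).trans_lt (isCompact_Icc.prod isCompact_Icc).measure_lt_top
  refine ENNReal.toReal_pos (ne_of_gt ?_) hlt.ne
  have ho : IsOpen {z : ℝ × ℝ | 0 < z.1 ∧ 0 < z.2 ∧ z.1 + z.2 < 1} :=
    (isOpen_lt continuous_const continuous_fst).inter ((isOpen_lt continuous_const
      continuous_snd).inter (isOpen_lt (continuous_fst.add continuous_snd) continuous_const))
  exact (ho.measure_pos volume ⟨(1 / 3, 1 / 3), by norm_num⟩).trans_le
    (measure_mono fun z hz => ⟨hz.1.le, hz.2.1.le, hz.2.2.le⟩)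

namespace Tri

variable {E : Tri}

theorem D_eq : E.D = (E.left - E.peak) 0 * (E.right - E.peak) 1 -
    (E.left - E.peak) 1 * (E.right - E.peak) 0 := by
  simp [D, det3]

theorem coord_param (hE : E.D ≠ 0) (z : ℝ × ℝ) :
    E.cP (param E.peak (E.left - E.peak) (E.right - E.peak) z) = 1 - z.1 - z.2 ∧
    E.cL (param E.peak (E.left - E.peak) (E.right - E.peak) z) = z.1 ∧
    E.cR (param E.peak (E.left - E.peak) (E.right - E.peak) z) = z.2 := by
  have e : param E.peak (E.left - E.peak) (E.right - E.peak) z =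
      (1 - z.1 - z.2) • E.peak + z.1 • E.left + z.2 • E.right := by
    simp only [param]; module
  rw [e]
  exact coord_comb hE (by ring)

/-- The parametrization maps the reference triangle onto `E` with Jacobian `D`. The value of
`refArea` is irrelevant; only its positivity enters later. -/
theorem area_eq (hE : E.D ≠ 0) : E.area = |E.D| * refArea := by
  have h : (param E.peak (E.left - E.peak) (E.right - E.peak)) ⁻¹' E.carrier = refTri := by
    ext z
    obtain ⟨h1, h2, h3⟩ := coord_param hE z
    rw [Set.mem_preimage, mem_carrier_iff hE, h1, h2, h3]
    constructor
    · rintro ⟨a, b, c⟩; exact ⟨b, c, by linarith⟩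
    · rintro ⟨a, b, c⟩; exact ⟨by linarith, a, b⟩
  have hd := hE
  rw [D_eq] at hd
  have hm := congrArg (fun μ => μ E.carrier) (map_param (p := E.peak) hd)
  simp only [Measure.smul_apply, smul_eq_mul] at hm
  rw [(measurableEmbedding_param hd).map_apply, h, ← D_eq] at hm
  have := congrArg ENNReal.toReal hm
  rw [ENNReal.toReal_mul, ENNReal.toReal_ofReal (abs_nonneg _)] at this
  change refArea = |E.D⁻¹| * E.area at this
  rw [this, ← mul_assoc, ← abs_mul, mul_inv_cancel₀ hE, abs_one, one_mul]

theorem area_pos (hE : E.D ≠ 0) : 0 < E.area := by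
  rw [area_eq hE]; exact mul_pos (abs_pos.2 hE) refArea_pos

theorem h_pos (hE : E.D ≠ 0) : 0 < E.h := Real.sqrt_pos.2 (area_pos hE)

theorem h_sq (hE : E.D ≠ 0) : E.h ^ 2 = E.area := Real.sq_sqrt (area_pos hE).le

/-! ### Shape regularity -/

/-- The sum of the squares of the lengths of the sides through the newest vertex. -/
def Q (E : Tri) : ℝ := ‖E.left - E.peak‖ ^ 2 + ‖E.right - E.peak‖ ^ 2

theorem norm_sq_eq (x : Pt) : ‖x‖ ^ 2 = x 0 ^ 2 + x 1 ^ 2 := by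
  rw [EuclideanSpace.norm_sq_eq, Fin.sum_univ_two]; simp

/-- The sides of a child through its newest vertex are the median and half of the bisection edge, so
this is the parallelogram law. As `|D|` is halved as well, `Q / |D|` is exactly invariant under
bisection: this is shape regularity. -/
theorem Q_child₁ : E.child₁.Q = E.Q / 2 := by
  simp only [Q, norm_sq_eq, child₁, mid, PiLp.sub_apply, midpoint_coord]; ring

theorem Q_child₂ : E.child₂.Q = E.Q / 2 := by
  simp only [Q, norm_sq_eq, child₂, mid, PiLp.sub_apply, midpoint_coord]; ring

theorem Q_nonneg : 0 ≤ E.Q := by unfold Q; positivity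

theorem Q_pos (hE : E.D ≠ 0) : 0 < E.Q := by
  have : 0 < ‖E.left - E.peak‖ := norm_pos_iff.2 (sub_ne_zero.2 (peak_ne_left hE).symm)
  unfold Q; positivity

theorem carrier_subset_closedBall : E.carrier ⊆ Metric.closedBall E.peak (Real.sqrt E.Q) := by
  refine convexHull_min ?_ (convex_closedBall _ _)
  intro x hx
  rw [Finset.mem_coe, mem_verts] at hx
  rw [Metric.mem_closedBall, dist_eq_norm]
  rcases hx with rfl | rfl | rfl
  · simp [Real.sqrt_nonneg]
  · exact Real.le_sqrt_of_sq_le (by unfold Q; nlinarith [sq_nonneg ‖E.right - E.peak‖])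
  · exact Real.le_sqrt_of_sq_le (by unfold Q; nlinarith [sq_nonneg ‖E.left - E.peak‖])

theorem norm_sub_le {x y : Pt} (hx : x ∈ E.carrier) (hy : y ∈ E.carrier) :
    ‖x - y‖ ≤ 2 * Real.sqrt E.Q := by
  have h1 := carrier_subset_closedBall hx
  have h2 := carrier_subset_closedBall hy
  rw [Metric.mem_closedBall] at h1 h2
  rw [← dist_eq_norm]
  linarith [dist_triangle_right x y E.peak]

end Tri

theorem Desc.Q_mul {F E : Tri} (h : Desc F E) : E.Q * |F.D| = F.Q * |E.D| := by
  induction h with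
  | refl => rfl
  | left _ ih =>
    rw [Tri.Q_child₁, Tri.D_child₁, abs_div, abs_two] at ih
    linarith
  | right _ ih =>
    rw [Tri.Q_child₂, Tri.D_child₂, abs_neg, abs_div, abs_two] at ih
    linarith

/-- The shape-regularity constant of a triangulation. -/
def shape (T₀ : Finset Tri) : ℝ := 1 + ∑ R ∈ T₀, R.Q / |R.D|

theorem shape_pos (T₀ : Finset Tri) : 0 < shape T₀ := by
  have : 0 ≤ ∑ R ∈ T₀, R.Q / |R.D| :=
    Finset.sum_nonneg fun R _ => div_nonneg Tri.Q_nonneg (abs_nonneg _)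
  unfold shape; linarith

/-! ### Shape regularity of refinements and finite overlap of the elements -/

section Refinement

variable {Ω : Set Pt} {T₀ T H : Finset Tri}

theorem IsRefinement.Q_le (hr : IsRefinement T₀ T H) (h₀ : IsConformingTriangulation Ω T₀) {E : Tri}
    (hE : E ∈ T) : E.Q ≤ shape T₀ * |E.D| := by
  obtain ⟨R, hR, hd⟩ := hr.exists_root.1 E hE
  have hD := abs_pos.2 (h₀.D_ne hR)
  have h1 : E.Q = R.Q / |R.D| * |E.D| := by
    rw [div_mul_eq_mul_div, eq_div_iff hD.ne', hd.Q_mul]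
  rw [h1]
  refine mul_le_mul_of_nonneg_right ?_ (abs_nonneg _)
  have := Finset.single_le_sum (f := fun R : Tri => R.Q / |R.D|)
    (fun R _ => div_nonneg Tri.Q_nonneg (abs_nonneg _)) hR
  unfold shape; linarith

/-- Bound for the number of elements that contain a given point. -/
def overlapBound (T₀ : Finset Tri) : ℝ :=
  4 * shape T₀ * volume.real (Metric.closedBall (0 : Pt) 1) / refArea

theorem overlapBound_nonneg (T₀ : Finset Tri) : 0 ≤ overlapBound T₀ := by
  have := shape_pos T₀
  have := refArea_pos
  unfold overlapBound; positivity

theorem Tri.volume_interior {E : Tri} : volume.real (interior E.carrier) = E.area := by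
  have h := Convex.addHaar_frontier (volume : Measure Pt) E.convex_carrier
  rw [Tri.area]
  refine congrArg ENNReal.toReal (measure_congr ?_)
  have hsub : (interior E.carrier : Set Pt) ⊆ E.carrier := interior_subset
  refine (hsub.eventuallyLE).antisymm ?_
  rw [ae_le_set]
  refine measure_mono_null ?_ h
  intro x hx
  exact ⟨subset_closure hx.1, hx.2⟩

/-- A packing argument. The elements at `x` may have very different sizes, so each is contracted
towards `x` to a common scale `r`. By convexity the copies of the interiors stay in their elements
and are disjoint; they lie in the ball of radius `r` about `x`, and shape regularity bounds their
areas below by a multiple of `r ^ 2`. -/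
theorem card_filter_mem_le (hr : IsRefinement T₀ T H) (h₀ : IsConformingTriangulation Ω T₀)
    (x : Pt) : ((T.filter fun E => x ∈ E.carrier).card : ℝ) ≤ overlapBound T₀ := by
  set S := T.filter fun E => x ∈ E.carrier with hS
  have hST : ∀ E ∈ S, E ∈ T ∧ x ∈ E.carrier := fun E hE => Finset.mem_filter.1 hE
  -- The common scale is the smallest of the diameter bounds `2 √Q`, so that all the homothety
  -- ratios are at most one; any positive value serves when no element contains `x`.
  obtain ⟨r, hr0, hrS⟩ : ∃ r : ℝ, 0 < r ∧ ∀ E ∈ S, r ≤ 2 * Real.sqrt E.Q := by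
    rcases S.eq_empty_or_nonempty with h | h
    · exact ⟨1, one_pos, by simp [h]⟩
    · obtain ⟨E, hE, hm⟩ := S.exists_min_image (fun E => 2 * Real.sqrt E.Q) h
      have := Real.sqrt_pos.2 (Tri.Q_pos (hr.D_ne h₀ (hST E hE).1))
      exact ⟨_, by positivity, hm⟩
  set A : Tri → Set Pt := fun E =>
    AffineMap.homothety x (r / (2 * Real.sqrt E.Q)) '' interior E.carrier with hA
  have ht : ∀ E ∈ S, 0 < r / (2 * Real.sqrt E.Q) ∧ r / (2 * Real.sqrt E.Q) ≤ 1 := by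
    intro E hE
    have := Real.sqrt_pos.2 (Tri.Q_pos (hr.D_ne h₀ (hST E hE).1))
    exact ⟨by positivity, (div_le_one (by positivity)).2 (hrS E hE)⟩
  have hAi : ∀ E ∈ S, A E ⊆ interior E.carrier := by
    rintro E hE _ ⟨y, hy, rfl⟩
    have := E.convex_carrier.combo_closure_interior_mem_interior (subset_closure (hST E hE).2) hy
      (sub_nonneg.2 (ht E hE).2) (ht E hE).1 (by ring)
    convert this using 1
    rw [AffineMap.homothety_apply, vsub_eq_sub, vadd_eq_add]; module
  have hAo : ∀ E ∈ S, MeasurableSet (A E) := by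
    intro E hE
    have hop := AffineMap.homothety_isOpenMap x _ (ht E hE).1.ne'
    exact (hop _ isOpen_interior).measurableSet
  have hAb : ∀ E ∈ S, A E ⊆ Metric.closedBall x r := by
    rintro E hE _ ⟨y, hy, rfl⟩
    have hQ := Real.sqrt_pos.2 (Tri.Q_pos (hr.D_ne h₀ (hST E hE).1))
    rw [Metric.mem_closedBall, dist_eq_norm, AffineMap.homothety_apply, vsub_eq_sub, vadd_eq_add,
      add_sub_cancel_right, norm_smul, Real.norm_eq_abs, abs_of_pos (ht E hE).1]
    have := Tri.norm_sub_le (interior_subset hy) (hST E hE).2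
    calc r / (2 * √E.Q) * ‖y - x‖ ≤ r / (2 * √E.Q) * (2 * √E.Q) :=
          mul_le_mul_of_nonneg_left this (ht E hE).1.le
      _ = r := by field_simp
  have hAv : ∀ E ∈ S, r ^ 2 * (refArea / (4 * shape T₀)) ≤ volume.real (A E) := by
    intro E hE
    have hD := hr.D_ne h₀ (hST E hE).1
    have hQ := Tri.Q_pos hD
    have e : volume.real (A E) = (r / (2 * Real.sqrt E.Q)) ^ 2 * E.area := by
      rw [← Tri.volume_interior, Measure.real, Measure.addHaar_image_homothety, ENNReal.toReal_mul,
        ENNReal.toReal_ofReal (abs_nonneg _), finrank_euclideanSpace, Fintype.card_fin,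
        abs_of_nonneg (sq_nonneg _)]
      rfl
    rw [e, Tri.area_eq hD, div_pow, mul_pow, Real.sq_sqrt hQ.le]
    have h1 := hr.Q_le h₀ (hST E hE).1
    have hs := shape_pos T₀
    have hR := refArea_pos
    rw [div_mul_eq_mul_div, mul_div_assoc', div_le_div_iff₀ (by positivity) (by positivity)]
    have := mul_le_mul_of_nonneg_left h1 (by positivity : 0 ≤ r ^ 2 * refArea)
    nlinarith
  have hdisj : (S : Set Tri).PairwiseDisjoint A := by
    intro E hE E' hE' hne
    exact ((hr.separated h₀ (hST E hE).1 (hST E' hE').1 hne).disjoint_interior).mono (hAi E hE)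
      (hAi E' hE')
  have hfin : volume (Metric.closedBall x r) ≠ ⊤ := (isCompact_closedBall x r).measure_lt_top.ne
  have hsum : ∑ E ∈ S, volume.real (A E) ≤ volume.real (Metric.closedBall x r) := by
    rw [← measureReal_biUnion_finset hdisj hAo
      (fun E hE => ((measure_mono (hAb E hE)).trans_lt hfin.lt_top).ne)]
    exact measureReal_mono (Set.iUnion₂_subset hAb) hfin
  have hball : volume.real (Metric.closedBall x r) =
      r ^ 2 * volume.real (Metric.closedBall (0 : Pt) 1) := by
    rw [Measure.real, Measure.addHaar_closedBall' _ _ hr0.le, ENNReal.toReal_mul,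
      ENNReal.toReal_ofReal (by positivity), finrank_euclideanSpace, Fintype.card_fin]
    rfl
  have h1 : (S.card : ℝ) * (r ^ 2 * (refArea / (4 * shape T₀))) ≤
      r ^ 2 * volume.real (Metric.closedBall (0 : Pt) 1) := by
    rw [← hball, ← nsmul_eq_mul, ← Finset.sum_const]
    exact (Finset.sum_le_sum hAv).trans hsum
  have hs := shape_pos T₀
  have hR := refArea_pos
  have h2 : (S.card : ℝ) * (refArea / (4 * shape T₀)) ≤
      volume.real (Metric.closedBall (0 : Pt) 1) := by
    refine le_of_mul_le_mul_left ?_ (by positivity : 0 < r ^ 2)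
    linarith
  rw [overlapBound, le_div_iff₀ hR]
  rw [mul_div_assoc', div_le_iff₀ (by positivity)] at h2
  linarith

end Refinement

/-! ### Functions that vanish at the proper nodes -/

section NodalEstimate

variable {Ω : Set Pt} {T₀ T H : Finset Tri}

/-- The nodes of global index at most `k`. -/
def nodesUpTo (T H : Finset Tri) (k : ℕ) : Finset Pt :=
  (nodes T).filter fun x => ∃ j ≤ k, IsGlobalIndex T H x j

theorem mem_nodesUpTo {k : ℕ} {x : Pt} :
    x ∈ nodesUpTo T H k ↔ x ∈ nodes T ∧ ∃ j ≤ k, IsGlobalIndex T H x j := by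
  simp [nodesUpTo]

/-- The constants of the recursion on the global index. -/
def nodalConst (M N : ℝ) : ℕ → ℝ
  | 0 => 0
  | k + 1 => M * (8 + 3 * N * nodalConst M N k)

theorem nodalConst_nonneg {M N : ℝ} (hM : 0 ≤ M) (hN : 0 ≤ N) (k : ℕ) : 0 ≤ nodalConst M N k := by
  induction k with
  | zero => exact le_rfl
  | succ k ih => unfold nodalConst; positivity

/-- After exchanging the sums, each node is counted once per element on whose boundary it lies,
hence at most `overlapBound` times. -/
theorem sum_nodesOn_le (hr : IsRefinement T₀ T H) (h₀ : IsConformingTriangulation Ω T₀)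
    {g : Pt → ℝ} (hg : ∀ x, 0 ≤ g x) (S : Finset Pt) :
    ∑ E ∈ T, ∑ x ∈ S.filter (fun x => x ∈ nodesOn T E), g x ≤ overlapBound T₀ * ∑ x ∈ S, g x := by
  simp_rw [Finset.sum_filter]
  rw [Finset.sum_comm, Finset.mul_sum]
  refine Finset.sum_le_sum fun x _ => ?_
  rw [← Finset.sum_filter, Finset.sum_const, nsmul_eq_mul]
  refine mul_le_mul_of_nonneg_right ?_ (hg x)
  refine le_trans ?_ (card_filter_mem_le hr h₀ x)
  exact_mod_cast Finset.card_le_card fun E hE => by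
    rw [Finset.mem_filter] at hE ⊢
    exact ⟨hE.1, Tri.frontier_subset (mem_nodesOn.1 hE.2).2⟩

/-- On an element where the node hangs, `p E` is affine along the side containing both parents. Thus
`z` at the node equals the error there, minus half the errors at the parents, plus half the values
of `z` at the parents, whose index is at most `k`. -/
theorem sq_le_of_hanging (hr : IsRefinement T₀ T H) (h₀ : IsConformingTriangulation Ω T₀)
    {z : Pt → ℝ} (p : Tri → P1) {F : Tri} (hF : F ∈ H) (hh : IsHangingNode T F.mid) {i j k : ℕ}
    (hi : i ≤ k) (hj : j ≤ k) (hl : IsGlobalIndex T H F.left i) (hrt : IsGlobalIndex T H F.right j) :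
    ∃ E ∈ T, F.mid ∈ nodesOn T E ∧ z F.mid ^ 2 ≤ 8 * (∑ x ∈ nodesOn T E, (z x - p E x) ^ 2) +
      3 * ∑ x ∈ (nodesUpTo T H k).filter (fun x => x ∈ nodesOn T E), z x ^ 2 := by
  obtain ⟨E, hE, hx, hx'⟩ := hh.exists_elem
  have hD := hr.D_ne h₀ hE
  obtain ⟨a, b, ha, hb, m1, m2⟩ := hr.edge_subset_side h₀ hE hF hx hx'
  have hs := Tri.segment_subset_frontier hD ha hb
  have hm : F.mid ∈ segment ℝ a b := (convex_segment a b).midpoint_mem m1 m2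
  have n0 : F.mid ∈ nodesOn T E := mem_nodesOn.2 ⟨hh.1, hs hm⟩
  have n1 : F.left ∈ nodesOn T E := mem_nodesOn.2 ⟨hl.mem_nodes, hs m1⟩
  have n2 : F.right ∈ nodesOn T E := mem_nodesOn.2 ⟨hrt.mem_nodes, hs m2⟩
  refine ⟨E, hE, n0, ?_⟩
  have d : ∀ y ∈ nodesOn T E, (z y - p E y) ^ 2 ≤ ∑ x ∈ nodesOn T E, (z x - p E x) ^ 2 :=
    fun y hy => Finset.single_le_sum (f := fun y => (z y - p E y) ^ 2)
      (fun x _ => sq_nonneg _) hy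
  have e : ∀ y, y ∈ nodesOn T E → ∀ l ≤ k, IsGlobalIndex T H y l →
      z y ^ 2 ≤ ∑ x ∈ (nodesUpTo T H k).filter (fun x => x ∈ nodesOn T E), z x ^ 2 :=
    fun y hy l hlk hyl => Finset.single_le_sum (f := fun y => z y ^ 2) (fun x _ => sq_nonneg _)
      (Finset.mem_filter.2 ⟨mem_nodesUpTo.2 ⟨hyl.mem_nodes, l, hlk, hyl⟩, hy⟩)
  have d0 := d _ n0
  have d1 := d _ n1
  have d2 := d _ n2
  have e1 := e _ n1 _ hi hl
  have e2 := e _ n2 _ hj hrt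
  have hp : p E F.mid = (p E F.left + p E F.right) / 2 := by
    rw [Tri.mid, AffineMap.map_midpoint, midpoint_eq_smul_add]
    simp; ring
  generalize (∑ x ∈ nodesOn T E, (z x - p E x) ^ 2) = S at *
  generalize (∑ x ∈ (nodesUpTo T H k).filter (fun x => x ∈ nodesOn T E), z x ^ 2) = Y at *
  rw [hp] at d0
  set u := z F.mid - (p E F.left + p E F.right) / 2 with hu
  set v := z F.left - p E F.left with hv
  set w := z F.right - p E F.right with hw
  have hz : z F.mid = u - v / 2 - w / 2 + z F.left / 2 + z F.right / 2 := by
    rw [hu, hv, hw]; ring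
  -- Cauchy–Schwarz with five terms. The three errors contribute 5(1 + 1/4 + 1/4) ≤ 8 and the two
  -- parent values 5(1/4 + 1/4) ≤ 3, which explains the constants.
  have key : z F.mid ^ 2 ≤ 5 * (u ^ 2 + (v / 2) ^ 2 + (w / 2) ^ 2 + (z F.left / 2) ^ 2 +
      (z F.right / 2) ^ 2) := by
    rw [hz]
    nlinarith [sq_nonneg (u + v / 2), sq_nonneg (u + w / 2), sq_nonneg (u - z F.left / 2),
      sq_nonneg (u - z F.right / 2), sq_nonneg (v / 2 - w / 2), sq_nonneg (v / 2 + z F.left / 2),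
      sq_nonneg (v / 2 + z F.right / 2), sq_nonneg (w / 2 + z F.left / 2),
      sq_nonneg (w / 2 + z F.right / 2), sq_nonneg (z F.left / 2 - z F.right / 2)]
  nlinarith [sq_nonneg u, sq_nonneg v, sq_nonneg w]

/-- Each hanging node of index at most `k + 1` is charged to an element on which it hangs; an
element receives at most `M` charges. The values at nodes of index at most `k` are counted at most
`overlapBound` times, and the induction hypothesis absorbs them. -/
theorem sum_nodesUpTo_le (hr : IsRefinement T₀ T H) (h₀ : IsConformingTriangulation Ω T₀) {M : ℕ}
    (hM : ∀ E ∈ T, (nodesOn T E).card ≤ M) {z : Pt → ℝ} (hz : ∀ x, IsProperNode T x → z x = 0)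
    (p : Tri → P1) (k : ℕ) :
    ∑ x ∈ nodesUpTo T H k, z x ^ 2 ≤ nodalConst M (overlapBound T₀) k *
      ∑ E ∈ T, ∑ x ∈ nodesOn T E, (z x - p E x) ^ 2 := by
  induction k with
  | zero =>
    -- Nodes of index 0 are proper, and `z` vanishes there.
    rw [nodalConst, zero_mul]
    refine (Finset.sum_eq_zero fun x hx => ?_).le
    obtain ⟨-, j, hj, h⟩ := mem_nodesUpTo.1 hx
    cases h with
    | proper _ h => rw [hz x h]; norm_num
    | hanging => omega
  | succ k ih =>
    set G : Tri → ℝ := fun E => 8 * (∑ x ∈ nodesOn T E, (z x - p E x) ^ 2) +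
      3 * ∑ x ∈ (nodesUpTo T H k).filter (fun x => x ∈ nodesOn T E), z x ^ 2 with hG
    have hG0 : ∀ E, 0 ≤ G E := fun E => add_nonneg
      (mul_nonneg (by norm_num) (Finset.sum_nonneg fun _ _ => sq_nonneg _))
      (mul_nonneg (by norm_num) (Finset.sum_nonneg fun _ _ => sq_nonneg _))
    have h1 : ∀ x ∈ nodesUpTo T H (k + 1), z x ^ 2 ≤ ∑ E ∈ T, if x ∈ nodesOn T E then G E else 0 := by
      intro x hx
      have hnn : ∀ E ∈ T, 0 ≤ if x ∈ nodesOn T E then G E else 0 := fun E _ => by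
        split_ifs
        · exact hG0 E
        · exact le_rfl
      obtain ⟨-, j, hj, h⟩ := mem_nodesUpTo.1 hx
      cases h with
      | proper _ h =>
        rw [hz x h, zero_pow two_ne_zero]
        exact Finset.sum_nonneg hnn
      | hanging F i l hF hh hl hrt =>
        obtain ⟨E, hE, hn, hle⟩ := sq_le_of_hanging hr h₀ (z := z) p hF hh (k := k)
          (by have := le_max_left i l; omega) (by have := le_max_right i l; omega) hl hrt
        refine hle.trans ?_
        have := Finset.single_le_sum hnn hE
        rwa [if_pos hn] at this
    have h2 : ∑ x ∈ nodesUpTo T H (k + 1), ∑ E ∈ T, (if x ∈ nodesOn T E then G E else 0) ≤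
        ∑ E ∈ T, (M : ℝ) * G E := by
      rw [Finset.sum_comm]
      refine Finset.sum_le_sum fun E hE => ?_
      rw [← Finset.sum_filter, Finset.sum_const, nsmul_eq_mul]
      refine mul_le_mul_of_nonneg_right ?_ (hG0 E)
      exact_mod_cast (Finset.card_le_card fun x hx => (Finset.mem_filter.1 hx).2).trans (hM E hE)
    have h3 := sum_nodesOn_le hr h₀ (g := fun x => z x ^ 2) (fun x => sq_nonneg _) (nodesUpTo T H k)
    have hN := overlapBound_nonneg T₀
    calc ∑ x ∈ nodesUpTo T H (k + 1), z x ^ 2 ≤ ∑ E ∈ T, (M : ℝ) * G E :=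
          (Finset.sum_le_sum h1).trans h2
      _ = M * (8 * (∑ E ∈ T, ∑ x ∈ nodesOn T E, (z x - p E x) ^ 2) + 3 *
          ∑ E ∈ T, ∑ x ∈ (nodesUpTo T H k).filter (fun x => x ∈ nodesOn T E), z x ^ 2) := by
        rw [← Finset.mul_sum, hG, Finset.sum_add_distrib, ← Finset.mul_sum, ← Finset.mul_sum]
      _ ≤ M * (8 * (∑ E ∈ T, ∑ x ∈ nodesOn T E, (z x - p E x) ^ 2) + 3 *
          (overlapBound T₀ * (nodalConst M (overlapBound T₀) k *
            ∑ E ∈ T, ∑ x ∈ nodesOn T E, (z x - p E x) ^ 2))) := by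
        refine mul_le_mul_of_nonneg_left ?_ (Nat.cast_nonneg M)
        have := mul_le_mul_of_nonneg_left ih hN
        linarith
      _ = _ := by rw [nodalConst]; ring

/-- A discrete Poincaré inequality: vanishing at the proper nodes removes the affine part on every
element. Admissibility enters because at `k = Λ` the induction has reached all the nodes. -/
theorem sum_sq_nodes_le (hr : IsRefinement T₀ T H) (h₀ : IsConformingTriangulation Ω T₀) {Λ : ℕ}
    (hA : IsAdmissible Λ T H) {z : Pt → ℝ} (hz : ∀ x, IsProperNode T x → z x = 0) (p : Tri → P1) :
    ∑ E ∈ T, ∑ x ∈ nodesOn T E, z x ^ 2 ≤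
      overlapBound T₀ * nodalConst (closureBound Λ) (overlapBound T₀) Λ *
      ∑ E ∈ T, ∑ x ∈ nodesOn T E, (z x - p E x) ^ 2 := by
  have h1 := sum_nodesUpTo_le hr h₀ (fun E hE => card_nodesOn_le hr h₀ hA hE) hz p Λ
  have h2 := sum_nodesOn_le hr h₀ (g := fun x => z x ^ 2) (fun x => sq_nonneg _) (nodesUpTo T H Λ)
  have h3 : ∀ E, (nodesUpTo T H Λ).filter (fun x => x ∈ nodesOn T E) = nodesOn T E := by
    intro E
    ext x
    rw [Finset.mem_filter, mem_nodesUpTo]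
    exact ⟨fun h => h.2, fun h => ⟨⟨(mem_nodesOn.1 h).1, hA x (mem_nodesOn.1 h).1⟩, h⟩⟩
  simp_rw [h3] at h2
  rw [mul_assoc]
  exact h2.trans (mul_le_mul_of_nonneg_left h1 (overlapBound_nonneg T₀))

end NodalEstimate

/-! ### Affine polynomials -/

/-- The affine polynomial with gradient `g` and value `c` at the origin. -/
def mkP1 (g : Pt) (c : ℝ) : P1 where
  toFun x := g 0 * x 0 + g 1 * x 1 + c
  linear :=
    { toFun := fun x => g 0 * x 0 + g 1 * x 1
      map_add' := fun x y => by simp only [PiLp.add_apply]; ring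
      map_smul' := fun r x => by simp only [PiLp.smul_apply, smul_eq_mul, RingHom.id_apply]; ring }
  map_vadd' x v := by
    simp only [vadd_eq_add, PiLp.add_apply, LinearMap.coe_mk, AddHom.coe_mk]; ring

theorem mkP1_apply (g : Pt) (c : ℝ) (x : Pt) : mkP1 g c x = g 0 * x 0 + g 1 * x 1 + c := rfl

theorem grad1_mkP1 (g : Pt) (c : ℝ) : grad1 (mkP1 g c) = g := by
  apply pt_ext <;> simp [grad1, mkP1]

theorem P1_apply (p : P1) (x : Pt) : p x = (grad1 p) 0 * x 0 + (grad1 p) 1 * x 1 + p 0 := by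
  have hx : x = x 0 • EuclideanSpace.single (0 : Fin 2) (1 : ℝ) +
      x 1 • EuclideanSpace.single (1 : Fin 2) (1 : ℝ) := by
    apply pt_ext <;> simp
  have h := AffineMap.decomp' p
  have h1 : p.linear x = p x - p 0 := by
    have := p.linearMap_vsub x 0
    simpa using this
  have h2 : p.linear x = x 0 * p.linear (EuclideanSpace.single 0 1) +
      x 1 * p.linear (EuclideanSpace.single 1 1) := by
    conv_lhs => rw [hx]
    rw [map_add, map_smul, map_smul, smul_eq_mul, smul_eq_mul]
  simp only [grad1]
  simp only [Matrix.cons_val_zero, Matrix.cons_val_one]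
  linarith

theorem inner_pt (x y : Pt) : inner ℝ x y = x 0 * y 0 + x 1 * y 1 := by
  rw [PiLp.inner_apply, Fin.sum_univ_two]; simp [mul_comm]

theorem P1_sub (p : P1) (x y : Pt) : p x - p y = inner ℝ (grad1 p) (x - y) := by
  rw [P1_apply p x, P1_apply p y, inner_pt]; simp only [PiLp.sub_apply]; ring

theorem P1_lipschitz (p : P1) : LipschitzWith ‖grad1 p‖₊ p := by
  refine LipschitzWith.of_dist_le_mul fun x y => ?_
  rw [Real.dist_eq, P1_sub, dist_eq_norm]
  exact abs_real_inner_le_norm _ _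

theorem P1_continuous (p : P1) : Continuous p := (P1_lipschitz p).continuous

theorem P1_hasFDerivAt (p : P1) (x : Pt) : HasFDerivAt p (innerSL ℝ (grad1 p)) x := by
  have h : (p : Pt → ℝ) = fun x => innerSL ℝ (grad1 p) x + p 0 := by
    funext x; rw [P1_apply, innerSL_apply_apply, inner_pt]
  rw [h]
  exact (innerSL ℝ (grad1 p)).hasFDerivAt.add_const _

theorem Tri.P1_eq_coord {E : Tri} (hE : E.D ≠ 0) (p : P1) (x : Pt) :
    p x = E.cP x * p E.peak + E.cL x * p E.left + E.cR x * p E.right := by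
  have h := coord_smul hE x
  have h0 := congrArg (fun y : Pt => y 0) h
  have h1 := congrArg (fun y : Pt => y 1) h
  simp only [PiLp.add_apply, PiLp.smul_apply, smul_eq_mul] at h0 h1
  have hs := coord_sum hE x
  rw [P1_apply p x, P1_apply p E.peak, P1_apply p E.left, P1_apply p E.right, ← h0, ← h1]
  linear_combination (-p 0) * hs

theorem Tri.P1_ext {E : Tri} (hE : E.D ≠ 0) {p q : P1} (h : ∀ v ∈ E.verts, p v = q v) (x : Pt) :
    p x = q x := by
  rw [P1_eq_coord hE p, P1_eq_coord hE q, h _ (mem_verts.2 (Or.inl rfl)),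
    h _ (mem_verts.2 (Or.inr (Or.inl rfl))), h _ (mem_verts.2 (Or.inr (Or.inr rfl)))]

theorem Tri.exists_interp {E : Tri} (hE : E.D ≠ 0) (f : Pt → ℝ) :
    ∃ p : P1, ∀ v ∈ E.verts, p v = f v := by
  set β := f E.left - f E.peak with hβ
  set γ := f E.right - f E.peak with hγ
  set g : Pt := !₂[(β * (E.right 1 - E.peak 1) - γ * (E.left 1 - E.peak 1)) / E.D,
    (γ * (E.left 0 - E.peak 0) - β * (E.right 0 - E.peak 0)) / E.D] with hg
  have g0 : g 0 = (β * (E.right 1 - E.peak 1) - γ * (E.left 1 - E.peak 1)) / E.D := by simp [hg]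
  have g1 : g 1 = (γ * (E.left 0 - E.peak 0) - β * (E.right 0 - E.peak 0)) / E.D := by simp [hg]
  refine ⟨mkP1 g (f E.peak - g 0 * E.peak 0 - g 1 * E.peak 1), fun v hv => ?_⟩
  rw [mkP1_apply]
  rcases mem_verts.1 hv with rfl | rfl | rfl
  · ring
  · have : g 0 * (E.left 0 - E.peak 0) + g 1 * (E.left 1 - E.peak 1) = β := by
      rw [g0, g1]; field_simp; simp only [D, det3]; ring
    linarith
  · have : g 0 * (E.right 0 - E.peak 0) + g 1 * (E.right 1 - E.peak 1) = γ := by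
      rw [g0, g1]; field_simp; simp only [D, det3]; ring
    linarith

theorem P1_level_null {p : P1} (h : grad1 p ≠ 0) : volume {x : Pt | p x = 0} = 0 := by
  have hs := Measure.addHaar_affineSubspace (volume : Measure Pt)
    ((AffineSubspace.mk' (0 : ℝ) (⊥ : Submodule ℝ ℝ)).comap p) ?_
  · convert hs using 2
    ext x
    simp
  · intro htop
    have hz : ∀ x, p x = 0 := fun x => by
      have : x ∈ (AffineSubspace.mk' (0 : ℝ) (⊥ : Submodule ℝ ℝ)).comap p := htop ▸ trivial
      simpa [AffineSubspace.mem_comap] using this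
    have := P1_sub p (grad1 p) 0
    rw [hz, hz, sub_zero, sub_zero, real_inner_self_eq_norm_sq] at this
    exact h (norm_eq_zero.1 (pow_eq_zero_iff two_ne_zero |>.1 this.symm))

/-! ### Gluing Lipschitz functions -/

/-- Continuous induction along the segment from `x` to `y`: the parameters satisfying the estimate
from the start form a closed set, and each can be advanced inside one of the finitely many pieces.
No convexity of the pieces is needed and the constant is not enlarged. -/
theorem lipschitzWith_of_cover {ι : Type*} [Finite ι] {A : ι → Set Pt} (hA : ∀ i, IsClosed (A i))
    (hcov : ∀ x, ∃ i, x ∈ A i) {f : Pt → ℝ} {K : NNReal} (hf : ∀ i, LipschitzOnWith K f (A i)) :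
    LipschitzWith K f := by
  have hc : Continuous f := by
    refine (locallyFinite_of_finite A).continuous ?_ hA fun i => (hf i).continuousOn
    exact Set.eq_univ_of_forall fun x => Set.mem_iUnion.2 (hcov x)
  refine LipschitzWith.of_dist_le_mul fun x y => ?_
  set l : ℝ → Pt := fun t => AffineMap.lineMap x y t with hl
  have hlc : Continuous l := AffineMap.lineMap_continuous
  have hld : ∀ s t, dist (l s) (l t) = |s - t| * dist x y := fun s t => by
    rw [hl]; simp only [dist_lineMap_lineMap, Real.dist_eq]
  set S : Set ℝ := {t | dist (f (l 0)) (f (l t)) ≤ K * dist x y * t} with hS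
  have hSc : IsClosed S := isClosed_le
    (continuous_const.dist (hc.comp hlc)) (continuous_const.mul continuous_id)
  have h01 : Set.Icc (0 : ℝ) 1 ⊆ S := by
    refine (hSc.inter isClosed_Icc).Icc_subset_of_forall_exists_gt (by simp [hS]) ?_
    rintro t ⟨htS, ht⟩ b hb
    -- The closed pieces missing `l t` are avoided near `t`. If every piece through `l t` were also
    -- left immediately after `t`, nothing would cover the next points.
    obtain ⟨i, hi, hfr⟩ : ∃ i, l t ∈ A i ∧ ∃ᶠ t' in 𝓝[>] t, l t' ∈ A i := by
      by_contra! hcon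
      have hev : ∀ i, ∀ᶠ t' in 𝓝[>] t, l t' ∉ A i := fun i => by
        by_cases hti : l t ∈ A i
        · exact hcon i hti
        · have : ∀ᶠ t' in 𝓝 t, l t' ∈ (A i)ᶜ :=
            hlc.continuousAt.eventually ((hA i).isOpen_compl.mem_nhds hti)
          exact this.filter_mono nhdsWithin_le_nhds
      obtain ⟨t', ht'⟩ := (eventually_all.2 hev).exists
      obtain ⟨i, hi⟩ := hcov (l t')
      exact ht' i hi
    obtain ⟨t', ht', hmem⟩ := (hfr.and_eventually (Ioc_mem_nhdsGT hb)).exists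
    refine ⟨t', ?_, hmem⟩
    have h1 := (hf i).dist_le_mul _ hi _ ht'
    rw [hld, abs_sub_comm, abs_of_pos (sub_pos.2 hmem.1)] at h1
    have h2 := dist_triangle (f (l 0)) (f (l t)) (f (l t'))
    have h3 : dist (f (l 0)) (f (l t)) ≤ K * dist x y * t := htS
    change dist (f (l 0)) (f (l t')) ≤ K * dist x y * t'
    nlinarith
  have h1 := h01 (Set.right_mem_Icc.2 zero_le_one)
  simpa [hS, hl] using h1

/-! ### The conforming interpolant -/

section Refinement

variable {Ω : Set Pt} {T₀ T H : Finset Tri}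

theorem IsRefinement.carrier_subset (hr : IsRefinement T₀ T H)
    (h₀ : IsConformingTriangulation Ω T₀) {E : Tri} (hE : E ∈ T) : E.carrier ⊆ closure Ω := by
  obtain ⟨R, hR, hd⟩ := hr.exists_root.1 E hE
  rw [h₀.closure_eq]
  exact (hd.subset (h₀.D_ne hR)).trans (Set.subset_biUnion_of_mem (u := fun R : Tri => R.carrier) hR)

theorem IsRefinement.exists_mem_carrier (hr : IsRefinement T₀ T H)
    (h₀ : IsConformingTriangulation Ω T₀) {x : Pt} (hx : x ∈ closure Ω) :
    ∃ E ∈ T, x ∈ E.carrier := by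
  rw [h₀.closure_eq] at hx
  simp only [Set.mem_iUnion, exists_prop] at hx
  obtain ⟨R, hR, hx⟩ := hx
  obtain ⟨E, hE, -, hxE⟩ := hr.exists_mem h₀ hR hx
  exact ⟨E, hE, hxE⟩

/-- The affine pieces interpolate the recursive nodal values at the vertices, and reproduce them at
hanging nodes because these are averages. Two pieces therefore agree at the vertices of one element
lying on the other, hence on the whole contact set by `Separated.affine_eq`, and glue together. -/
theorem exists_conforming_interpolant (hr : IsRefinement T₀ T H)
    (h₀ : IsConformingTriangulation Ω T₀) {Λ : ℕ} (hA : IsAdmissible Λ T H) {u : Pt → ℝ}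
    (hu : ∀ x ∈ frontier Ω, u x = 0) :
    ∃ (w : Pt → ℝ) (p : Tri → P1), (∀ E ∈ T, ∀ x ∈ E.carrier, w x = p E x) ∧
      (∀ x, IsProperNode T x → w x = u x) ∧ ∀ x ∉ Ω, w x = 0 := by
  have hnode : ∀ x ∈ nodes T, ∃ r, NodalValue T H u x r := fun x hx => by
    obtain ⟨k, -, h⟩ := hA x hx
    exact h.exists_nodalValue
  have hp : ∀ E : Tri, ∃ p : P1, E ∈ T → ∀ v ∈ E.verts, ∀ r, NodalValue T H u v r → p v = r := by
    intro E
    by_cases hE : E ∈ T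
    · obtain ⟨p, hp⟩ := Tri.exists_interp (hr.D_ne h₀ hE) fun v =>
        if h : ∃ r, NodalValue T H u v r then h.choose else 0
      refine ⟨p, fun _ v hv r hvr => ?_⟩
      have hex : ∃ r, NodalValue T H u v r := ⟨r, hvr⟩
      rw [hp v hv, dif_pos hex]
      exact hex.choose_spec.unique hr h₀ hvr
    · exact ⟨0, fun h => absurd h hE⟩
  choose p hp using hp
  have hpn : ∀ E ∈ T, ∀ x ∈ E.carrier, ∀ r, NodalValue T H u x r → p E x = r :=
    fun E hE x hx r h => h.eq_affine hr h₀ hE (hp E hE) hx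
  have hpp : ∀ E ∈ T, ∀ E' ∈ T, ∀ x ∈ E.carrier, x ∈ E'.carrier → p E x = p E' x := by
    intro E hE E' hE' x hx hx'
    by_cases hne : E = E'
    · rw [hne]
    have key : ∀ y ∈ nodes T, y ∈ E.carrier → y ∈ E'.carrier → p E y = p E' y := by
      intro y hy h1 h2
      obtain ⟨r, h⟩ := hnode y hy
      rw [hpn E hE y h1 r h, hpn E' hE' y h2 r h]
    exact (hr.separated h₀ hE hE' hne).affine_eq
      (fun y hy h => key y (mem_nodes.2 ⟨E, hE, hy⟩) (Tri.verts_subset_carrier hy) h)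
      (fun y hy h => key y (mem_nodes.2 ⟨E', hE', hy⟩) h (Tri.verts_subset_carrier hy)) hx hx'
  set w : Pt → ℝ := fun x => if h : ∃ E ∈ T, x ∈ E.carrier then p h.choose x else 0 with hw
  have hwE : ∀ E ∈ T, ∀ x ∈ E.carrier, w x = p E x := by
    intro E hE x hx
    have hex : ∃ E ∈ T, x ∈ E.carrier := ⟨E, hE, hx⟩
    simp only [hw]
    rw [dif_pos hex]
    exact hpp _ hex.choose_spec.1 E hE x hex.choose_spec.2 hx
  refine ⟨w, p, hwE, ?_, ?_⟩
  · intro x hx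
    obtain ⟨E, hE, hv⟩ := mem_nodes.1 hx.1
    rw [hwE E hE x (Tri.verts_subset_carrier hv)]
    exact hp E hE x hv _ (NodalValue.proper x hx)
  · intro x hx
    by_cases hc : x ∈ closure Ω
    · have hf : x ∈ frontier Ω := by rw [frontier, h₀.isOpen.interior_eq]; exact ⟨hc, hx⟩
      obtain ⟨R, hR, a, ha, b, hb, hab, hsub, hxs⟩ := h₀.exists_side hf
      have hxR : x ∈ R.carrier := R.convex_carrier.segment_subset (Tri.verts_subset_carrier ha)
        (Tri.verts_subset_carrier hb) hxs
      obtain ⟨E, hE, hd, hxE⟩ := hr.exists_mem h₀ hR hxR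
      rw [hwE E hE x hxE]
      have hzero : ∀ v ∈ E.verts, v ∈ frontier Ω → p E v = 0 := fun v hv hvf => by
        obtain ⟨r, h⟩ := hnode v (mem_nodes.2 ⟨E, hE, hv⟩)
        rw [hp E hE v hv r h, h.eq_zero_of_frontier hr h₀ hu hvf]
      by_cases hv : x ∈ E.verts
      · exact hzero x hv hf
      -- A boundary point that is not a vertex of `E` lies on a side of `E` contained in ∂Ω; the
      -- nodal values vanish at its two ends.
      obtain ⟨c, d, hcv, hdv, -, hcs, hds, hxcd⟩ := h₀.side_cases hR hR hd ha hb hab hxs hxE hv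
      obtain ⟨t, -, rfl⟩ := mem_segment_iff_lineMap.1 hxcd
      rw [AffineMap.apply_lineMap, hzero c hcv (hsub hcs), hzero d hdv (hsub hds)]
      simp
    · have hex : ¬ ∃ E ∈ T, x ∈ E.carrier := fun ⟨E, hE, h⟩ => hc (hr.carrier_subset h₀ hE h)
      simp only [hw]
      rw [dif_neg hex]

theorem lipschitz_of_piecewise_affine (hr : IsRefinement T₀ T H)
    (h₀ : IsConformingTriangulation Ω T₀) {w : Pt → ℝ} {p : Tri → P1}
    (hw : ∀ E ∈ T, ∀ x ∈ E.carrier, w x = p E x) (hw0 : ∀ x ∉ Ω, w x = 0) :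
    ∃ K, LipschitzWith K w := by
  set K : NNReal := ∑ E ∈ T, ‖grad1 (p E)‖₊ with hK
  -- The cover consists of the elements together with the complement of Ω, indexed by `none`, where
  -- the function is zero.
  refine ⟨K, lipschitzWith_of_cover (ι := Option T)
    (A := fun i => i.elim Ωᶜ fun E => E.1.carrier) ?_ ?_ ?_⟩
  · rintro (_ | E)
    · exact h₀.isOpen.isClosed_compl
    · exact Tri.isCompact_carrier.isClosed
  · intro x
    by_cases hx : x ∈ Ω
    · obtain ⟨E, hE, h⟩ := hr.exists_mem_carrier h₀ (subset_closure hx)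
      exact ⟨some ⟨E, hE⟩, h⟩
    · exact ⟨none, hx⟩
  · rintro (_ | E)
    · intro x hx y hy
      rw [hw0 x hx, hw0 y hy]; simp
    · intro x hx y hy
      rw [hw E.1 E.2 x hx, hw E.1 E.2 y hy]
      refine (P1_lipschitz (p E.1) x y).trans (mul_le_mul_left ?_ _)
      exact_mod_cast Finset.single_le_sum (f := fun E : Tri => ‖grad1 (p E)‖₊)
        (fun _ _ => zero_le) E.2

theorem Tri.volume_frontier {E : Tri} : volume (frontier E.carrier) = 0 :=
  Convex.addHaar_frontier (volume : Measure Pt) E.convex_carrier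

/-- Off the null boundaries of the elements, `w` is locally affine or, outside the closed domain,
zero. A piece with nonzero gradient vanishes only on a null line. This is what makes truncation near
zero converge in the gradient norm. -/
theorem ae_fderiv_eq_zero (hr : IsRefinement T₀ T H) (h₀ : IsConformingTriangulation Ω T₀)
    {w : Pt → ℝ} {p : Tri → P1} (hw : ∀ E ∈ T, ∀ x ∈ E.carrier, w x = p E x)
    (hw0 : ∀ x ∉ Ω, w x = 0) : ∀ᵐ x, w x = 0 → fderiv ℝ w x = 0 := by
  have h1 : ∀ᵐ x : Pt, ∀ E ∈ T, x ∉ frontier E.carrier := by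
    rw [Finset.eventually_all]
    exact fun E _ => measure_eq_zero_iff_ae_notMem.1 Tri.volume_frontier
  have h2 : ∀ᵐ x : Pt, ∀ E ∈ T, grad1 (p E) ≠ 0 → p E x ≠ 0 := by
    rw [Finset.eventually_all]
    intro E _
    by_cases h : grad1 (p E) = 0
    · simp [h]
    · filter_upwards [measure_eq_zero_iff_ae_notMem.1 (P1_level_null h)] with x hx _
      exact hx
  filter_upwards [h1, h2] with x hx1 hx2 h
  by_cases hc : x ∈ closure Ω
  · obtain ⟨E, hE, hxE⟩ := hr.exists_mem_carrier h₀ hc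
    have hi : x ∈ interior E.carrier := by
      by_contra hni
      exact hx1 E hE ⟨subset_closure hxE, hni⟩
    have hg : grad1 (p E) = 0 := by
      by_contra hg
      exact hx2 E hE hg (by rw [← hw E hE x hxE, h])
    have heq : w =ᶠ[𝓝 x] p E := by
      filter_upwards [isOpen_interior.mem_nhds hi] with y hy
      exact hw E hE y (interior_subset hy)
    rw [heq.fderiv_eq, (P1_hasFDerivAt (p E) x).fderiv, hg, map_zero]
  · have heq : w =ᶠ[𝓝 x] fun _ => 0 := by
      filter_upwards [isClosed_closure.isOpen_compl.mem_nhds hc] with y hy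
      exact hw0 y fun hy' => hy (subset_closure hy')
    rw [heq.fderiv_eq]; simp

theorem IsConformingTriangulation.isCompact_closure (h₀ : IsConformingTriangulation Ω T₀) :
    IsCompact (closure Ω) := by
  rw [h₀.closure_eq]
  exact T₀.isCompact_biUnion fun E _ => Tri.isCompact_carrier

end Refinement

/-! ### Gradients -/

theorem gradient_coord (f : Pt → ℝ) (x : Pt) (i : Fin 2) :
    gradient f x i = fderiv ℝ f x (EuclideanSpace.single i 1) := by
  have h := InnerProductSpace.toDual_symm_apply (𝕜 := ℝ) (x := EuclideanSpace.single i (1 : ℝ))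
    (y := fderiv ℝ f x)
  rw [← h, gradient, EuclideanSpace.inner_single_right]
  simp

theorem norm_gradient (f : Pt → ℝ) (x : Pt) : ‖gradient f x‖ = ‖fderiv ℝ f x‖ := by
  rw [gradient, LinearIsometryEquiv.norm_map]

theorem norm_gradient_sub (f g : Pt → ℝ) (x : Pt) :
    ‖gradient f x - gradient g x‖ = ‖fderiv ℝ f x - fderiv ℝ g x‖ := by
  rw [gradient, gradient, ← map_sub, LinearIsometryEquiv.norm_map]

theorem measurable_gradient (f : Pt → ℝ) : Measurable (gradient f) :=
  (InnerProductSpace.toDual ℝ Pt).symm.continuous.measurable.comp (measurable_fderiv ℝ f)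

theorem tendsto_eLpNorm_zero {F : Type*} [NormedAddCommGroup F] {μ : Measure Pt}
    [IsFiniteMeasure μ] {f : ℕ → Pt → F} {C : ℝ} (hm : ∀ n, AEStronglyMeasurable (f n) μ)
    (hb : ∀ n, ∀ᵐ x ∂μ, ‖f n x‖ ≤ C) (h : ∀ᵐ x ∂μ, Tendsto (fun n => f n x) atTop (𝓝 0)) :
    Tendsto (fun n => eLpNorm (f n) 2 μ) atTop (𝓝 0) := by
  have h1 : Tendsto (fun n => ∫⁻ x, ‖f n x‖ₑ ^ (2 : ℝ) ∂μ) atTop (𝓝 (∫⁻ _, 0 ∂μ)) := by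
    refine tendsto_lintegral_of_dominated_convergence' (fun _ => ENNReal.ofReal C ^ (2 : ℝ))
      (fun n => (hm n).enorm.pow_const _) (fun n => ?_) ?_ ?_
    · filter_upwards [hb n] with x hx
      refine ENNReal.rpow_le_rpow ?_ (by norm_num)
      rw [← ofReal_norm]
      exact ENNReal.ofReal_le_ofReal hx
    · rw [lintegral_const]
      exact ENNReal.mul_ne_top (ENNReal.rpow_ne_top_of_nonneg (by norm_num) ENNReal.ofReal_ne_top)
        (measure_ne_top μ _)
    · filter_upwards [h] with x hx
      have := (continuous_enorm.tendsto (0 : F)).comp hx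
      rw [enorm_zero] at this
      have h2 := (ENNReal.continuous_rpow_const (y := 2)).tendsto 0 |>.comp this
      rw [ENNReal.zero_rpow_of_pos (by norm_num)] at h2
      exact h2
  rw [lintegral_zero] at h1
  have h2 := (ENNReal.continuous_rpow_const (y := 1 / 2)).tendsto 0 |>.comp h1
  rw [ENNReal.zero_rpow_of_pos (by norm_num)] at h2
  refine h2.congr fun n => ?_
  rw [eLpNorm_eq_lintegral_rpow_enorm_toReal two_ne_zero ENNReal.ofNat_ne_top]
  simp

/-! ### Lipschitz functions vanishing outside a domain belong to `H¹₀` -/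

open scoped Convolution in
-- Differentiation under the integral, with the derivative on the Lipschitz factor: Rademacher's
-- theorem gives it almost everywhere, and `K` times the bump dominates the difference quotients.
theorem hasFDerivAt_convolution_lipschitz {g : Pt → ℝ} {K : NNReal} (hg : LipschitzWith K g)
    (b : ContDiffBump (0 : Pt)) (x : Pt) :
    HasFDerivAt (b.normed volume ⋆[ContinuousLinearMap.lsmul ℝ ℝ, volume] g)
      ((b.normed volume ⋆[ContinuousLinearMap.lsmul ℝ ℝ, volume] (fderiv ℝ g)) x) x := by
  have hbc : Continuous (b.normed volume) := b.continuous_normed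
  have hbs : HasCompactSupport (b.normed volume) := b.hasCompactSupport_normed
  have hbi : Integrable (b.normed volume) volume := hbc.integrable_of_hasCompactSupport hbs
  have hmeas : ∀ y, AEStronglyMeasurable (fun t => b.normed volume t • g (y - t)) volume :=
    fun y => (hbc.smul (hg.continuous.comp (continuous_const.sub continuous_id))).aestronglyMeasurable
  have key := hasFDerivAt_integral_of_dominated_loc_of_lip (𝕜 := ℝ) (μ := (volume : Measure Pt))
    (F := fun y t => b.normed volume t • g (y - t))
    (F' := fun t => b.normed volume t • fderiv ℝ g (x - t))
    (bound := fun t => K * b.normed volume t) (x₀ := x) (s := Set.univ) Filter.univ_mem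
    (Eventually.of_forall hmeas) ?_ ?_ ?_ (hbi.const_mul _) ?_
  · have := key.2
    simp only [convolution_def, ContinuousLinearMap.lsmul_apply]
    exact this
  · exact (hbc.smul (hg.continuous.comp (continuous_const.sub continuous_id))).integrable_of_hasCompactSupport
      hbs.smul_right
  · exact (hbc.measurable.smul ((measurable_fderiv ℝ g).comp (measurable_const.sub
      measurable_id))).aestronglyMeasurable
  · refine Eventually.of_forall fun t => ?_
    refine (LipschitzWith.of_dist_le_mul fun y z => ?_).lipschitzOnWith
    have hn := b.nonneg_normed (μ := volume) t
    have h1 := hg.dist_le_mul (y - t) (z - t)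
    rw [dist_sub_right] at h1
    rw [dist_eq_norm, ← smul_sub, norm_smul, ← dist_eq_norm, Real.norm_of_nonneg hn]
    rw [Real.coe_nnabs, abs_of_nonneg (mul_nonneg K.coe_nonneg hn)]
    nlinarith
  · have h1 := hg.ae_differentiableAt (μ := (volume : Measure Pt))
    have h2 := (Measure.measurePreserving_sub_left (volume : Measure Pt) x).quasiMeasurePreserving.ae h1
    filter_upwards [h2] with t ht
    have h3 : HasFDerivAt (fun y => g (y - t)) (fderiv ℝ g (x - t)) x :=
      (ht.hasFDerivAt).comp x ((hasFDerivAt_id x).sub_const t)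
    exact h3.fun_const_smul _

section Domain

variable {Ω : Set Pt}

open scoped Convolution in
-- Mollification: the gradient of the mollified function is the mollified gradient, bounded by the
-- Lipschitz constant and convergent almost everywhere by Lebesgue differentiation.
theorem exists_test_sequence (hΩ : IsOpen Ω) (hc : IsCompact (closure Ω)) {g : Pt → ℝ} {K : NNReal}
    (hg : LipschitzWith K g) (hgc : HasCompactSupport g) (hgs : tsupport g ⊆ Ω) :
    ∃ φ : ℕ → Pt → ℝ, (∀ n, IsTestFunction Ω (φ n)) ∧
      Tendsto (fun n => eLpNorm (fun x => φ n x - g x) 2 (volume.restrict Ω)) atTop (𝓝 0) ∧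
      Tendsto (fun n => eLpNorm (fun x => gradient (φ n) x - gradient g x) 2 (volume.restrict Ω))
        atTop (𝓝 0) := by
  have hfin : IsFiniteMeasure (volume.restrict Ω) :=
    ⟨by rw [Measure.restrict_apply_univ]
        exact (measure_mono subset_closure).trans_lt hc.measure_lt_top⟩
  -- The margin `δ` keeps the supports of the mollified functions inside Ω.
  obtain ⟨δ, hδ, hδΩ⟩ := hgc.isCompact.exists_cthickening_subset_open hΩ hgs
  -- The fixed ratio 2 between outer and inner radius is what the almost everywhere convergence of
  -- the convolutions requires.
  set b : ℕ → ContDiffBump (0 : Pt) := fun n =>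
    { rIn := δ / (n + 1) / 2
      rOut := δ / (n + 1)
      rIn_pos := by positivity
      rIn_lt_rOut := half_lt_self (by positivity) } with hb
  have hout : ∀ n, (b n).rOut = δ / (n + 1) := fun n => rfl
  have hout_le : ∀ n, (b n).rOut ≤ δ := fun n => by
    rw [hout]; exact div_le_self hδ.le (by linarith [(Nat.cast_nonneg n : (0 : ℝ) ≤ n)])
  have hout0 : Tendsto (fun n => (b n).rOut) atTop (𝓝 0) :=
    tendsto_const_div_atTop_nhds_zero_nat δ |>.comp (tendsto_add_atTop_nat 1) |>.congr fun n => by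
      simp [hout]
  have hfd : LocallyIntegrable (fderiv ℝ g) volume := by
    refine (locallyIntegrable_const (K : ℝ)).mono (measurable_fderiv ℝ g).aestronglyMeasurable ?_
    exact Eventually.of_forall fun x => by
      rw [Real.norm_of_nonneg K.coe_nonneg]; exact norm_fderiv_le_of_lipschitz ℝ hg
  set φ : ℕ → Pt → ℝ := fun n => (b n).normed volume ⋆[ContinuousLinearMap.lsmul ℝ ℝ, volume] g
    with hφ
  have hφfd : ∀ n x, fderiv ℝ (φ n) x =
      ((b n).normed volume ⋆[ContinuousLinearMap.lsmul ℝ ℝ, volume] (fderiv ℝ g)) x :=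
    fun n x => (hasFDerivAt_convolution_lipschitz hg (b n) x).fderiv
  have hsm : ∀ n, ContDiff ℝ ∞ (φ n) := fun n =>
    (b n).hasCompactSupport_normed.contDiff_convolution_left _ (b n).contDiff_normed
      hg.continuous.locallyIntegrable
  refine ⟨φ, fun n => ⟨hsm n, ?_, ?_⟩, ?_, ?_⟩
  · exact (b n).hasCompactSupport_normed.convolution _ hgc
  · refine Set.Subset.trans (closure_minimal ?_ Metric.isClosed_cthickening) hδΩ
    refine (support_convolution_subset_swap _).trans ?_
    rintro _ ⟨y, hy, z, hz, rfl⟩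
    rw [(b n).support_normed_eq, mem_ball_zero_iff] at hz
    refine Metric.mem_cthickening_of_dist_le _ y δ _ (subset_tsupport g hy) ?_
    rw [dist_eq_norm]
    simpa using hz.le.trans (hout_le n)
  · refine tendsto_eLpNorm_zero (C := K * δ) (fun n => ?_) (fun n => ?_) ?_
    · exact ((hsm n).continuous.sub hg.continuous).aestronglyMeasurable
    · refine Eventually.of_forall fun x => ?_
      rw [← dist_eq_norm]
      refine (b n).dist_normed_convolution_le hg.continuous.aestronglyMeasurable fun y hy => ?_
      refine (hg.dist_le_mul y x).trans (mul_le_mul_of_nonneg_left ?_ K.2)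
      exact (Metric.mem_ball.1 hy).le.trans (hout_le n)
    · refine Eventually.of_forall fun x => ?_
      have := ContDiffBump.convolution_tendsto_right_of_continuous (μ := volume) hout0 hg.continuous x
      have h2 := this.sub_const (g x)
      rwa [sub_self] at h2
  · refine tendsto_eLpNorm_zero (C := K + K) (fun n => ?_) (fun n => ?_) ?_
    · exact ((measurable_gradient _).sub (measurable_gradient _)).aestronglyMeasurable
    · refine Eventually.of_forall fun x => ?_
      rw [norm_gradient_sub]
      refine (norm_sub_le _ _).trans (add_le_add ?_ (norm_fderiv_le_of_lipschitz ℝ hg))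
      rw [hφfd, convolution_def]
      refine (norm_integral_le_of_norm_le (g := fun t => (b n).normed volume t * K) ?_ ?_).trans_eq ?_
      · exact ((b n).continuous_normed.integrable_of_hasCompactSupport
          (b n).hasCompactSupport_normed).mul_const _
      · refine Eventually.of_forall fun t => ?_
        have hn := (b n).nonneg_normed (μ := volume) t
        rw [ContinuousLinearMap.lsmul_apply, norm_smul, Real.norm_of_nonneg hn]
        exact mul_le_mul_of_nonneg_left (norm_fderiv_le_of_lipschitz ℝ hg) hn
      · rw [integral_mul_const, (b n).integral_normed, one_mul]
    · have hae := ContDiffBump.ae_convolution_tendsto_right_of_locallyIntegrable (K := 2) (φ := b) hout0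
        (Eventually.of_forall fun n => by simp only [hb]; linarith) hfd
      refine ae_restrict_of_ae ?_
      filter_upwards [hae] with x hx
      rw [tendsto_zero_iff_norm_tendsto_zero]
      simp only [norm_gradient_sub, hφfd]
      rw [← tendsto_iff_norm_sub_tendsto_zero]
      exact hx

/-- Truncation at distance `ε` from zero. -/
def shrink (ε t : ℝ) : ℝ := t - max (-ε) (min ε t)

theorem shrink_lipschitz {w : Pt → ℝ} {K : NNReal} (hw : LipschitzWith K w) (ε : ℝ) :
    LipschitzWith (K + K) fun x => shrink ε (w x) :=
  hw.sub ((hw.const_min ε).const_max (-ε))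

theorem abs_shrink_sub_le {ε : ℝ} (hε : 0 ≤ ε) (t : ℝ) : |shrink ε t - t| ≤ ε := by
  rw [shrink, sub_sub_cancel_left, abs_neg, abs_le]
  exact ⟨le_max_left _ _, max_le (by linarith) (min_le_left _ _)⟩

theorem shrink_of_abs_le {ε t : ℝ} (h : |t| ≤ ε) : shrink ε t = 0 := by
  rw [abs_le] at h
  rw [shrink, min_eq_right h.2, max_eq_right h.1, sub_self]

theorem shrink_of_le {ε t : ℝ} (hε : 0 ≤ ε) (h : ε ≤ t) : shrink ε t = t - ε := by
  rw [shrink, min_eq_left h, max_eq_right (by linarith)]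

theorem shrink_of_le_neg {ε t : ℝ} (hε : 0 ≤ ε) (h : t ≤ -ε) : shrink ε t = t + ε := by
  rw [shrink, min_eq_right (by linarith), max_eq_left h]; ring

/-- Near a point with `w x ≠ 0` the truncated function differs from `w` by a constant once `n` is
large. Near a zero of `w` it vanishes identically, and the hypothesis says that the derivative of
`w` is zero too. -/
theorem fderiv_shrink_eventually {w : Pt → ℝ} (hc : Continuous w) {x : Pt}
    (h : w x = 0 → fderiv ℝ w x = 0) :
    ∀ᶠ n : ℕ in atTop, fderiv ℝ (fun y => shrink (1 / ((n : ℝ) + 1)) (w y)) x = fderiv ℝ w x := by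
  have ht := tendsto_one_div_add_atTop_nhds_zero_nat (𝕜 := ℝ)
  rcases lt_trichotomy (w x) 0 with hx | hx | hx
  · filter_upwards [ht.eventually (gt_mem_nhds (show (0 : ℝ) < -w x by linarith))] with n hn
    have hn0 : (0 : ℝ) ≤ 1 / ((n : ℝ) + 1) := by positivity
    have heq : (fun y => shrink (1 / ((n : ℝ) + 1)) (w y)) =ᶠ[𝓝 x]
        fun y => w y + 1 / ((n : ℝ) + 1) := by
      filter_upwards [hc.continuousAt.eventually (gt_mem_nhds (show w x < -(1 / ((n : ℝ) + 1)) by linarith))]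
        with y hy
      exact shrink_of_le_neg hn0 hy.le
    rw [heq.fderiv_eq, fderiv_add_const]
  · refine Eventually.of_forall fun n => ?_
    have hn0 : (0 : ℝ) < 1 / ((n : ℝ) + 1) := by positivity
    have heq : (fun y => shrink (1 / ((n : ℝ) + 1)) (w y)) =ᶠ[𝓝 x] fun _ => 0 := by
      have := (continuous_abs.comp hc).continuousAt.eventually
        (gt_mem_nhds (show (abs ∘ w) x < 1 / ((n : ℝ) + 1) by simpa [hx] using hn0))
      filter_upwards [this] with y hy
      exact shrink_of_abs_le (le_of_lt hy)
    rw [heq.fderiv_eq, h hx]; simp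
  · filter_upwards [ht.eventually (gt_mem_nhds hx)] with n hn
    have hn0 : (0 : ℝ) ≤ 1 / ((n : ℝ) + 1) := by positivity
    have heq : (fun y => shrink (1 / ((n : ℝ) + 1)) (w y)) =ᶠ[𝓝 x]
        fun y => w y - 1 / ((n : ℝ) + 1) := by
      filter_upwards [hc.continuousAt.eventually (lt_mem_nhds hn)] with y hy
      exact shrink_of_le hn0 hy.le
    rw [heq.fderiv_eq, fderiv_sub_const]

theorem IsTestFunction.gradient_mul_integral {φ : Pt → ℝ} (hφ : IsTestFunction Ω φ) {w : Pt → ℝ}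
    {K : NNReal} (hw : LipschitzWith K w) (i : Fin 2) :
    ∫ x in Ω, w x * gradient φ x i = - ∫ x in Ω, gradient w x i * φ x := by
  obtain ⟨hsm, hcs, hsub⟩ := hφ
  obtain ⟨C, hC⟩ := hsm.lipschitzWith_of_hasCompactSupport hcs (by simp)
  have h := LipschitzWith.integral_lineDeriv_mul_eq (μ := (volume : Measure Pt)) hw hC hcs
    (EuclideanSpace.single i (1 : ℝ))
  have z1 : ∀ x ∉ Ω, w x * gradient φ x i = 0 := fun x hx => by
    have : x ∉ tsupport (fderiv ℝ φ) := fun h => hx (hsub (tsupport_fderiv_subset ℝ h))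
    rw [gradient_coord, image_eq_zero_of_notMem_tsupport this]; simp
  have z2 : ∀ x ∉ Ω, gradient w x i * φ x = 0 := fun x hx => by
    rw [image_eq_zero_of_notMem_tsupport fun h => hx (hsub h), mul_zero]
  rw [setIntegral_eq_integral_of_forall_compl_eq_zero z1,
    setIntegral_eq_integral_of_forall_compl_eq_zero z2]
  have e1 : ∫ x, lineDeriv ℝ w x (EuclideanSpace.single i 1) * φ x = ∫ x, gradient w x i * φ x := by
    refine integral_congr_ae ?_
    filter_upwards [hw.ae_differentiableAt (μ := (volume : Measure Pt))] with x hx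
    rw [gradient_coord, hx.lineDeriv_eq_fderiv]
  have e2 : ∫ x, lineDeriv ℝ φ x (-EuclideanSpace.single i 1) * w x =
      - ∫ x, w x * gradient φ x i := by
    rw [← integral_neg]
    refine integral_congr_ae (Eventually.of_forall fun x => ?_)
    simp only
    rw [gradient_coord, ((hsm.differentiable (by simp)) x).lineDeriv_eq_fderiv, map_neg]
    ring
  rw [e1, e2] at h
  rw [h, neg_neg]

/-- Truncation at height `ε` produces a function supported in `{ε ≤ |w|}`, a compact subset of Ω
because `w` is continuous and vanishes off Ω. It can thus be mollified inside Ω, and no regularity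
of ∂Ω is needed. -/
theorem memH10_of_lipschitz (hΩ : IsOpen Ω) (hc : IsCompact (closure Ω)) {w : Pt → ℝ} {K : NNReal}
    (hw : LipschitzWith K w) (hw0 : ∀ x ∉ Ω, w x = 0)
    (hae : ∀ᵐ x, w x = 0 → fderiv ℝ w x = 0) : MemH10 Ω w := by
  have hfin : IsFiniteMeasure (volume.restrict Ω) :=
    ⟨by rw [Measure.restrict_apply_univ]
        exact (measure_mono subset_closure).trans_lt hc.measure_lt_top⟩
  have hz : ∀ x ∉ closure Ω, w x = 0 := fun x hx => hw0 x fun h => hx (subset_closure h)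
  obtain ⟨M, hM⟩ : ∃ M, ∀ x, ‖w x‖ ≤ M :=
    hw.continuous.bounded_above_of_compact_support
      (HasCompactSupport.intro hc hz)
  set ε : ℕ → ℝ := fun n => 1 / ((n : ℝ) + 1) with hε
  have hε0 : ∀ n, 0 < ε n := fun n => by simp only [hε]; positivity
  have hε1 : ∀ n, ε n ≤ 1 := fun n => by
    simp only [hε]
    rw [div_le_one (by positivity)]
    linarith [(Nat.cast_nonneg n : (0 : ℝ) ≤ n)]
  set wn : ℕ → Pt → ℝ := fun n x => shrink (ε n) (w x) with hwn
  have hwnL : ∀ n, LipschitzWith (K + K) (wn n) := fun n => shrink_lipschitz hw _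
  have t1 : Tendsto (fun n => eLpNorm (fun x => wn n x - w x) 2 (volume.restrict Ω)) atTop (𝓝 0) := by
    refine tendsto_eLpNorm_zero (C := 1) (fun n => ((hwnL n).continuous.sub
      hw.continuous).aestronglyMeasurable) (fun n => Eventually.of_forall fun x =>
        (abs_shrink_sub_le (hε0 n).le _).trans (hε1 n)) (Eventually.of_forall fun x => ?_)
    exact squeeze_zero_norm (fun n => abs_shrink_sub_le (hε0 n).le _)
      tendsto_one_div_add_atTop_nhds_zero_nat
  have t2 : Tendsto (fun n => eLpNorm (fun x => gradient (wn n) x - gradient w x) 2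
      (volume.restrict Ω)) atTop (𝓝 0) := by
    refine tendsto_eLpNorm_zero (C := ((K + K : NNReal) : ℝ) + K) (fun n => ?_)
      (fun n => Eventually.of_forall fun x => ?_) (ae_restrict_of_ae ?_)
    · exact ((measurable_gradient _).sub (measurable_gradient _)).aestronglyMeasurable
    · rw [norm_gradient_sub]
      exact (norm_sub_le _ _).trans (add_le_add (norm_fderiv_le_of_lipschitz ℝ (hwnL n))
        (norm_fderiv_le_of_lipschitz ℝ hw))
    · filter_upwards [hae] with x hx
      refine tendsto_const_nhds.congr' ?_
      filter_upwards [fderiv_shrink_eventually hw.continuous hx] with n hn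
      rw [← norm_eq_zero.1 ((norm_gradient_sub (wn n) w x).trans ?_)]
      rw [norm_eq_zero, sub_eq_zero]
      exact hn
  have happ : ∀ η : ENNReal, 0 < η → ∃ φ, IsTestFunction Ω φ ∧
      eLpNorm (fun x => φ x - w x) 2 (volume.restrict Ω) ≤ η + η ∧
      eLpNorm (fun x => gradient φ x - gradient w x) 2 (volume.restrict Ω) ≤ η + η := by
    intro η hη
    obtain ⟨n, hn1, hn2⟩ := ((t1.eventually (gt_mem_nhds hη)).and
      (t2.eventually (gt_mem_nhds hη))).exists
    have hcl : IsClosed {x | ε n ≤ |w x|} := isClosed_le continuous_const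
      (continuous_abs.comp hw.continuous)
    have hsub : {x | ε n ≤ |w x|} ⊆ Ω := fun x hx => by
      by_contra h
      simp only [Set.mem_ofPred_eq, hw0 x h, abs_zero] at hx
      linarith [hε0 n]
    have hts : tsupport (wn n) ⊆ {x | ε n ≤ |w x|} := by
      refine closure_minimal (fun x hx => ?_) hcl
      by_contra h
      exact hx (shrink_of_abs_le (not_le.1 h).le)
    have hcs : HasCompactSupport (wn n) :=
      hc.of_isClosed_subset (isClosed_tsupport _) ((hts.trans hsub).trans subset_closure)
    obtain ⟨φ, hφ, s1, s2⟩ := exists_test_sequence hΩ hc (hwnL n) hcs (hts.trans hsub)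
    obtain ⟨m, hm1, hm2⟩ := ((s1.eventually (gt_mem_nhds hη)).and
      (s2.eventually (gt_mem_nhds hη))).exists
    refine ⟨φ m, hφ m, ?_, ?_⟩
    · have e : (fun x => φ m x - w x) = (fun x => φ m x - wn n x) + fun x => wn n x - w x := by
        funext x; simp
      rw [e]
      refine (eLpNorm_add_le ?_ ?_ (by norm_num)).trans (add_le_add hm1.le hn1.le)
      · exact ((hφ m).1.continuous.sub (hwnL n).continuous).aestronglyMeasurable
      · exact ((hwnL n).continuous.sub hw.continuous).aestronglyMeasurable
    · have e : (fun x => gradient (φ m) x - gradient w x) =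
          (fun x => gradient (φ m) x - gradient (wn n) x) +
            fun x => gradient (wn n) x - gradient w x := by
        funext x; simp
      rw [e]
      refine (eLpNorm_add_le ?_ ?_ (by norm_num)).trans (add_le_add hm2.le hn2.le)
      · exact ((measurable_gradient _).sub (measurable_gradient _)).aestronglyMeasurable
      · exact ((measurable_gradient _).sub (measurable_gradient _)).aestronglyMeasurable
  refine ⟨gradient w, ⟨?_, ?_, fun φ hφ i => hφ.gradient_mul_integral hw i⟩, ?_⟩
  · exact MemLp.of_bound hw.continuous.aestronglyMeasurable M (Eventually.of_forall hM)
  · exact MemLp.of_bound (measurable_gradient w).aestronglyMeasurable K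
      (Eventually.of_forall fun x => by
        rw [norm_gradient]; exact norm_fderiv_le_of_lipschitz ℝ hw)
  · have hη : ∀ n : ℕ, (0 : ENNReal) < ((n : ENNReal) + 1)⁻¹ := fun n =>
      ENNReal.inv_pos.2 (by finiteness)
    choose φ hφ h1 h2 using fun n : ℕ => happ _ (hη n)
    have ht : Tendsto (fun n : ℕ => ((n : ENNReal) + 1)⁻¹ + ((n : ENNReal) + 1)⁻¹) atTop (𝓝 0) := by
      have : Tendsto (fun n : ℕ => ((n : ENNReal) + 1)⁻¹) atTop (𝓝 0) := by
        have := (ENNReal.tendsto_inv_nat_nhds_zero).comp (tendsto_add_atTop_nat 1)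
        refine this.congr fun n => by simp
      simpa using this.add this
    exact ⟨φ, hφ, tendsto_of_tendsto_of_tendsto_of_le_of_le tendsto_const_nhds ht
      (fun _ => zero_le) h1, tendsto_of_tendsto_of_tendsto_of_le_of_le tendsto_const_nhds ht
      (fun _ => zero_le) h2⟩

end Domain

/-! ### Cutoff functions -/

/-- A smooth step, vanishing for `t ≤ 1` and equal to one for `t ≥ 2`. -/
def step (t : ℝ) : ℝ := Real.smoothTransition (t - 1)

theorem step_contDiff : ContDiff ℝ ∞ step :=
  Real.smoothTransition.contDiff.comp (contDiff_id.sub contDiff_const)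

theorem step_of_le {t : ℝ} (h : t ≤ 1) : step t = 0 :=
  Real.smoothTransition.zero_of_nonpos (by linarith)

theorem step_of_ge {t : ℝ} (h : 2 ≤ t) : step t = 1 :=
  Real.smoothTransition.one_of_one_le (by linarith)

theorem step_nonneg (t : ℝ) : 0 ≤ step t := Real.smoothTransition.nonneg _

theorem step_le_one (t : ℝ) : step t ≤ 1 := Real.smoothTransition.le_one _

theorem step_hasDerivAt (t : ℝ) : HasDerivAt step (deriv step t) t :=
  (step_contDiff.differentiable (by simp) t).hasDerivAt

theorem continuous_deriv_step : Continuous (deriv step) :=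
  step_contDiff.continuous_deriv (by simp)

theorem deriv_step_of_lt {t : ℝ} (h : t < 1) : deriv step t = 0 := by
  have : step =ᶠ[𝓝 t] fun _ => 0 := by
    filter_upwards [gt_mem_nhds h] with s hs
    exact step_of_le hs.le
  rw [this.deriv_eq]; simp

theorem deriv_step_of_gt {t : ℝ} (h : 2 < t) : deriv step t = 0 := by
  have : step =ᶠ[𝓝 t] fun _ => 1 := by
    filter_upwards [lt_mem_nhds h] with s hs
    exact step_of_ge hs.le
  rw [this.deriv_eq]; simp

theorem hasCompactSupport_deriv_step : HasCompactSupport (deriv step) := by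
  refine HasCompactSupport.intro (isCompact_Icc (a := (1 : ℝ)) (b := 2)) fun t ht => ?_
  rw [Set.mem_Icc, not_and_or, not_le, not_le] at ht
  exact ht.elim deriv_step_of_lt deriv_step_of_gt

theorem integral_deriv_step : ∫ t, deriv step t = 1 := by
  have h0 : Tendsto step atBot (𝓝 0) := by
    refine tendsto_const_nhds.congr' ?_
    filter_upwards [eventually_le_atBot 1] with t ht
    exact (step_of_le ht).symm
  have h1 : Tendsto step atTop (𝓝 1) := by
    refine tendsto_const_nhds.congr' ?_
    filter_upwards [eventually_ge_atTop 2] with t ht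
    exact (step_of_ge ht).symm
  have := integral_of_hasDerivAt_of_tendsto step_hasDerivAt
    (continuous_deriv_step.integrable_of_hasCompactSupport hasCompactSupport_deriv_step) h0 h1
  simpa using this

/-! ### Boundary layers of a triangle -/

namespace Tri

variable {E : Tri}

/-- Cyclic relabelling of the vertices. -/
def rot (E : Tri) : Tri := ⟨E.left, E.right, E.peak⟩

theorem rot_D : E.rot.D = E.D := by simp only [D, det3, rot]; ring

theorem rot_cP : E.rot.cP = E.cL := by funext x; simp only [cP, cL, rot_D]; rfl
theorem rot_cL : E.rot.cL = E.cR := by funext x; simp only [cL, cR, rot_D]; rfl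
theorem rot_cR : E.rot.cR = E.cP := by funext x; simp only [cR, cP, rot_D]; rfl

/-- The gradient of the barycentric coordinate of the newest vertex. -/
def gP (E : Tri) : Pt := !₂[-(E.right 1 - E.left 1) / E.D, (E.right 0 - E.left 0) / E.D]
/-- The gradient of the barycentric coordinate of the left vertex. -/
def gL (E : Tri) : Pt := !₂[-(E.peak 1 - E.right 1) / E.D, (E.peak 0 - E.right 0) / E.D]
/-- The gradient of the barycentric coordinate of the right vertex. -/
def gR (E : Tri) : Pt := !₂[-(E.left 1 - E.peak 1) / E.D, (E.left 0 - E.peak 0) / E.D]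

theorem rot_gP : E.rot.gP = E.gL := by simp only [gP, gL, rot_D]; rfl
theorem rot_gL : E.rot.gL = E.gR := by simp only [gL, gR, rot_D]; rfl

theorem cP_hasFDerivAt (x : Pt) : HasFDerivAt E.cP (innerSL ℝ E.gP) x := by
  have h : E.cP = mkP1 E.gP (E.cP 0) := by
    funext y; rw [mkP1_apply]; simp only [cP, det3, gP]; simp; ring
  have h2 := P1_hasFDerivAt (mkP1 E.gP (E.cP 0)) x
  rwa [← h, grad1_mkP1] at h2

theorem cL_hasFDerivAt (x : Pt) : HasFDerivAt E.cL (innerSL ℝ E.gL) x := by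
  rw [← rot_cP, ← rot_gP]; exact cP_hasFDerivAt x

theorem cR_hasFDerivAt (x : Pt) : HasFDerivAt E.cR (innerSL ℝ E.gR) x := by
  rw [← rot_cL, ← rot_gL]; exact cL_hasFDerivAt x

theorem cP_contDiff : ContDiff ℝ ∞ E.cP := by unfold cP det3; fun_prop
theorem cL_contDiff : ContDiff ℝ ∞ E.cL := by unfold cL det3; fun_prop
theorem cR_contDiff : ContDiff ℝ ∞ E.cR := by unfold cR det3; fun_prop

/-- The derivative of the cutoff function in the direction of the first barycentric coordinate. -/
def layer (E : Tri) (ε : ℝ) (x : Pt) : ℝ :=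
  deriv step (E.cP x / ε) / ε * (step (E.cL x / ε) * step (E.cR x / ε))

/-- In coordinates stretched by `1 / ε` across the side `[left, right]`, so that `cP = ε z.1`, the
Jacobian `ε |D|` cancels the factor `1 / ε` of the layer. -/
theorem layer_integral {ε : ℝ} (hE : E.D ≠ 0) (hε : 0 < ε) (v : Pt → ℝ) :
    ∫ x, v x * E.layer ε x = |E.D| * ∫ z : ℝ × ℝ,
      v (param E.left (ε • (E.peak - E.left)) (E.right - E.left) z) *
        (deriv step z.1 * (step ((1 - ε * z.1 - z.2) / ε) * step (z.2 / ε))) := by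
  have hdet : (ε • (E.peak - E.left) : Pt) 0 * (E.right - E.left) 1 -
      (ε • (E.peak - E.left) : Pt) 1 * (E.right - E.left) 0 = -(ε * E.D) := by
    simp only [PiLp.smul_apply, PiLp.sub_apply, smul_eq_mul, D, det3]; ring
  rw [integral_param (p := E.left) (u := ε • (E.peak - E.left)) (v := E.right - E.left)
    (by rw [hdet]; exact neg_ne_zero.2 (mul_ne_zero hε.ne' hE)), hdet, abs_neg, abs_mul,
    abs_of_pos hε, mul_comm ε, mul_assoc, ← integral_const_mul]
  congr 2
  funext z
  have e : param E.left (ε • (E.peak - E.left)) (E.right - E.left) z =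
      (ε * z.1) • E.peak + (1 - ε * z.1 - z.2) • E.left + z.2 • E.right := by
    simp only [param]; module
  obtain ⟨h1, h2, h3⟩ := coord_comb hE (α := ε * z.1) (β := 1 - ε * z.1 - z.2) (γ := z.2) (by ring)
  rw [layer, e, h1, h2, h3, mul_div_cancel_left₀ _ hε.ne']
  field_simp

theorem param_mem_carrier {ε : ℝ} (hE : E.D ≠ 0) {z : ℝ × ℝ} (h1 : 0 ≤ ε * z.1) (h2 : 0 ≤ z.2)
    (h3 : 0 ≤ 1 - ε * z.1 - z.2) :
    param E.left (ε • (E.peak - E.left)) (E.right - E.left) z ∈ E.carrier := by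
  have e : param E.left (ε • (E.peak - E.left)) (E.right - E.left) z =
      (ε * z.1) • E.peak + (1 - ε * z.1 - z.2) • E.left + z.2 • E.right := by
    simp only [param]; module
  obtain ⟨i1, i2, i3⟩ := coord_comb hE (α := ε * z.1) (β := 1 - ε * z.1 - z.2) (γ := z.2) (by ring)
  rw [mem_carrier_iff hE, e, i1, i2, i3]
  exact ⟨h1, h3, h2⟩

/-- The layer is an approximate arc-length measure on `[left, right]`: the transversal profile has
mass `∫ step' = 1`, while the two remaining factors tend to the indicator of the open side. -/
theorem layer_tendsto (hE : E.D ≠ 0) {v : Pt → ℝ} (hv : Continuous v) :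
    Tendsto (fun n : ℕ => ∫ x, v x * E.layer (1 / ((n : ℝ) + 1)) x) atTop
      (𝓝 (|E.D| * ∫ t in Set.Icc (0 : ℝ) 1, v (AffineMap.lineMap E.left E.right t))) := by
  set ε : ℕ → ℝ := fun n => 1 / ((n : ℝ) + 1) with hε
  have hε0 : ∀ n, 0 < ε n := fun n => by simp only [hε]; positivity
  have hεt : Tendsto ε atTop (𝓝 0) := tendsto_one_div_add_atTop_nhds_zero_nat
  refine Tendsto.congr (fun n => (layer_integral hE (hε0 n) v).symm) ?_
  refine Tendsto.const_mul _ ?_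
  obtain ⟨M, hM⟩ := isCompact_carrier (E := E).exists_bound_of_continuousOn hv.continuousOn
  obtain ⟨C, hC⟩ := hasCompactSupport_deriv_step.exists_bound_of_continuous continuous_deriv_step
  set G : ℝ × ℝ → ℝ := fun z => deriv step z.1 *
    (Set.Ioo (0 : ℝ) 1).indicator (fun t => v (AffineMap.lineMap E.left E.right t)) z.2 with hG
  have hlim : ∫ z, G z = ∫ t in Set.Icc (0 : ℝ) 1, v (AffineMap.lineMap E.left E.right t) := by
    simp only [hG]
    rw [Measure.volume_eq_prod, integral_prod_mul, integral_deriv_step, one_mul, integral_indicator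
      measurableSet_Ioo, integral_Icc_eq_integral_Ioo]
  rw [← hlim]
  refine tendsto_integral_of_dominated_convergence
    ((Set.Icc (1 : ℝ) 2 ×ˢ Set.Icc (0 : ℝ) 1).indicator fun _ => |M| * |C|) ?_ ?_ ?_ ?_
  · intro n
    have h1 := continuous_param E.left (ε n • (E.peak - E.left)) (E.right - E.left)
    have h2 := continuous_deriv_step
    have h3 := step_contDiff.continuous
    exact Continuous.aestronglyMeasurable (by fun_prop)
  · refine IntegrableOn.integrable_indicator ?_ (measurableSet_Icc.prod measurableSet_Icc)
    exact integrableOn_const (hs := (isCompact_Icc.prod isCompact_Icc).measure_lt_top.ne)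
  · intro n
    refine Eventually.of_forall fun z => ?_
    -- Domination: `step'` is supported in `[1, 2]` and the other factors vanish outside `E`, where
    -- `v` is not controlled.
    by_cases hz : z ∈ Set.Icc (1 : ℝ) 2 ×ˢ Set.Icc (0 : ℝ) 1 ∧ 0 ≤ 1 - ε n * z.1 - z.2
    · obtain ⟨hz, h3⟩ := hz
      rw [Set.indicator_of_mem hz]
      have hm := param_mem_carrier hE (mul_nonneg (hε0 n).le (zero_le_one.trans hz.1.1)) hz.2.1 h3
      rw [norm_mul, norm_mul]
      refine mul_le_mul ((hM _ hm).trans (le_abs_self M)) ?_ (by positivity) (abs_nonneg _)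
      refine (mul_le_of_le_one_right (norm_nonneg _) ?_).trans ((hC _).trans (le_abs_self C))
      rw [Real.norm_of_nonneg (mul_nonneg (step_nonneg _) (step_nonneg _))]
      exact mul_le_one₀ (step_le_one _) (step_nonneg _) (step_le_one _)
    · have h0 : deriv step z.1 * (step ((1 - ε n * z.1 - z.2) / ε n) * step (z.2 / ε n)) = 0 := by
        by_contra hne
        have a1 : deriv step z.1 ≠ 0 := left_ne_zero_of_mul hne
        have a2 := left_ne_zero_of_mul (right_ne_zero_of_mul hne)
        have a3 := right_ne_zero_of_mul (right_ne_zero_of_mul hne)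
        have b1 : 1 ≤ z.1 := by
          by_contra h; exact a1 (deriv_step_of_lt (not_le.1 h))
        have b2 : z.1 ≤ 2 := by
          by_contra h; exact a1 (deriv_step_of_gt (not_le.1 h))
        have b3 : 0 ≤ 1 - ε n * z.1 - z.2 := by
          by_contra h
          exact a2 (step_of_le ((div_nonpos_of_nonpos_of_nonneg (not_le.1 h).le (hε0 n).le).trans
            zero_le_one))
        have b4 : 0 ≤ z.2 := by
          by_contra h
          exact a3 (step_of_le ((div_nonpos_of_nonpos_of_nonneg (not_le.1 h).le (hε0 n).le).trans
            zero_le_one))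
        have b5 := mul_nonneg (hε0 n).le (zero_le_one.trans b1)
        exact hz ⟨⟨⟨b1, b2⟩, ⟨b4, by linarith⟩⟩, b3⟩
      rw [h0, mul_zero, norm_zero]
      exact Set.indicator_nonneg (fun _ _ => by positivity) _
  · have hnull : ∀ᵐ z : ℝ × ℝ, z.2 ≠ 0 ∧ z.2 ≠ 1 := by
      have hq : Measure.QuasiMeasurePreserving (Prod.snd : ℝ × ℝ → ℝ) volume volume :=
        Measure.quasiMeasurePreserving_snd
      have h : ∀ᵐ t : ℝ, t ≠ 0 ∧ t ≠ 1 := by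
        filter_upwards [Measure.ae_ne volume (0 : ℝ), Measure.ae_ne volume (1 : ℝ)] with t h0 h1
        exact ⟨h0, h1⟩
      exact hq.ae h
    filter_upwards [hnull] with z hz
    have hinv : Tendsto (fun n => (ε n)⁻¹) atTop atTop := by
      have : (fun n => (ε n)⁻¹) = fun n : ℕ => (n : ℝ) + 1 := by funext n; simp [hε]
      rw [this]
      exact tendsto_atTop_add_const_right _ _ tendsto_natCast_atTop_atTop
    rcases lt_or_gt_of_ne hz.1 with h0 | h0
    · refine tendsto_const_nhds.congr fun n => ?_
      rw [step_of_le (t := z.2 / ε n)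
        ((div_nonpos_of_nonpos_of_nonneg h0.le (hε0 n).le).trans zero_le_one)]
      simp [hG, h0.le]
    rcases lt_or_gt_of_ne hz.2 with h1 | h1
    · have hp : Tendsto (fun n => v (param E.left (ε n • (E.peak - E.left)) (E.right - E.left) z))
          atTop (𝓝 (v (AffineMap.lineMap E.left E.right z.2))) := by
        refine (hv.tendsto _).comp ?_
        have hc : Continuous fun s : ℝ => param E.left (s • (E.peak - E.left)) (E.right - E.left) z := by
          unfold param; fun_prop
        have e0 : param E.left ((0 : ℝ) • (E.peak - E.left)) (E.right - E.left) z =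
            AffineMap.lineMap E.left E.right z.2 := by
          simp [param, AffineMap.lineMap_apply, add_comm]
        rw [← e0]
        exact (hc.tendsto 0).comp hεt
      have e1 : ∀ᶠ n in atTop, step (z.2 / ε n) = 1 := by
        have := hinv.const_mul_atTop h0
        filter_upwards [this.eventually_ge_atTop 2] with n hn
        exact step_of_ge (by rwa [div_eq_mul_inv])
      have e2 : ∀ᶠ n in atTop, step ((1 - ε n * z.1 - z.2) / ε n) = 1 := by
        have := (hinv.const_mul_atTop (show 0 < 1 - z.2 by linarith))
        filter_upwards [this.eventually_ge_atTop (2 + z.1)] with n hn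
        refine step_of_ge ?_
        have : (1 - ε n * z.1 - z.2) / ε n = (1 - z.2) * (ε n)⁻¹ - z.1 := by
          have := (hε0 n).ne'
          field_simp
          ring
        linarith
      have hGz : G z = v (AffineMap.lineMap E.left E.right z.2) * deriv step z.1 := by
        simp only [hG]
        rw [Set.indicator_of_mem (show z.2 ∈ Set.Ioo (0 : ℝ) 1 from ⟨h0, h1⟩), mul_comm]
      rw [hGz]
      refine (hp.mul_const _).congr' ?_
      filter_upwards [e1, e2] with n h1 h2
      rw [h1, h2]; ring
    · refine tendsto_const_nhds.congr fun n => ?_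
      have hGz : G z = 0 := by simp [hG, h1.le]
      rw [hGz]
      by_cases hs : z.1 < 1
      · rw [deriv_step_of_lt hs]; ring
      · rw [step_of_le (t := (1 - ε n * z.1 - z.2) / ε n)]
        · ring
        · refine (div_nonpos_of_nonpos_of_nonneg ?_ (hε0 n).le).trans zero_le_one
          nlinarith [hε0 n]

end Tri

/-! ### The divergence theorem in a triangle -/

namespace Tri

variable {E : Tri}

/-- The cutoff function: it vanishes near the boundary of `E`. -/
def cutoff (E : Tri) (ε : ℝ) (x : Pt) : ℝ :=
  step (E.cP x / ε) * (step (E.cL x / ε) * step (E.cR x / ε))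

theorem cutoff_contDiff (ε : ℝ) : ContDiff ℝ ∞ (E.cutoff ε) :=
  (step_contDiff.comp (cP_contDiff.div_const ε)).mul
    ((step_contDiff.comp (cL_contDiff.div_const ε)).mul
      (step_contDiff.comp (cR_contDiff.div_const ε)))

theorem cutoff_nonneg (ε : ℝ) (x : Pt) : 0 ≤ E.cutoff ε x :=
  mul_nonneg (step_nonneg _) (mul_nonneg (step_nonneg _) (step_nonneg _))

theorem cutoff_le_one (ε : ℝ) (x : Pt) : E.cutoff ε x ≤ 1 :=
  mul_le_one₀ (step_le_one _) (mul_nonneg (step_nonneg _) (step_nonneg _))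
    (mul_le_one₀ (step_le_one _) (step_nonneg _) (step_le_one _))

theorem le_of_cutoff_ne_zero {ε : ℝ} (hε : 0 < ε) {x : Pt} (h : E.cutoff ε x ≠ 0) :
    ε ≤ E.cP x ∧ ε ≤ E.cL x ∧ ε ≤ E.cR x := by
  have key : ∀ t, step (t / ε) ≠ 0 → ε ≤ t := fun t ht => by
    by_contra hlt
    exact ht (step_of_le ((div_le_one hε).2 (not_le.1 hlt).le))
  exact ⟨key _ (left_ne_zero_of_mul h), key _ (left_ne_zero_of_mul (right_ne_zero_of_mul h)),
    key _ (right_ne_zero_of_mul (right_ne_zero_of_mul h))⟩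

theorem cutoff_isTest (hE : E.D ≠ 0) {ε : ℝ} (hε : 0 < ε) :
    IsTestFunction (interior E.carrier) (E.cutoff ε) := by
  have hcl : IsClosed {x | ε ≤ E.cP x ∧ ε ≤ E.cL x ∧ ε ≤ E.cR x} :=
    (isClosed_le continuous_const continuous_cP).inter
      ((isClosed_le continuous_const continuous_cL).inter
        (isClosed_le continuous_const continuous_cR))
  have hts : tsupport (E.cutoff ε) ⊆ {x | ε ≤ E.cP x ∧ ε ≤ E.cL x ∧ ε ≤ E.cR x} :=
    closure_minimal (fun x hx => le_of_cutoff_ne_zero hε hx) hcl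
  have hin : tsupport (E.cutoff ε) ⊆ interior E.carrier := fun x hx => by
    obtain ⟨h1, h2, h3⟩ := hts hx
    exact (mem_interior_iff hE).2 ⟨hε.trans_le h1, hε.trans_le h2, hε.trans_le h3⟩
  exact ⟨cutoff_contDiff ε, isCompact_carrier.of_isClosed_subset (isClosed_tsupport _)
    (hin.trans interior_subset), hin⟩

theorem cutoff_tendsto (hE : E.D ≠ 0) {x : Pt} (hx : x ∈ interior E.carrier) :
    Tendsto (fun n : ℕ => E.cutoff (1 / ((n : ℝ) + 1)) x) atTop (𝓝 1) := by
  obtain ⟨h1, h2, h3⟩ := (mem_interior_iff hE).1 hx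
  have key : ∀ t : ℝ, 0 < t → ∀ᶠ n : ℕ in atTop, step (t / (1 / ((n : ℝ) + 1))) = 1 := by
    intro t ht
    have := (tendsto_atTop_add_const_right atTop (1 : ℝ) tendsto_natCast_atTop_atTop).const_mul_atTop ht
    filter_upwards [this.eventually_ge_atTop 2] with n hn
    refine step_of_ge ?_
    rwa [div_div_eq_mul_div, div_one]
  refine tendsto_const_nhds.congr' ?_
  filter_upwards [key _ h1, key _ h2, key _ h3] with n e1 e2 e3
  rw [cutoff, e1, e2, e3]; norm_num

/-- Each factor of the cutoff yields the layer along one side; cyclic relabelling reduces the three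
layers to a single definition. -/
theorem gradient_cutoff (ε : ℝ) (x : Pt) (i : Fin 2) : gradient (E.cutoff ε) x i =
    E.gP i * E.layer ε x + E.gL i * E.rot.layer ε x + E.gR i * E.rot.rot.layer ε x := by
  have key : ∀ {f : Pt → ℝ} {g : Pt}, HasFDerivAt f (innerSL ℝ g) x →
      HasFDerivAt (fun y => step (f y / ε)) ((deriv step (f x / ε) / ε) • innerSL ℝ g) x := by
    intro f g hf
    have h1 : HasFDerivAt (fun y => f y / ε) (ε⁻¹ • innerSL ℝ g) x := by
      have := hf.const_mul ε⁻¹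
      refine this.congr_of_eventuallyEq (Eventually.of_forall fun y => ?_)
      simp only; rw [div_eq_inv_mul]
    have h2 := (step_hasDerivAt (f x / ε)).comp_hasFDerivAt x h1
    rwa [smul_smul, ← div_eq_mul_inv] at h2
  have hP := key (cP_hasFDerivAt (E := E) x)
  have hL := key (cL_hasFDerivAt (E := E) x)
  have hR := key (cR_hasFDerivAt (E := E) x)
  have h := hP.mul (hL.mul hR)
  have hfd : fderiv ℝ (E.cutoff ε) x = _ := h.fderiv
  rw [gradient_coord, hfd]
  simp only [layer, rot_cP, rot_cL, rot_cR, add_apply,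
    smul_apply, innerSL_apply_apply, EuclideanSpace.inner_single_right,
    smul_eq_mul]
  simp
  ring

theorem layer_continuous (ε : ℝ) : Continuous (E.layer ε) := by
  have h1 := continuous_deriv_step
  have h2 := step_contDiff.continuous
  have h3 := continuous_cP (E := E)
  have h4 := continuous_cL (E := E)
  have h5 := continuous_cR (E := E)
  unfold layer
  fun_prop

theorem layer_eq_zero (hE : E.D ≠ 0) {ε : ℝ} (hε : 0 < ε) {x : Pt} (hx : x ∉ interior E.carrier) :
    E.layer ε x = 0 := by
  by_contra h
  have h1 := left_ne_zero_of_mul h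
  have h2 := left_ne_zero_of_mul (right_ne_zero_of_mul h)
  have h3 := right_ne_zero_of_mul (right_ne_zero_of_mul h)
  have key : ∀ t, step (t / ε) ≠ 0 → 0 < t := fun t ht => by
    by_contra hlt
    exact ht (step_of_le ((div_nonpos_of_nonpos_of_nonneg (not_lt.1 hlt) hε.le).trans zero_le_one))
  refine hx ((mem_interior_iff hE).2 ⟨?_, key _ h2, key _ h3⟩)
  by_contra hlt
  refine h1 ?_
  rw [deriv_step_of_lt ((div_nonpos_of_nonpos_of_nonneg (not_lt.1 hlt) hε.le).trans_lt zero_lt_one),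
    zero_div]

theorem layer_integrable (hE : E.D ≠ 0) {ε : ℝ} (hε : 0 < ε) {v : Pt → ℝ} (hv : Continuous v) :
    Integrable fun x => v x * E.layer ε x := by
  refine (hv.mul (layer_continuous ε)).integrable_of_hasCompactSupport
    (HasCompactSupport.intro (isCompact_carrier (E := E)) fun x hx => ?_)
  show v x * E.layer ε x = 0
  rw [layer_eq_zero hE hε fun h => hx (interior_subset h), mul_zero]

theorem rot_carrier : E.rot.carrier = E.carrier := by
  have : E.rot.verts = E.verts := by
    ext x; simp only [mem_verts, rot]; tauto
  rw [carrier, carrier, this]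

/-- Mean value of `v` along the segment `[a, b]`. -/
def segMean (v : Pt → ℝ) (a b : Pt) : ℝ := ∫ t in Set.Icc (0 : ℝ) 1, v (AffineMap.lineMap a b t)

/-- The weak gradient is tested with cutoffs increasing to the full triangle. One side of the
identity converges to the integral of `g`, the other concentrates on the three sides. The vector
`-|D| gP` is the outward normal multiplied by the length of `[left, right]`. -/
theorem green_of_continuous (hE : E.D ≠ 0) {v : Pt → ℝ} (hv : Continuous v) {g : Pt → Pt}
    (hg : IntegrableOn g (interior E.carrier)) (hw : HasWeakGrad (interior E.carrier) v g) (i : Fin 2) :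
    ∫ x in interior E.carrier, g x i = -|E.D| * (E.gP i * segMean v E.left E.right +
      E.gL i * segMean v E.right E.peak + E.gR i * segMean v E.peak E.left) := by
  set ε : ℕ → ℝ := fun n => 1 / ((n : ℝ) + 1) with hε
  have hε0 : ∀ n, 0 < ε n := fun n => by simp only [hε]; positivity
  have hE1 : E.rot.D ≠ 0 := by rwa [rot_D]
  have hE2 : E.rot.rot.D ≠ 0 := by rwa [rot_D]
  have hgi : IntegrableOn (fun x => g x i) (interior E.carrier) := by
    have h := (EuclideanSpace.proj i : Pt →L[ℝ] ℝ).integrable_comp hg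
    exact h
  have l1 := layer_tendsto hE hv
  have l2 := layer_tendsto hE1 hv
  have l3 := layer_tendsto hE2 hv
  have hL : Tendsto (fun n => ∫ x in interior E.carrier, v x * gradient (E.cutoff (ε n)) x i) atTop
      (𝓝 (E.gP i * (|E.D| * segMean v E.left E.right) + E.gL i * (|E.rot.D| * segMean v E.rot.left E.rot.right)
        + E.gR i * (|E.rot.rot.D| * segMean v E.rot.rot.left E.rot.rot.right))) := by
    refine (((l1.const_mul (E.gP i)).add (l2.const_mul (E.gL i))).add (l3.const_mul (E.gR i))).congr
      fun n => ?_
    have z : ∀ x ∉ interior E.carrier, v x * gradient (E.cutoff (ε n)) x i = 0 := fun x hx => by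
      rw [gradient_cutoff, layer_eq_zero hE (hε0 n) hx,
        layer_eq_zero hE1 (hε0 n) (by rwa [rot_carrier]),
        layer_eq_zero hE2 (hε0 n) (by rwa [rot_carrier, rot_carrier])]
      ring
    rw [setIntegral_eq_integral_of_forall_compl_eq_zero z]
    have i1 := (layer_integrable hE (hε0 n) hv).const_mul (E.gP i)
    have i2 := (layer_integrable hE1 (hε0 n) hv).const_mul (E.gL i)
    have i3 := (layer_integrable hE2 (hε0 n) hv).const_mul (E.gR i)
    have e := integral_add (f := fun x => E.gP i * (v x * E.layer (ε n) x) +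
      E.gL i * (v x * E.rot.layer (ε n) x)) (i1.add i2) i3
    rw [integral_add i1 i2, integral_const_mul, integral_const_mul, integral_const_mul] at e
    refine e.symm.trans ?_
    refine integral_congr_ae (Eventually.of_forall fun x => ?_)
    simp only [gradient_cutoff]; ring
  have hR : Tendsto (fun n => - ∫ x in interior E.carrier, g x i * E.cutoff (ε n) x) atTop
      (𝓝 (-∫ x in interior E.carrier, g x i)) := by
    refine Tendsto.neg ?_
    refine tendsto_integral_of_dominated_convergence (fun x => ‖g x i‖) ?_ hgi.norm ?_ ?_
    · exact fun n => hgi.aestronglyMeasurable.mul (cutoff_contDiff _).continuous.aestronglyMeasurable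
    · refine fun n => Eventually.of_forall fun x => ?_
      rw [norm_mul, Real.norm_of_nonneg (cutoff_nonneg _ _)]
      exact mul_le_of_le_one_right (norm_nonneg _) (cutoff_le_one _ _)
    · filter_upwards [ae_restrict_mem isOpen_interior.measurableSet] with x hx
      have := (cutoff_tendsto hE hx).const_mul (g x i)
      rwa [mul_one] at this
  have heq := tendsto_nhds_unique (hL.congr fun n => hw _ (cutoff_isTest hE (hε0 n)) i) hR
  simp only [rot_D] at heq
  simp only [rot] at heq
  linarith

theorem segMean_congr {v w : Pt → ℝ} {a b : Pt} (h : ∀ x ∈ segment ℝ a b, v x = w x) :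
    segMean v a b = segMean w a b :=
  setIntegral_congr_fun measurableSet_Icc fun t ht =>
    h _ (mem_segment_iff_lineMap.2 ⟨t, ht, rfl⟩)

theorem exists_extension {v : Pt → ℝ} (hv : ContinuousOn v E.carrier) :
    ∃ w : Pt → ℝ, Continuous w ∧ ∀ x ∈ E.carrier, w x = v x := by
  obtain ⟨w, hw⟩ := ContinuousMap.exists_restrict_eq (Y := ℝ) isCompact_carrier.isClosed
    (⟨E.carrier.domRestrict v, continuousOn_iff_continuous_domRestrict.1 hv⟩ : C(E.carrier, ℝ))
  exact ⟨w, w.continuous, fun x hx => congrArg (fun f : C(E.carrier, ℝ) => f ⟨x, hx⟩) hw⟩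

/-- The divergence theorem for a continuous function with an integrable weak gradient. -/
theorem green (hE : E.D ≠ 0) {v : Pt → ℝ} (hv : ContinuousOn v E.carrier) {g : Pt → Pt}
    (hg : IntegrableOn g (interior E.carrier)) (hw : HasWeakGrad (interior E.carrier) v g) (i : Fin 2) :
    ∫ x in interior E.carrier, g x i = -|E.D| * (E.gP i * segMean v E.left E.right +
      E.gL i * segMean v E.right E.peak + E.gR i * segMean v E.peak E.left) := by
  obtain ⟨w, hwc, hwv⟩ := exists_extension hv
  have hs : ∀ {a b}, a ∈ E.verts → b ∈ E.verts → segMean w a b = segMean v a b := fun ha hb =>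
    segMean_congr fun x hx => hwv x (E.convex_carrier.segment_subset (verts_subset_carrier ha)
      (verts_subset_carrier hb) hx)
  have m1 : E.peak ∈ E.verts := mem_verts.2 (by simp)
  have m2 : E.left ∈ E.verts := mem_verts.2 (by simp)
  have m3 : E.right ∈ E.verts := mem_verts.2 (by simp)
  rw [← hs m2 m3, ← hs m3 m1, ← hs m1 m2]
  refine green_of_continuous hE hwc hg (fun φ hφ i => ?_) i
  rw [← hw φ hφ i]
  exact setIntegral_congr_fun isOpen_interior.measurableSet fun x hx => by
    simp only [hwv x (interior_subset hx)]

end Tri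

/-! ### Products of weak gradients and traces of `H¹₀` functions -/

variable {Ω U : Set Pt}

theorem HasWeakGrad.mono {v : Pt → ℝ} {g : Pt → Pt} (h : HasWeakGrad Ω v g) (hΩ : MeasurableSet Ω)
    (hU : U ⊆ Ω) : HasWeakGrad U v g := by
  intro φ hφ i
  have h0 : ∀ x, x ∉ U → φ x = 0 := fun x hx =>
    image_eq_zero_of_notMem_tsupport fun hx' => hx (hφ.2.2 hx')
  have h1 : ∀ x, x ∉ U → gradient φ x i = 0 := fun x hx => by
    have : fderiv ℝ φ x = 0 := by
      by_contra hne
      exact hx (hφ.2.2 (support_fderiv_subset ℝ hne))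
    rw [gradient_coord, this]; rfl
  have := h φ ⟨hφ.1, hφ.2.1, hφ.2.2.trans hU⟩ i
  rw [setIntegral_eq_of_subset_of_forall_sdiff_eq_zero hΩ hU (fun x hx => by rw [h1 x hx.2, mul_zero]),
    setIntegral_eq_of_subset_of_forall_sdiff_eq_zero hΩ hU (fun x hx => by rw [h0 x hx.2, mul_zero])]
    at this
  exact this

theorem IsTestFunction.hasWeakGrad {φ : Pt → ℝ} (hφ : IsTestFunction Ω φ) :
    HasWeakGrad U φ (gradient φ) := by
  intro ψ hψ i
  obtain ⟨K, hK⟩ := hφ.1.lipschitzWith_of_hasCompactSupport hφ.2.1 (by simp)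
  exact hψ.gradient_mul_integral hK i

theorem IsTestFunction.mul {φ χ : Pt → ℝ} (hφ : IsTestFunction U φ) (hχ : ContDiff ℝ ∞ χ) :
    IsTestFunction U fun x => φ x * χ x :=
  ⟨hφ.1.mul hχ, hφ.2.1.mul_right, (closure_mono (Function.support_mul_subset_left _ _)).trans hφ.2.2⟩

theorem IsTestFunction.eq_zero_of_mem_frontier {φ : Pt → ℝ} (hφ : IsTestFunction Ω φ) (hΩ : IsOpen Ω)
    {x : Pt} (hx : x ∈ frontier Ω) : φ x = 0 :=
  image_eq_zero_of_notMem_tsupport fun h => by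
    rw [hΩ.frontier_eq] at hx
    exact hx.2 (hφ.2.2 h)

theorem continuous_gradient {χ : Pt → ℝ} (hχ : ContDiff ℝ ∞ χ) (i : Fin 2) :
    Continuous fun x => gradient χ x i := by
  have : Continuous (fderiv ℝ χ) := hχ.continuous_fderiv (by simp)
  simp only [gradient_coord]
  fun_prop

theorem gradient_mul {φ χ : Pt → ℝ} (hφ : ContDiff ℝ ∞ φ) (hχ : ContDiff ℝ ∞ χ) (x : Pt) (i : Fin 2) :
    gradient (fun x => φ x * χ x) x i = φ x * gradient χ x i + χ x * gradient φ x i := by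
  have h1 := (hφ.differentiable (by simp)) x
  have h2 := (hχ.differentiable (by simp)) x
  simp only [gradient_coord]
  rw [fderiv_fun_mul h1 h2]
  simp

theorem isFiniteMeasure_interior (E : Tri) : IsFiniteMeasure (volume.restrict (interior E.carrier)) :=
  ⟨by rw [Measure.restrict_apply_univ]
      exact (measure_mono interior_subset).trans_lt E.isCompact_carrier.measure_lt_top⟩

theorem integrableOn_mul {E : Tri} {f χ : Pt → ℝ} (hf : IntegrableOn f (interior E.carrier))
    (hχ : Continuous χ) : IntegrableOn (fun x => f x * χ x) (interior E.carrier) := by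
  obtain ⟨C, hC⟩ := E.isCompact_carrier.exists_bound_of_continuousOn hχ.continuousOn
  refine Integrable.mul_bdd (c := C) hf hχ.aestronglyMeasurable ?_
  filter_upwards [ae_restrict_mem isOpen_interior.measurableSet] with x hx
  exact hC x (interior_subset hx)

/-- Product rule for weak gradients. -/
theorem HasWeakGrad.mul {E : Tri} {v χ : Pt → ℝ} {g : Pt → Pt}
    (h : HasWeakGrad (interior E.carrier) v g) (hχ : ContDiff ℝ ∞ χ)
    (hv : IntegrableOn v (interior E.carrier)) (hg : IntegrableOn g (interior E.carrier)) :
    HasWeakGrad (interior E.carrier) (fun x => v x * χ x)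
      (fun x => v x • gradient χ x + χ x • g x) := by
  intro φ hφ i
  have hgi : IntegrableOn (fun x => g x i) (interior E.carrier) :=
    (EuclideanSpace.proj (𝕜 := ℝ) i).integrable_comp hg
  have h1 := h _ (hφ.mul hχ) i
  simp only [gradient_mul hφ.1 hχ] at h1
  have i1 := integrableOn_mul hv (hφ.1.continuous.mul (continuous_gradient hχ i))
  have i2 := integrableOn_mul hv (hχ.continuous.mul (continuous_gradient hφ.1 i))
  have i3 := integrableOn_mul hgi (hφ.1.continuous.mul hχ.continuous)
  simp only [mul_add] at h1
  have hsum : ∫ x in interior E.carrier, (v x * (φ x * gradient χ x i) + v x * (χ x * gradient φ x i)) =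
      (∫ x in interior E.carrier, v x * (φ x * gradient χ x i)) +
        ∫ x in interior E.carrier, v x * (χ x * gradient φ x i) := integral_add i1 i2
  rw [hsum] at h1
  have e1 : ∫ x in interior E.carrier, v x * χ x * gradient φ x i =
      ∫ x in interior E.carrier, v x * (χ x * gradient φ x i) := by simp only [mul_assoc]
  have e2 : ∫ x in interior E.carrier, (v x • gradient χ x + χ x • g x) i * φ x =
      (∫ x in interior E.carrier, v x * (φ x * gradient χ x i)) +
      ∫ x in interior E.carrier, g x i * (φ x * χ x) := by
    refine Eq.trans (integral_congr_ae (.of_forall fun x => ?_)) (integral_add i1 i3)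
    simp only [PiLp.add_apply, PiLp.smul_apply, smul_eq_mul]
    ring
  rw [e1, e2]
  linarith

theorem memLp_one_of_two {F : Type*} [NormedAddCommGroup F] {E : Tri} {f : Pt → F}
    (hU : interior E.carrier ⊆ Ω) (hf : MemLp f 2 (volume.restrict Ω)) :
    IntegrableOn f (interior E.carrier) := by
  have := isFiniteMeasure_interior E
  exact (hf.mono_measure (Measure.restrict_mono hU le_rfl)).integrable (by norm_num)

theorem IsTestFunction.memLp {φ : Pt → ℝ} (hφ : IsTestFunction Ω φ) : MemLp φ 2 (volume.restrict Ω) :=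
  (hφ.1.continuous.memLp_of_hasCompactSupport hφ.2.1).restrict _

theorem IsTestFunction.memLp_gradient_coord {φ : Pt → ℝ} (hφ : IsTestFunction Ω φ) (i : Fin 2) :
    MemLp (fun x => gradient φ x i) 2 (volume.restrict Ω) := by
  refine ((continuous_gradient hφ.1 i).memLp_of_hasCompactSupport ?_).restrict _
  refine (hφ.2.1.fderiv ℝ).mono' ?_
  intro x hx
  refine subset_closure fun h => hx ?_
  simp only [gradient_coord, h]
  rfl

theorem tendsto_integral_mul {E : Tri} {f : ℕ → Pt → ℝ} {g χ : Pt → ℝ} (hU : interior E.carrier ⊆ Ω)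
    (hf : ∀ n, MemLp (f n) 2 (volume.restrict Ω)) (hg : MemLp g 2 (volume.restrict Ω))
    (hχ : Continuous χ)
    (h : Tendsto (fun n => eLpNorm (fun x => f n x - g x) 2 (volume.restrict Ω)) atTop (𝓝 0)) :
    Tendsto (fun n => ∫ x in interior E.carrier, f n x * χ x) atTop
      (𝓝 (∫ x in interior E.carrier, g x * χ x)) := by
  have := isFiniteMeasure_interior E
  set μ := volume.restrict (interior E.carrier)
  obtain ⟨C, hC⟩ := E.isCompact_carrier.exists_bound_of_continuousOn hχ.continuousOn
  have hμ : μ ≤ volume.restrict Ω := Measure.restrict_mono hU le_rfl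
  have hd : ∀ n, MemLp (fun x => f n x - g x) 2 μ := fun n => ((hf n).sub hg).mono_measure hμ
  refine tendsto_integral_of_L1' _ (integrableOn_mul (memLp_one_of_two hU hg) hχ).1
    (.of_forall fun n => integrableOn_mul (memLp_one_of_two hU (hf n)) hχ) ?_
  have hb : ∀ n, eLpNorm ((fun x => f n x * χ x) - fun x => g x * χ x) 1 μ ≤
      ENNReal.ofReal C * (eLpNorm (fun x => f n x - g x) 2 (volume.restrict Ω) *
        μ Set.univ ^ (1 / (1 : ENNReal).toReal - 1 / (2 : ENNReal).toReal)) := fun n => by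
    refine (eLpNorm_le_mul_eLpNorm_of_ae_le_mul (g := fun x => f n x - g x) (c := C) ?_ 1).trans ?_
    · filter_upwards [ae_restrict_mem isOpen_interior.measurableSet] with x hx
      have := hC x (interior_subset hx)
      simp only [Pi.sub_apply, ← sub_mul, norm_mul]
      nlinarith [norm_nonneg (f n x - g x)]
    · gcongr
      refine (eLpNorm_le_eLpNorm_mul_rpow_measure_univ (q := 2) (by norm_num) (hd n).1).trans ?_
      gcongr
  refine tendsto_of_tendsto_of_tendsto_of_le_of_le tendsto_const_nhds ?_ (fun _ => zero_le) hb
  have hfin : μ Set.univ ^ (1 / (1 : ENNReal).toReal - 1 / (2 : ENNReal).toReal) ≠ ⊤ :=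
    ENNReal.rpow_ne_top_of_nonneg (by norm_num) (measure_ne_top _ _)
  have := ENNReal.Tendsto.const_mul (ENNReal.Tendsto.mul_const h (Or.inr hfin))
    (Or.inr (ENNReal.ofReal_ne_top (r := C)))
  simpa using this

namespace Tri

variable {E : Tri}

theorem gP_ne_zero (hE : E.D ≠ 0) : E.gP ≠ 0 := by
  intro h
  have h0 := congrArg (fun v : Pt => v 0) h
  have h1 := congrArg (fun v : Pt => v 1) h
  simp only [gP, PiLp.zero_apply, PiLp.toLp_apply, Matrix.cons_val_zero, Matrix.cons_val_one, div_eq_zero_iff, hE,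
    or_false, neg_eq_zero] at h0 h1
  apply hE
  have h0' : E.right 1 = E.left 1 := by linarith
  have h1' : E.right 0 = E.left 0 := by linarith
  simp only [D, det3, h0', h1']
  ring

/-- With a smooth weight `χ` vanishing on the other two sides, Green's formula sees only `[left,
right]`. For the approximating test functions this term is zero, since they vanish on ∂Ω; the volume
terms pass to the limit in L². So every weighted mean of `v` along the side vanishes, and continuity
gives `v = 0` there. -/
theorem trace_eq_zero (hE : E.D ≠ 0) (hΩ : IsOpen Ω) (hU : interior E.carrier ⊆ Ω) {v : Pt → ℝ}
    (hv : ContinuousOn v E.carrier) (h0 : MemH10 Ω v)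
    (hs : segment ℝ E.left E.right ⊆ frontier Ω) : ∀ x ∈ segment ℝ E.left E.right, v x = 0 := by
  obtain ⟨g, ⟨hv2, hg2, hvg⟩, φ, hφ, hφv, hφg⟩ := h0
  have hvI : IntegrableOn v (interior E.carrier) := memLp_one_of_two hU hv2
  have hgI : IntegrableOn g (interior E.carrier) := memLp_one_of_two hU hg2
  have hwg := hvg.mono hΩ.measurableSet hU
  have hgi : ∀ i, MemLp (fun x => g x i) 2 (volume.restrict Ω) := fun i =>
    (EuclideanSpace.proj (𝕜 := ℝ) i).comp_memLp' hg2
  have hφgi : ∀ i, Tendsto (fun n => eLpNorm (fun x => gradient (φ n) x i - g x i) 2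
      (volume.restrict Ω)) atTop (𝓝 0) := fun i => by
    refine tendsto_of_tendsto_of_tendsto_of_le_of_le tendsto_const_nhds hφg (fun _ => zero_le)
      fun n => eLpNorm_mono fun x => ?_
    exact PiLp.norm_apply_le (gradient (φ n) x - g x) i
  have key : ∀ χ : Pt → ℝ, ContDiff ℝ ∞ χ → (∀ x, E.cL x = 0 → χ x = 0) → (∀ x, E.cR x = 0 → χ x = 0) →
      segMean (fun x => v x * χ x) E.left E.right = 0 := by
    intro χ hχ hL hR
    have hbd : ∀ f : Pt → ℝ, segMean (fun x => f x * χ x) E.right E.peak = 0 ∧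
        segMean (fun x => f x * χ x) E.peak E.left = 0 := fun f => by
      constructor
      · rw [segMean_congr (w := fun _ => 0)]
        · simp [segMean]
        · intro x hx
          rw [segment_symm] at hx
          simp [hL x ((mem_segment_peak_right hE).1 hx).2]
      · rw [segMean_congr (w := fun _ => 0)]
        · simp [segMean]
        · intro x hx
          simp [hR x ((mem_segment_peak_left hE).1 hx).2]
    have hlim : ∀ i, (∫ x in interior E.carrier, (v x * gradient χ x i + g x i * χ x)) = 0 := by
      intro i
      have h1 : ∀ n, (∫ x in interior E.carrier, φ n x * gradient χ x i) +
          (∫ x in interior E.carrier, gradient (φ n) x i * χ x) = 0 := fun n => by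
        rw [← integral_add (integrableOn_mul (memLp_one_of_two hU (hφ n).memLp) (continuous_gradient hχ i))
          (integrableOn_mul (memLp_one_of_two hU ((hφ n).memLp_gradient_coord i)) hχ.continuous)]
        have hψ := (hφ n).mul hχ
        have hint : IntegrableOn (gradient fun x => φ n x * χ x) (interior E.carrier) := by
          have : Continuous (gradient fun x => φ n x * χ x) := by
            have := hψ.1.continuous_fderiv (by simp)
            exact (InnerProductSpace.toDual ℝ Pt).symm.continuous.comp this
          exact (this.continuousOn.integrableOn_compact E.isCompact_carrier).mono_set interior_subset
        have hgr := green hE hψ.1.continuous.continuousOn hint hψ.hasWeakGrad i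
        rw [(hbd (φ n)).1, (hbd (φ n)).2, segMean_congr (w := fun _ => 0)] at hgr
        · simp only [segMean, integral_zero, mul_zero, add_zero, gradient_mul (hφ n).1 hχ] at hgr
          rw [← hgr]
          simp only [mul_comm (χ _)]
        · intro x hx
          simp [(hφ n).eq_zero_of_mem_frontier hΩ (hs hx)]
      rw [integral_add (integrableOn_mul hvI (continuous_gradient hχ i))
        (integrableOn_mul (memLp_one_of_two hU (hgi i)) hχ.continuous)]
      refine tendsto_nhds_unique ((tendsto_integral_mul hU (fun n => (hφ n).memLp) hv2 (continuous_gradient hχ i) hφv).add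
        (tendsto_integral_mul hU (fun n => (hφ n).memLp_gradient_coord i) (hgi i) hχ.continuous (hφgi i))) ?_
      simp only [h1]
      exact tendsto_const_nhds
    have hint : IntegrableOn (fun x => v x • gradient χ x + χ x • g x) (interior E.carrier) := by
      have hc : Continuous (gradient χ) :=
        (InnerProductSpace.toDual ℝ Pt).symm.continuous.comp (hχ.continuous_fderiv (by simp))
      obtain ⟨C, hC⟩ := E.isCompact_carrier.exists_bound_of_continuousOn hχ.continuous.continuousOn
      obtain ⟨C', hC'⟩ := E.isCompact_carrier.exists_bound_of_continuousOn hc.continuousOn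
      refine Integrable.add (Integrable.smul_bdd hvI C' hc.aestronglyMeasurable ?_)
        (Integrable.bdd_smul hgI C hχ.continuous.aestronglyMeasurable ?_)
      · filter_upwards [ae_restrict_mem isOpen_interior.measurableSet] with x hx
        exact hC' x (interior_subset hx)
      · filter_upwards [ae_restrict_mem isOpen_interior.measurableSet] with x hx
        exact hC x (interior_subset hx)
    have hgr : ∀ i, E.gP i * segMean (fun x => v x * χ x) E.left E.right = 0 := by
      intro i
      have := green hE (v := fun x => v x * χ x) (hv.mul hχ.continuous.continuousOn) hint
        (hwg.mul hχ hvI hgI) i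
      rw [(hbd v).1, (hbd v).2] at this
      have e : ∫ x in interior E.carrier, (v x • gradient χ x + χ x • g x) i = 0 := by
        rw [← hlim i]
        refine integral_congr_ae (.of_forall fun x => ?_)
        simp only [PiLp.add_apply, PiLp.smul_apply, smul_eq_mul]
        ring
      rw [e] at this
      have hD := abs_pos.2 hE
      have : |E.D| * (E.gP i * segMean (fun x => v x * χ x) E.left E.right) = 0 := by linarith
      exact (mul_eq_zero.1 this).resolve_left hD.ne'
    by_contra hne
    refine gP_ne_zero hE (PiLp.ext fun i => ?_)
    exact (mul_eq_zero.1 (hgr i)).resolve_right hne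
  have hmaps : ∀ t ∈ Set.Icc (0 : ℝ) 1, (AffineMap.lineMap E.left E.right t : Pt) ∈ E.carrier := fun t ht =>
    ((mem_segment_left_right hE).1 (mem_segment_iff_lineMap.2 ⟨t, ht, rfl⟩)).1
  set f : ℝ → ℝ := fun t => v (AffineMap.lineMap E.left E.right t) with hf
  have hfc : ContinuousOn f (Set.Icc 0 1) :=
    hv.comp (AffineMap.lineMap_continuous.continuousOn) hmaps
  have hF : ContinuousOn (fun t => f t * (1 - t)) (Set.Icc 0 1) := hfc.mul (by fun_prop)
  have hae : ∀ᵐ t, t ∈ Set.Ioo (0 : ℝ) 1 → f t * (1 - t) = 0 := by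
    refine isOpen_Ioo.ae_eq_zero_of_integral_contDiff_smul_eq_zero
      ((hF.integrableOn_compact isCompact_Icc).mono_set Set.Ioo_subset_Icc_self).locallyIntegrableOn ?_
    intro ψ hψ hc hsup
    have h0 : ψ 0 = 0 := image_eq_zero_of_notMem_tsupport fun h => lt_irrefl _ (hsup h).1
    -- On `[left, right]` this weight is `ψ(t)(1 - t)`. It vanishes with `cL` by its second factor,
    -- and with `cR` because the support of `ψ` lies in the open interval. The factor `1 - t` has no
    -- zero there and is removed at the end.
    have := key (fun x => ψ (E.cR x) * E.cL x) ((hψ.comp E.cR_contDiff).mul E.cL_contDiff)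
      (fun x h => by simp [h]) (fun x h => by simp [h, h0])
    rw [← this, segMean]
    rw [← setIntegral_eq_integral_of_forall_compl_eq_zero (s := Set.Icc (0 : ℝ) 1)]
    · refine setIntegral_congr_fun measurableSet_Icc fun t ht => ?_
      simp only [cR_lineMap, cL_lineMap, smul_eq_mul, hf]
      have a1 : E.cR E.left = 0 := (coord_left hE).2.2
      have a2 : E.cR E.right = 1 := (coord_right hE).2.2
      have a3 : E.cL E.left = 1 := (coord_left hE).2.1
      have a4 : E.cL E.right = 0 := (coord_right hE).2.1
      simp only [a1, a2, a3, a4]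
      ring_nf
    · intro t ht
      have : ψ t = 0 := image_eq_zero_of_notMem_tsupport fun h => ht (Set.Ioo_subset_Icc_self (hsup h))
      simp [this]
  have hae' : (fun t => f t * (1 - t)) =ᵐ[volume.restrict (Set.Ioo (0 : ℝ) 1)] fun _ => 0 := by
    rw [Filter.EventuallyEq, ae_restrict_iff' measurableSet_Ioo]
    exact hae
  have hIoo := Measure.eqOn_open_of_ae_eq hae' isOpen_Ioo (hF.mono Set.Ioo_subset_Icc_self)
    continuousOn_const
  have hf0 : Set.EqOn f (fun _ => 0) (Set.Ioo 0 1) := fun t ht =>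
    (mul_eq_zero.1 (hIoo ht)).resolve_right (by linarith [ht.2])
  have hf1 : Set.EqOn f (fun _ => 0) (Set.Icc 0 1) :=
    hf0.of_subset_closure hfc continuousOn_const Set.Ioo_subset_Icc_self
      (by rw [closure_Ioo (by norm_num)])
  intro x hx
  obtain ⟨t, ht, rfl⟩ := mem_segment_iff_lineMap.1 hx
  exact hf1 ht

end Tri

namespace Tri

variable {E : Tri} {Ω : Set Pt}

theorem trace_eq_zero_of_side (hE : E.D ≠ 0) (hΩ : IsOpen Ω) (hU : interior E.carrier ⊆ Ω) {v : Pt → ℝ}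
    (hv : ContinuousOn v E.carrier) (h0 : MemH10 Ω v) {a b : Pt} (ha : a ∈ E.verts) (hb : b ∈ E.verts)
    (hab : a ≠ b) (hs : segment ℝ a b ⊆ frontier Ω) : ∀ x ∈ segment ℝ a b, v x = 0 := by
  have h1 := trace_eq_zero hE hΩ hU hv h0
  have hE' : E.rot.D ≠ 0 := by rwa [rot_D]
  have h2 := trace_eq_zero (E := E.rot) hE' hΩ (by rwa [rot_carrier]) (by rwa [rot_carrier]) h0
  have hE'' : E.rot.rot.D ≠ 0 := by rwa [rot_D]
  have h3 := trace_eq_zero (E := E.rot.rot) hE'' hΩ (by rwa [rot_carrier, rot_carrier])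
    (by rwa [rot_carrier, rot_carrier]) h0
  simp only [rot] at h2 h3
  rw [mem_verts] at ha hb
  rcases ha with rfl | rfl | rfl <;> rcases hb with rfl | rfl | rfl
  all_goals first
    | exact absurd rfl hab
    | exact h1 hs
    | exact h2 hs
    | exact h3 hs
    | (rw [segment_symm] at hs ⊢; first | exact h1 hs | exact h2 hs | exact h3 hs)

end Tri

/-! ### Boundary values and differences of discrete functions -/

theorem RestrictsInto.continuousOn {E : Tri} {W : Submodule ℝ C(E.carrier, ℝ)} {v : Pt → ℝ}
    (h : RestrictsInto E W v) : ContinuousOn v E.carrier := by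
  obtain ⟨w, -, hw⟩ := h
  rw [continuousOn_iff_continuous_domRestrict]
  convert w.continuous using 1
  funext x
  exact (hw x).symm

theorem RestrictsInto.sub {E : Tri} {W : Submodule ℝ C(E.carrier, ℝ)} {v w : Pt → ℝ}
    (hv : RestrictsInto E W v) (hw : RestrictsInto E W w) : RestrictsInto E W fun x => v x - w x := by
  obtain ⟨a, ha, ha'⟩ := hv
  obtain ⟨b, hb, hb'⟩ := hw
  exact ⟨a - b, W.sub_mem ha hb, fun x => by simp [ha', hb']⟩

variable {Ω : Set Pt} {T₀ T H : Finset Tri}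

theorem IsRefinement.continuousOn_closure (hr : IsRefinement T₀ T H)
    (h₀ : IsConformingTriangulation Ω T₀) {v : Pt → ℝ} (hv : ∀ E ∈ T, ContinuousOn v E.carrier) :
    ContinuousOn v (closure Ω) := by
  have : ContinuousOn v (⋃ E : {E // E ∈ T}, E.1.carrier) :=
    (locallyFinite_of_finite _).continuousOn_iUnion (fun E => E.1.isCompact_carrier.isClosed)
      fun E => hv E.1 E.2
  refine this.mono fun x hx => ?_
  obtain ⟨E, hE, hx⟩ := hr.exists_mem_carrier h₀ hx
  exact Set.mem_iUnion.2 ⟨⟨E, hE⟩, hx⟩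

/-- Discrete functions are continuous on the closed domain, so the trace result applies directly in
the initial triangle that owns the boundary side, without descending to the elements. -/
theorem MemVT.eq_zero_of_mem_frontier (hr : IsRefinement T₀ T H)
    (h₀ : IsConformingTriangulation Ω T₀) {V : (E : Tri) → Submodule ℝ C(E.carrier, ℝ)} {v : Pt → ℝ}
    (h : MemVT Ω T V v) {x : Pt} (hx : x ∈ frontier Ω) : v x = 0 := by
  obtain ⟨R, hR, a, ha, b, hb, hab, hs, hx⟩ := h₀.exists_side hx
  have hc := hr.continuousOn_closure h₀ fun E hE => (h.2 E hE).continuousOn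
  refine Tri.trace_eq_zero_of_side (h₀.D_ne hR) h₀.isOpen (h₀.interior_subset hR) (hc.mono ?_) h.1 ha hb
    hab hs x hx
  rw [h₀.closure_eq]
  exact Set.subset_biUnion_of_mem (u := fun E : Tri => E.carrier) hR

theorem IsTestFunction.sub {φ ψ : Pt → ℝ} (hφ : IsTestFunction Ω φ) (hψ : IsTestFunction Ω ψ) :
    IsTestFunction Ω fun x => φ x - ψ x := by
  refine ⟨hφ.1.sub hψ.1, hφ.2.1.sub hψ.2.1, ?_⟩
  refine (tsupport_sub φ ψ).trans (Set.union_subset hφ.2.2 hψ.2.2)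

theorem IsH1With.sub {v w : Pt → ℝ} {g k : Pt → Pt} (hv : IsH1With Ω v g) (hw : IsH1With Ω w k) :
    IsH1With Ω (fun x => v x - w x) fun x => g x - k x := by
  refine ⟨hv.1.sub hw.1, hv.2.1.sub hw.2.1, fun φ hφ i => ?_⟩
  have hg : MemLp (fun x => g x i) 2 (volume.restrict Ω) :=
    (EuclideanSpace.proj (𝕜 := ℝ) i).comp_memLp' hv.2.1
  have hk : MemLp (fun x => k x i) 2 (volume.restrict Ω) :=
    (EuclideanSpace.proj (𝕜 := ℝ) i).comp_memLp' hw.2.1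
  simp only [PiLp.sub_apply, sub_mul]
  have e1 : ∫ x in Ω, (v x * gradient φ x i - w x * gradient φ x i) =
      (∫ x in Ω, v x * gradient φ x i) - ∫ x in Ω, w x * gradient φ x i :=
    integral_sub (hv.1.integrable_mul (hφ.memLp_gradient_coord i))
      (hw.1.integrable_mul (hφ.memLp_gradient_coord i))
  have e2 : ∫ x in Ω, (g x i * φ x - k x i * φ x) =
      (∫ x in Ω, g x i * φ x) - ∫ x in Ω, k x i * φ x :=
    integral_sub (hg.integrable_mul hφ.memLp) (hk.integrable_mul hφ.memLp)
  rw [e1, e2, hv.2.2 φ hφ i, hw.2.2 φ hφ i]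
  ring

theorem tendsto_eLpNorm_sub {F : Type*} [NormedAddCommGroup F] {μ : Measure Pt} {f f' : ℕ → Pt → F}
    {g g' : Pt → F} (hf : ∀ n, AEStronglyMeasurable (fun x => f n x - g x) μ)
    (hf' : ∀ n, AEStronglyMeasurable (fun x => f' n x - g' x) μ)
    (h : Tendsto (fun n => eLpNorm (fun x => f n x - g x) 2 μ) atTop (𝓝 0))
    (h' : Tendsto (fun n => eLpNorm (fun x => f' n x - g' x) 2 μ) atTop (𝓝 0)) :
    Tendsto (fun n => eLpNorm (fun x => f n x - f' n x - (g x - g' x)) 2 μ) atTop (𝓝 0) := by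
  have := h.add h'
  rw [add_zero] at this
  refine tendsto_of_tendsto_of_tendsto_of_le_of_le tendsto_const_nhds this (fun _ => zero_le)
    fun n => ?_
  refine le_trans (le_of_eq ?_) (eLpNorm_sub_le (hf n) (hf' n) (by norm_num))
  congr 1
  funext x
  simp only [Pi.sub_apply]
  abel

theorem MemH10.sub {v w : Pt → ℝ} (hv : MemH10 Ω v) (hw : MemH10 Ω w) :
    MemH10 Ω fun x => v x - w x := by
  obtain ⟨g, hg, φ, hφ, hφv, hφg⟩ := hv
  obtain ⟨k, hk, ψ, hψ, hψw, hψk⟩ := hw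
  refine ⟨_, hg.sub hk, fun n x => φ n x - ψ n x, fun n => (hφ n).sub (hψ n), ?_, ?_⟩
  · exact tendsto_eLpNorm_sub (fun n => ((hφ n).memLp.sub hg.1).1)
      (fun n => ((hψ n).memLp.sub hk.1).1) hφv hψw
  · have := tendsto_eLpNorm_sub (fun n => (measurable_gradient (φ n)).aestronglyMeasurable.sub hg.2.1.1)
      (fun n => (measurable_gradient (ψ n)).aestronglyMeasurable.sub hk.2.1.1) hφg hψk
    refine this.congr fun n => ?_
    congr 1
    funext x
    have h1 := (hφ n).1.differentiable (by simp) x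
    have h2 := (hψ n).1.differentiable (by simp) x
    congr 1
    ext i
    simp only [gradient_coord, PiLp.sub_apply]
    rw [fderiv_fun_sub h1 h2]
    rfl

/-- The discrete function `u - w`, where `w` is the conforming piecewise affine function that
agrees with `u` at the proper nodes. -/
theorem MemVT.exists_sub_conforming (hr : IsRefinement T₀ T H) (h₀ : IsConformingTriangulation Ω T₀)
    {Λ : ℕ} (hA : IsAdmissible Λ T H) {V : (E : Tri) → Submodule ℝ C(E.carrier, ℝ)}
    (hV : ∀ E ∈ T, IsLocalVEMSpace T E (V E)) {u : Pt → ℝ} (hu : MemVT Ω T V u) :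
    ∃ (z : Pt → ℝ) (p : Tri → P1), MemVT Ω T V z ∧ (∀ x, IsProperNode T x → z x = 0) ∧
      ∀ E ∈ T, ∀ x ∈ E.carrier, z x = u x - p E x := by
  obtain ⟨w, p, hw, hwp, hw0⟩ :=
    exists_conforming_interpolant hr h₀ hA fun x hx => hu.eq_zero_of_mem_frontier hr h₀ hx
  obtain ⟨K, hK⟩ := lipschitz_of_piecewise_affine hr h₀ hw hw0
  have hwH := memH10_of_lipschitz h₀.isOpen h₀.isCompact_closure hK hw0 (ae_fderiv_eq_zero hr h₀ hw hw0)
  refine ⟨fun x => u x - w x, p, ⟨hu.1.sub hwH, fun E hE => (hu.2 E hE).sub ?_⟩, fun x hx => ?_,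
    fun E hE x hx => ?_⟩
  · obtain ⟨q, hq, hq'⟩ := (hV E hE).affine_mem (p E)
    exact ⟨q, hq, fun x => by rw [hq', hw E hE x x.2]⟩
  · simp [hwp x hx]
  · simp only [hw E hE x hx]

/-! ### Arc length -/

theorem lineMap_injective {a b : Pt} (h : a ≠ b) :
    Function.Injective (AffineMap.lineMap a b : ℝ → Pt) := AffineMap.lineMap_injective ℝ h

theorem segment_lineMap (a b : Pt) {r s : ℝ} (h : r ≤ s) :
    segment ℝ (AffineMap.lineMap a b r : Pt) (AffineMap.lineMap a b s) =
      (AffineMap.lineMap a b : ℝ → Pt) '' Set.Icc r s := by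
  rw [← segment_eq_Icc h, image_segment]

theorem openSegment_lineMap (a b : Pt) {r s : ℝ} (h : r < s) :
    openSegment ℝ (AffineMap.lineMap a b r : Pt) (AffineMap.lineMap a b s) =
      (AffineMap.lineMap a b : ℝ → Pt) '' Set.Ioo r s := by
  rw [← openSegment_eq_Ioo h, image_openSegment]

theorem isClosedEmbedding_lineMap {a b : Pt} (h : a ≠ b) :
    IsClosedEmbedding (AffineMap.lineMap a b : ℝ → Pt) := by
  refine (AntilipschitzWith.of_le_mul_dist (K := (nndist a b)⁻¹) fun s t => ?_).isClosedEmbedding ?_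
  · rw [dist_lineMap_lineMap, NNReal.coe_inv, coe_nndist]
    have := dist_pos.2 h
    field_simp
    exact le_rfl
  · exact (lipschitzWith_lineMap a b).uniformContinuous

theorem integral_segment {a b : Pt} (h : a ≠ b) (f : Pt → ℝ) :
    ∫ x in segment ℝ a b, f x ∂(Measure.hausdorffMeasure 1) = dist a b * Tri.segMean f a b := by
  set ℓ : ℝ → Pt := ⇑(AffineMap.lineMap a b : ℝ →ᵃ[ℝ] Pt) with hℓ
  have he : MeasurableEmbedding ℓ := (isClosedEmbedding_lineMap h).measurableEmbedding
  have hc : Measure.comap ℓ (Measure.hausdorffMeasure 1) = nndist a b • (volume : Measure ℝ) := by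
    ext s hs
    rw [he.comap_apply, hℓ, hausdorffMeasure_lineMap_image (E := Pt) a b s, hausdorffMeasure_real]
    rfl
  have hseg : segment ℝ a b = ℓ '' Set.Icc 0 1 := by
    have := segment_lineMap a b (zero_le_one (α := ℝ))
    simpa using this
  have h1 : (Measure.hausdorffMeasure 1 : Measure Pt).restrict (segment ℝ a b) =
      (Measure.map ℓ (nndist a b • (volume : Measure ℝ))).restrict (segment ℝ a b) := by
    rw [← hc, he.map_comap, Measure.restrict_restrict_of_subset]
    rw [hseg]
    exact Set.image_subset_range _ _
  rw [h1, he.setIntegral_map, hseg, Set.preimage_image_eq _ he.injective, Measure.restrict_smul,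
    integral_smul_nnreal_measure, Tri.segMean, NNReal.smul_def, coe_nndist, smul_eq_mul]

theorem integrableOn_segment {a b : Pt} {s : Set Pt} {f : Pt → ℝ} (hf : ContinuousOn f s)
    (h : segment ℝ a b ⊆ s) : IntegrableOn f (segment ℝ a b) (Measure.hausdorffMeasure 1) := by
  have hc : IsCompact (segment ℝ a b) := by
    rw [segment_eq_image_lineMap]
    exact isCompact_Icc.image AffineMap.lineMap_continuous
  have hfin : Measure.hausdorffMeasure 1 (segment ℝ a b) < ⊤ := by
    rw [hausdorffMeasure_segment]; exact edist_lt_top _ _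
  obtain ⟨C, hC⟩ := hc.exists_bound_of_continuousOn (hf.mono h)
  exact IntegrableOn.of_bound hfin ((hf.mono h).aestronglyMeasurable hc.measurableSet) C
    ((ae_restrict_iff' hc.measurableSet).2 (.of_forall hC))

theorem isClosed_segment (a b : Pt) : IsClosed (segment ℝ a b) := by
  rw [segment_eq_image_lineMap]
  exact (isCompact_Icc.image AffineMap.lineMap_continuous).isClosed

/-! ### Edges -/

variable {T : Finset Tri} {E : Tri}

theorem mem_edges {e : Set Pt} : e ∈ edges T E ↔ ∃ p ∈ nodesOn T E, ∃ q ∈ nodesOn T E, p ≠ q ∧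
    segment ℝ p q ⊆ frontier E.carrier ∧ (∀ z ∈ nodes T, z ∉ openSegment ℝ p q) ∧
    segment ℝ p q = e := by
  simp only [edges, Finset.mem_image, Finset.mem_filter, Finset.mem_product, Prod.exists]
  constructor
  · rintro ⟨p, q, ⟨⟨hp, hq⟩, h⟩, rfl⟩
    exact ⟨p, hp, q, hq, h.1, h.2.1, h.2.2, rfl⟩
  · rintro ⟨p, hp, q, hq, h1, h2, h3, rfl⟩
    exact ⟨p, q, ⟨⟨hp, hq⟩, h1, h2, h3⟩, rfl⟩

/-- Since there are finitely many nodes, the nearest ones on either side of `x` along `[a, b]` are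
the ends of an edge. -/
theorem exists_edge {a b x : Pt} (hab : a ≠ b) (ha : a ∈ nodes T) (hb : b ∈ nodes T)
    (hs : segment ℝ a b ⊆ frontier E.carrier) (hx : x ∈ segment ℝ a b) (hxn : x ∉ nodes T) :
    ∃ e ∈ edges T E, x ∈ e ∧ e ⊆ segment ℝ a b := by
  obtain ⟨t, ht, rfl⟩ := mem_segment_iff_lineMap.1 hx
  set K := ((nodes T).preimage (AffineMap.lineMap a b : ℝ → Pt)
    (lineMap_injective hab).injOn).filter (fun s => s ∈ Set.Icc (0 : ℝ) 1)
  have hK : ∀ s, s ∈ K ↔ (AffineMap.lineMap a b s : Pt) ∈ nodes T ∧ s ∈ Set.Icc (0 : ℝ) 1 := fun s => by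
    simp [K]
  obtain ⟨r, hr, hr'⟩ := (K.filter (· ≤ t)).exists_max_image id
    ⟨0, by simp [hK, ha, ht.1]⟩
  obtain ⟨s, hs1, hs2⟩ := (K.filter (t ≤ ·)).exists_min_image id
    ⟨1, by simp [hK, hb, ht.2]⟩
  simp only [Finset.mem_filter, hK, id] at hr hr' hs1 hs2
  have hrt : r < t := lt_of_le_of_ne hr.2 fun h => hxn (h ▸ hr.1.1)
  have hts : t < s := lt_of_le_of_ne hs1.2 fun h => hxn (h ▸ hs1.1.1)
  have hsub : segment ℝ (AffineMap.lineMap a b r : Pt) (AffineMap.lineMap a b s) ⊆ segment ℝ a b := by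
    rw [segment_lineMap _ _ (hrt.trans hts).le]
    rintro _ ⟨y, hy, rfl⟩
    exact mem_segment_iff_lineMap.2 ⟨y, ⟨hr.1.2.1.trans hy.1, hy.2.trans hs1.1.2.2⟩, rfl⟩
  refine ⟨_, mem_edges.2 ⟨AffineMap.lineMap a b r, ?_, AffineMap.lineMap a b s, ?_, ?_, hsub.trans hs,
    ?_, rfl⟩, ?_, hsub⟩
  · exact mem_nodesOn.2 ⟨hr.1.1, hs (hsub (left_mem_segment _ _ _))⟩
  · exact mem_nodesOn.2 ⟨hs1.1.1, hs (hsub (right_mem_segment _ _ _))⟩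
  · exact fun h => (hrt.trans hts).ne (lineMap_injective hab h)
  · rw [openSegment_lineMap _ _ (hrt.trans hts)]
    rintro _ hz ⟨y, hy, rfl⟩
    have hy' : y ∈ Set.Icc (0 : ℝ) 1 := ⟨hr.1.2.1.trans hy.1.le, hy.2.le.trans hs1.1.2.2⟩
    rcases le_total y t with h | h
    · exact absurd (hr' y ⟨⟨hz, hy'⟩, h⟩) (not_le.2 hy.1)
    · exact absurd (hs2 y ⟨⟨hz, hy'⟩, h⟩) (not_le.2 hy.2)
  · rw [segment_lineMap _ _ (hrt.trans hts).le]
    exact ⟨t, ⟨hrt.le, hts.le⟩, rfl⟩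

theorem edge_param {a b : Pt} {e : Set Pt} (he : e ∈ edges T E)
    (hs : e ⊆ segment ℝ a b) : ∃ r s : ℝ, r < s ∧ (AffineMap.lineMap a b r : Pt) ∈ nodes T ∧
      (AffineMap.lineMap a b s : Pt) ∈ nodes T ∧ e = (AffineMap.lineMap a b : ℝ → Pt) '' Set.Icc r s ∧
      ∀ t ∈ Set.Ioo r s, (AffineMap.lineMap a b t : Pt) ∉ nodes T := by
  obtain ⟨p, hp, q, hq, hpq, -, hn, rfl⟩ := mem_edges.1 he
  obtain ⟨r, -, rfl⟩ := mem_segment_iff_lineMap.1 (hs (left_mem_segment ℝ p q))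
  obtain ⟨s, -, rfl⟩ := mem_segment_iff_lineMap.1 (hs (right_mem_segment ℝ _ q))
  rw [mem_nodesOn] at hp hq
  rcases lt_or_gt_of_ne (fun h : r = s => hpq (by rw [h])) with h | h
  · rw [openSegment_lineMap _ _ h] at hn
    exact ⟨r, s, h, hp.1, hq.1, segment_lineMap a b h.le, fun t ht h' => hn _ h' ⟨t, ht, rfl⟩⟩
  · rw [openSegment_symm, openSegment_lineMap _ _ h] at hn
    exact ⟨s, r, h, hq.1, hp.1, by rw [segment_symm, segment_lineMap a b h.le],
      fun t ht h' => hn _ h' ⟨t, ht, rfl⟩⟩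

theorem edge_unique {a b x : Pt} {e e' : Set Pt} (hab : a ≠ b) (he : e ∈ edges T E)
    (he' : e' ∈ edges T E) (hsub : e ⊆ segment ℝ a b) (hsub' : e' ⊆ segment ℝ a b) (hx : x ∈ e)
    (hx' : x ∈ e') (hn : x ∉ nodes T) : e = e' := by
  obtain ⟨r, s, -, hr, hs, rfl, h⟩ := edge_param he hsub
  obtain ⟨r', s', -, hr', hs', rfl, h'⟩ := edge_param he' hsub'
  obtain ⟨t, ht, rfl⟩ := hx
  obtain ⟨t', ht', htt⟩ := hx'
  obtain rfl := lineMap_injective hab htt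
  have h1 : r < t' := lt_of_le_of_ne ht.1 fun h => hn (h ▸ hr)
  have h2 : t' < s := lt_of_le_of_ne ht.2 fun h => hn (h ▸ hs)
  have h3 : r' < t' := lt_of_le_of_ne ht'.1 fun h => hn (h ▸ hr')
  have h4 : t' < s' := lt_of_le_of_ne ht'.2 fun h => hn (h ▸ hs')
  have e1 : r = r' := by
    rcases lt_trichotomy r r' with hlt | heq | hlt
    · exact absurd hr' (h _ ⟨hlt, h3.trans h2⟩)
    · exact heq
    · exact absurd hr (h' _ ⟨hlt, h1.trans h4⟩)
  have e2 : s = s' := by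
    rcases lt_trichotomy s s' with hlt | heq | hlt
    · exact absurd hs (h' _ ⟨h3.trans h2, hlt⟩)
    · exact heq
    · exact absurd hs' (h _ ⟨h1.trans h4, hlt⟩)
  rw [e1, e2]

/-- Finite sets are null for arc length, and away from the nodes the edges contained in a side
partition it. -/
theorem integral_side {a b : Pt} (hab : a ≠ b) (ha : a ∈ nodes T) (hb : b ∈ nodes T)
    (hs : segment ℝ a b ⊆ frontier E.carrier) {f : Pt → ℝ} (hf : ContinuousOn f E.carrier) :
    ∫ x in segment ℝ a b, f x ∂(Measure.hausdorffMeasure 1) =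
      ∑ e ∈ (edges T E).filter (· ⊆ segment ℝ a b), ∫ x in e, f x ∂(Measure.hausdorffMeasure 1) := by
  have hna : NullSingletonClass (Measure.hausdorffMeasure 1 : Measure Pt) :=
    Measure.nullSingletonClass_hausdorff Pt zero_lt_one
  have hN : (Measure.hausdorffMeasure 1 : Measure Pt) (nodes T : Set Pt) = 0 :=
    (nodes T).finite_toSet.measure_zero _
  have hae : ∀ s : Set Pt, (s \ (nodes T : Set Pt) : Set Pt) =ᵐ[Measure.hausdorffMeasure 1] s := fun s =>
    sdiff_null_ae_eq_self hN
  have hclosed : ∀ e ∈ edges T E, MeasurableSet e ∧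
      IntegrableOn f e (Measure.hausdorffMeasure 1) := by
    intro e he
    obtain ⟨p, -, q, -, -, hsub, -, rfl⟩ := mem_edges.1 he
    exact ⟨(isClosed_segment p q).measurableSet, integrableOn_segment hf (hsub.trans Tri.frontier_subset)⟩
  rw [← setIntegral_congr_set (hae _), Finset.sum_congr rfl fun e _ => (setIntegral_congr_set (hae e)).symm]
  rw [← integral_biUnion_finset]
  · congr 2
    ext x
    simp only [Set.mem_sdiff, Set.mem_iUnion, Finset.mem_filter, SetLike.mem_coe]
    constructor
    · rintro ⟨hx, hn⟩
      obtain ⟨e, he, hxe, hsub⟩ := exists_edge hab ha hb hs hx hn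
      exact ⟨e, ⟨he, hsub⟩, hxe, hn⟩
    · rintro ⟨e, ⟨-, hsub⟩, hx, hn⟩
      exact ⟨hsub hx, hn⟩
  · intro e he
    exact (hclosed e (Finset.mem_filter.1 he).1).1.diff (nodes T).finite_toSet.measurableSet
  · intro e he e' he' hne
    simp only [Finset.coe_filter, Set.mem_ofPred_eq] at he he'
    refine Set.disjoint_left.2 fun x hx hx' => hne ?_
    exact edge_unique hab he.1 he'.1 he.2 he'.2 hx.1 hx'.1 hx.2
  · intro e he
    exact (hclosed e (Finset.mem_filter.1 he).1).2.mono_set Set.sdiff_subset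

/-! ### Outward normals and Green's formula along the edges -/

namespace Tri

variable {E : Tri}

theorem cP_sub (x y : Pt) : E.cP x - E.cP y = inner ℝ E.gP (x - y) := by
  rw [inner_pt]
  simp only [cP, det3, gP, PiLp.sub_apply, PiLp.toLp_apply, Matrix.cons_val_zero, Matrix.cons_val_one]
  ring

theorem norm_gP (hE : E.D ≠ 0) : |E.D| * ‖E.gP‖ = dist E.left E.right := by
  have hD := abs_pos.2 hE
  rw [← sq_eq_sq₀ (by positivity) dist_nonneg, mul_pow, sq_abs, norm_sq_eq, dist_eq_norm, norm_sq_eq]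
  simp only [gP, PiLp.sub_apply, PiLp.toLp_apply, Matrix.cons_val_zero, Matrix.cons_val_one]
  field_simp
  ring

theorem isOutwardNormal_gP (hE : E.D ≠ 0) {e : Set Pt} (he : e ⊆ segment ℝ E.left E.right) :
    IsOutwardNormal E e (-(‖E.gP‖⁻¹ • E.gP)) := by
  have hg := gP_ne_zero hE
  refine ⟨by rw [norm_neg, norm_smul, norm_inv, norm_norm, inv_mul_cancel₀ (norm_ne_zero_iff.2 hg)],
    fun x hx y hy => ?_⟩
  rw [inner_neg_left, real_inner_smul_left, ← cP_sub, ((mem_segment_left_right hE).1 (he hx)).2,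
    sub_zero, neg_nonpos]
  exact mul_nonneg (inv_nonneg.2 (norm_nonneg _)) ((mem_carrier_iff hE).1 hy).1

/-- The conditions determine the normal. Used at both ends of the edge they make it orthogonal to
the edge, hence parallel to `gP`; used at the newest vertex they fix the sign. -/
theorem outwardNormal_eq (hE : E.D ≠ 0) {p q : Pt} (hpq : p ≠ q)
    (he : segment ℝ p q ⊆ segment ℝ E.left E.right) :
    outwardNormal E (segment ℝ p q) = -(‖E.gP‖⁻¹ • E.gP) := by
  have hspec : IsOutwardNormal E (segment ℝ p q) (outwardNormal E (segment ℝ p q)) :=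
    Classical.epsilon_spec ⟨_, isOutwardNormal_gP hE he⟩
  set ν := outwardNormal E (segment ℝ p q)
  have hp := (mem_segment_left_right hE).1 (he (left_mem_segment ℝ p q))
  have hq := (mem_segment_left_right hE).1 (he (right_mem_segment ℝ p q))
  have h1 := hspec.2 p (left_mem_segment ℝ p q) q hq.1
  have h2 := hspec.2 q (right_mem_segment ℝ p q) p hp.1
  have h3 := hspec.2 p (left_mem_segment ℝ p q) E.peak (verts_subset_carrier (mem_verts.2 (.inl rfl)))
  have hg0 : inner ℝ E.gP (q - p) = 0 := by rw [← cP_sub, hp.2, hq.2, sub_zero]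
  have hg1 : inner ℝ E.gP (E.peak - p) = 1 := by rw [← cP_sub, hp.2, (coord_peak hE).1, sub_zero]
  have hg := norm_pos_iff.2 (gP_ne_zero hE)
  have hn : ν 0 ^ 2 + ν 1 ^ 2 = 1 := by rw [← norm_sq_eq, hspec.1, one_pow]
  have hgn := norm_sq_eq E.gP
  rw [inner_pt] at h1 h2 h3 hg0 hg1
  simp only [PiLp.sub_apply] at h1 h2 h3 hg0 hg1
  have hν0 : ν 0 * (q 0 - p 0) + ν 1 * (q 1 - p 1) = 0 := by linarith
  -- Both `ν` and `gP` are orthogonal to `q - p ≠ 0`, so in the plane they are parallel.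
  have hcross : ν 0 * E.gP 1 - ν 1 * E.gP 0 = 0 := by
    by_contra hne
    apply hpq
    have a0 : (ν 0 * E.gP 1 - ν 1 * E.gP 0) * (q 0 - p 0) = 0 := by linear_combination E.gP 1 * hν0 - ν 1 * hg0
    have a1 : (ν 0 * E.gP 1 - ν 1 * E.gP 0) * (q 1 - p 1) = 0 := by linear_combination ν 0 * hg0 - E.gP 0 * hν0
    have b0 := (mul_eq_zero.1 a0).resolve_left hne
    have b1 := (mul_eq_zero.1 a1).resolve_left hne
    exact pt_ext (by linarith) (by linarith)
  set s := ν 0 * E.gP 0 + ν 1 * E.gP 1 with hs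
  have hsg : s * 1 = ‖E.gP‖ ^ 2 * (ν 0 * (E.peak 0 - p 0) + ν 1 * (E.peak 1 - p 1)) := by
    rw [← hg1, hgn, hs]
    linear_combination ((E.peak 1 - p 1) * E.gP 0 - (E.peak 0 - p 0) * E.gP 1) * hcross
  have hs0 : s ≤ 0 := by nlinarith [sq_nonneg ‖E.gP‖]
  have hsq : s ^ 2 = ‖E.gP‖ ^ 2 := by
    rw [hgn, hs]
    linear_combination (E.gP 0 ^ 2 + E.gP 1 ^ 2) * hn - (ν 0 * E.gP 1 - ν 1 * E.gP 0) * hcross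
  have hsv : s = -‖E.gP‖ := by
    rcases sq_eq_sq_iff_eq_or_eq_neg.1 hsq with h | h
    · linarith
    · exact h
  have hc : ∀ i, ν i * ‖E.gP‖ = - E.gP i := by
    intro i
    have : ν i * ‖E.gP‖ ^ 2 = s * E.gP i := by
      rw [hgn, hs]
      fin_cases i
      · show ν 0 * _ = _ * E.gP 0
        linear_combination E.gP 1 * hcross
      · show ν 1 * _ = _ * E.gP 1
        linear_combination -E.gP 0 * hcross
    rw [hsv] at this
    have h' : (ν i * ‖E.gP‖) * ‖E.gP‖ = (- E.gP i) * ‖E.gP‖ := by linarith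
    exact mul_right_cancel₀ hg.ne' h'
  ext i
  have := hc i
  simp only [PiLp.neg_apply, PiLp.smul_apply, smul_eq_mul]
  field_simp
  linarith

theorem verts_rot : E.rot.verts = E.verts := by
  ext x; simp only [mem_verts, rot]; tauto

end Tri

variable {T : Finset Tri} {E : Tri}

theorem edges_rot : edges T E.rot = edges T E := by
  simp only [edges, nodesOn, Tri.rot_carrier]

theorem outwardNormal_rot (e : Set Pt) : outwardNormal E.rot e = outwardNormal E e := by
  have : IsOutwardNormal E.rot e = IsOutwardNormal E e := by
    funext ν
    simp only [IsOutwardNormal, Tri.rot_carrier]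
  simp only [outwardNormal, this]

theorem flux_side (hE : E.D ≠ 0) (hN : ∀ x ∈ E.verts, x ∈ nodes T) {v : Pt → ℝ}
    (hv : ContinuousOn v E.carrier) (i : Fin 2) :
    -|E.D| * (E.gP i * Tri.segMean v E.left E.right) =
      ∑ e ∈ (edges T E).filter (· ⊆ segment ℝ E.left E.right),
        outwardNormal E e i * ∫ x in e, v x ∂(Measure.hausdorffMeasure 1) := by
  have hL : E.left ∈ E.verts := Tri.mem_verts.2 (.inr (.inl rfl))
  have hR : E.right ∈ E.verts := Tri.mem_verts.2 (.inr (.inr rfl))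
  have hg := norm_pos_iff.2 (Tri.gP_ne_zero hE)
  have h1 : ∀ e ∈ (edges T E).filter (· ⊆ segment ℝ E.left E.right),
      outwardNormal E e i * (∫ x in e, v x ∂(Measure.hausdorffMeasure 1)) =
        -(‖E.gP‖⁻¹ * E.gP i) * ∫ x in e, v x ∂(Measure.hausdorffMeasure 1) := by
    intro e he
    obtain ⟨he, hs⟩ := Finset.mem_filter.1 he
    obtain ⟨p, -, q, -, hpq, -, -, rfl⟩ := mem_edges.1 he
    rw [Tri.outwardNormal_eq hE hpq hs]
    rfl
  rw [Finset.sum_congr rfl h1, ← Finset.mul_sum,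
    ← integral_side (Tri.left_ne_right hE) (hN _ hL) (hN _ hR)
      (Tri.segment_subset_frontier hE hL hR) hv,
    integral_segment (Tri.left_ne_right hE), ← Tri.norm_gP hE]
  field_simp

/-- Some barycentric coordinate vanishes at the midpoint of the segment. Being nonnegative at both
ends, it vanishes at both, hence along the whole segment. -/
theorem edge_subset_one_side (hE : E.D ≠ 0) {p q : Pt} (h : segment ℝ p q ⊆ frontier E.carrier) :
    segment ℝ p q ⊆ segment ℝ E.left E.right ∨ segment ℝ p q ⊆ segment ℝ E.right E.peak ∨
      segment ℝ p q ⊆ segment ℝ E.peak E.left := by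
  have hm : (AffineMap.lineMap p q (1 / 2 : ℝ) : Pt) ∈ segment ℝ p q :=
    mem_segment_iff_lineMap.2 ⟨1 / 2, by norm_num, rfl⟩
  have hp := (Tri.mem_carrier_iff hE).1 (Tri.frontier_subset (h (left_mem_segment ℝ p q)))
  have hq := (Tri.mem_carrier_iff hE).1 (Tri.frontier_subset (h (right_mem_segment ℝ p q)))
  obtain ⟨-, hc⟩ := (Tri.mem_frontier_iff hE).1 (h hm)
  rw [Tri.cP_lineMap, Tri.cL_lineMap, Tri.cR_lineMap] at hc
  have key : ∀ x ∈ segment ℝ p q, x ∈ E.carrier ∧ ∃ t : ℝ, AffineMap.lineMap p q t = x := fun x hx => by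
    obtain ⟨t, -, ht⟩ := mem_segment_iff_lineMap.1 hx
    exact ⟨Tri.frontier_subset (h hx), t, ht⟩
  rcases hc with hc | hc | hc
  · left
    intro x hx
    obtain ⟨hx, t, rfl⟩ := key x hx
    have h1 : E.cP p = 0 := by linarith
    have h2 : E.cP q = 0 := by linarith
    exact (Tri.mem_segment_left_right hE).2 ⟨hx, by rw [Tri.cP_lineMap, h1, h2]; ring⟩
  · right; left
    intro x hx
    obtain ⟨hx, t, rfl⟩ := key x hx
    have h1 : E.cL p = 0 := by linarith
    have h2 : E.cL q = 0 := by linarith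
    rw [segment_symm]
    exact (Tri.mem_segment_peak_right hE).2 ⟨hx, by rw [Tri.cL_lineMap, h1, h2]; ring⟩
  · right; right
    intro x hx
    obtain ⟨hx, t, rfl⟩ := key x hx
    have h1 : E.cR p = 0 := by linarith
    have h2 : E.cR q = 0 := by linarith
    exact (Tri.mem_segment_peak_left hE).2 ⟨hx, by rw [Tri.cR_lineMap, h1, h2]; ring⟩

theorem sum_edges_eq (hE : E.D ≠ 0) (F : Set Pt → ℝ) : ∑ e ∈ edges T E, F e =
    (∑ e ∈ (edges T E).filter (· ⊆ segment ℝ E.left E.right), F e) +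
    (∑ e ∈ (edges T E).filter (· ⊆ segment ℝ E.right E.peak), F e) +
    ∑ e ∈ (edges T E).filter (· ⊆ segment ℝ E.peak E.left), F e := by
  rw [Finset.sum_filter, Finset.sum_filter, Finset.sum_filter, ← Finset.sum_add_distrib,
    ← Finset.sum_add_distrib]
  refine Finset.sum_congr rfl fun e he => ?_
  obtain ⟨p, -, q, -, hpq, hsub, -, rfl⟩ := mem_edges.1 he
  have hl := left_mem_segment ℝ p q
  have hr := right_mem_segment ℝ p q
  have h1 : segment ℝ p q ⊆ segment ℝ E.left E.right → E.cP p = 0 ∧ E.cP q = 0 := fun h =>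
    ⟨((Tri.mem_segment_left_right hE).1 (h hl)).2, ((Tri.mem_segment_left_right hE).1 (h hr)).2⟩
  have h2 : segment ℝ p q ⊆ segment ℝ E.right E.peak → E.cL p = 0 ∧ E.cL q = 0 := fun h => by
    rw [segment_symm _ E.right] at h
    exact ⟨((Tri.mem_segment_peak_right hE).1 (h hl)).2, ((Tri.mem_segment_peak_right hE).1 (h hr)).2⟩
  have h3 : segment ℝ p q ⊆ segment ℝ E.peak E.left → E.cR p = 0 ∧ E.cR q = 0 := fun h =>
    ⟨((Tri.mem_segment_peak_left hE).1 (h hl)).2, ((Tri.mem_segment_peak_left hE).1 (h hr)).2⟩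
  have n12 : ¬ (segment ℝ p q ⊆ segment ℝ E.left E.right ∧ segment ℝ p q ⊆ segment ℝ E.right E.peak) :=
    fun h => hpq ((Tri.eq_right hE (h1 h.1).1 (h2 h.2).1).trans
      (Tri.eq_right hE (h1 h.1).2 (h2 h.2).2).symm)
  have n13 : ¬ (segment ℝ p q ⊆ segment ℝ E.left E.right ∧ segment ℝ p q ⊆ segment ℝ E.peak E.left) :=
    fun h => hpq ((Tri.eq_left hE (h1 h.1).1 (h3 h.2).1).trans
      (Tri.eq_left hE (h1 h.1).2 (h3 h.2).2).symm)
  have n23 : ¬ (segment ℝ p q ⊆ segment ℝ E.right E.peak ∧ segment ℝ p q ⊆ segment ℝ E.peak E.left) :=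
    fun h => hpq ((Tri.eq_peak hE (h2 h.1).1 (h3 h.2).1).trans
      (Tri.eq_peak hE (h2 h.1).2 (h3 h.2).2).symm)
  rcases edge_subset_one_side hE hsub with h | h | h
  · rw [if_pos h, if_neg fun h' => n12 ⟨h, h'⟩, if_neg fun h' => n13 ⟨h, h'⟩]; ring
  · rw [if_pos h, if_neg fun h' => n12 ⟨h', h⟩, if_neg fun h' => n23 ⟨h, h'⟩]; ring
  · rw [if_pos h, if_neg fun h' => n13 ⟨h', h⟩, if_neg fun h' => n23 ⟨h', h⟩]; ring

/-- Green's formula, in terms of the edges of the polygon `E`. -/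
theorem green_edges (hE : E.D ≠ 0) (hN : ∀ x ∈ E.verts, x ∈ nodes T) {v : Pt → ℝ}
    (hv : ContinuousOn v E.carrier) {g : Pt → Pt} (hg : IntegrableOn g (interior E.carrier))
    (hw : HasWeakGrad (interior E.carrier) v g) (i : Fin 2) :
    ∫ x in interior E.carrier, g x i =
      ∑ e ∈ edges T E, outwardNormal E e i * ∫ x in e, v x ∂(Measure.hausdorffMeasure 1) := by
  have hE' : E.rot.D ≠ 0 := by rwa [Tri.rot_D]
  have hE'' : E.rot.rot.D ≠ 0 := by rwa [Tri.rot_D]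
  have f1 := flux_side hE hN hv i
  have f2 := flux_side (E := E.rot) hE' (by rwa [Tri.verts_rot]) (by rwa [Tri.rot_carrier]) i
  have f3 := flux_side (E := E.rot.rot) hE'' (by rwa [Tri.verts_rot, Tri.verts_rot])
    (by rwa [Tri.rot_carrier, Tri.rot_carrier]) i
  simp only [edges_rot, outwardNormal_rot, Tri.rot_D, Tri.rot_gP, Tri.rot_gL] at f2 f3
  rw [sum_edges_eq hE, ← f1]
  change _ = _ + (∑ e ∈ (edges T E).filter (· ⊆ segment ℝ E.rot.left E.rot.right), _) +
    ∑ e ∈ (edges T E).filter (· ⊆ segment ℝ E.rot.rot.left E.rot.rot.right), _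
  rw [← f2, ← f3, Tri.green hE hv hg hw i]
  simp only [Tri.rot]
  ring

/-! ### Nodal bounds for discrete functions and for the projection -/

variable {T : Finset Tri} {E : Tri}

theorem Tri.frontier_eq (hE : E.D ≠ 0) : frontier E.carrier =
    segment ℝ E.left E.right ∪ (segment ℝ E.peak E.right ∪ segment ℝ E.peak E.left) := by
  ext x
  rw [Tri.mem_frontier_iff hE, Set.mem_union, Set.mem_union, Tri.mem_segment_left_right hE,
    Tri.mem_segment_peak_right hE, Tri.mem_segment_peak_left hE]
  tauto

/-- An affine function on an edge is bounded by its values at the two ends, which are nodes. -/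
theorem abs_le_of_nodesOn (hE : E.D ≠ 0) (hN : ∀ x ∈ E.verts, x ∈ nodes T) {z : Pt → ℝ}
    (hz : ∀ e ∈ edges T E, ∃ p : P1, ∀ x ∈ e, z x = p x) {M : ℝ}
    (hM : ∀ x ∈ nodesOn T E, |z x| ≤ M) : ∀ x ∈ frontier E.carrier, |z x| ≤ M := by
  intro x hx
  by_cases hn : x ∈ nodes T
  · exact hM x (mem_nodesOn.2 ⟨hn, hx⟩)
  have hP : E.peak ∈ E.verts := Tri.mem_verts.2 (.inl rfl)
  have hL : E.left ∈ E.verts := Tri.mem_verts.2 (.inr (.inl rfl))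
  have hR : E.right ∈ E.verts := Tri.mem_verts.2 (.inr (.inr rfl))
  have hedge : ∃ e ∈ edges T E, x ∈ e := by
    rw [Tri.frontier_eq hE] at hx
    rcases hx with hx | hx | hx
    · obtain ⟨e, he, hxe, -⟩ := exists_edge (Tri.left_ne_right hE) (hN _ hL) (hN _ hR)
        (Tri.segment_subset_frontier hE hL hR) hx hn
      exact ⟨e, he, hxe⟩
    · obtain ⟨e, he, hxe, -⟩ := exists_edge (Tri.peak_ne_right hE) (hN _ hP) (hN _ hR)
        (Tri.segment_subset_frontier hE hP hR) hx hn
      exact ⟨e, he, hxe⟩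
    · obtain ⟨e, he, hxe, -⟩ := exists_edge (Tri.peak_ne_left hE) (hN _ hP) (hN _ hL)
        (Tri.segment_subset_frontier hE hP hL) hx hn
      exact ⟨e, he, hxe⟩
  obtain ⟨e, he, hxe⟩ := hedge
  obtain ⟨P, hzP⟩ := hz e he
  obtain ⟨p, hp, q, hq, -, -, -, rfl⟩ := mem_edges.1 he
  obtain ⟨t, ht, rfl⟩ := mem_segment_iff_lineMap.1 hxe
  have h1 := hM p hp
  have h2 := hM q hq
  rw [hzP _ (left_mem_segment _ _ _)] at h1
  rw [hzP _ (right_mem_segment _ _ _)] at h2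
  rw [hzP _ hxe, AffineMap.apply_lineMap, AffineMap.lineMap_apply_ring]
  rw [abs_le] at h1 h2 ⊢
  constructor <;> nlinarith [ht.1, ht.2]

theorem Tri.measure_frontier_lt_top (hE : E.D ≠ 0) :
    (Measure.hausdorffMeasure 1 : Measure Pt) (frontier E.carrier) < ⊤ := by
  rw [Tri.frontier_eq hE]
  refine measure_union_lt_top ?_ (measure_union_lt_top ?_ ?_) <;>
  · rw [hausdorffMeasure_segment]
    exact edist_lt_top _ _

theorem Tri.measure_frontier_pos (hE : E.D ≠ 0) :
    0 < (Measure.hausdorffMeasure 1 : Measure Pt).real (frontier E.carrier) := by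
  refine ENNReal.toReal_pos (ne_of_gt ?_) (Tri.measure_frontier_lt_top hE).ne
  refine lt_of_lt_of_le ?_ (measure_mono (Tri.frontier_eq hE ▸ Set.subset_union_left :
    segment ℝ E.left E.right ⊆ frontier E.carrier))
  rw [hausdorffMeasure_segment]
  exact edist_pos.2 (Tri.left_ne_right hE)

theorem Tri.integrableOn_frontier (hE : E.D ≠ 0) {f : Pt → ℝ} (hf : ContinuousOn f E.carrier) :
    IntegrableOn f (frontier E.carrier) (Measure.hausdorffMeasure 1) :=
  hf.integrableOn_of_subset_isCompact E.isCompact_carrier isClosed_frontier.measurableSet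
    Tri.frontier_subset (Tri.measure_frontier_lt_top hE).ne

theorem integral_inner_sub {g : Pt → Pt} (hg : IntegrableOn g (interior E.carrier)) (G k : Pt) :
    ∫ x in interior E.carrier, inner ℝ (g x - G) k =
      ((∫ x in interior E.carrier, g x 0) - E.area * G 0) * k 0 +
      ((∫ x in interior E.carrier, g x 1) - E.area * G 1) * k 1 := by
  have := isFiniteMeasure_interior E
  have hgi : ∀ i, IntegrableOn (fun x => g x i) (interior E.carrier) := fun i =>
    (EuclideanSpace.proj (𝕜 := ℝ) i).integrable_comp hg
  have hc : ∀ c : ℝ, ∫ _ in interior E.carrier, c = E.area * c := fun c => by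
    rw [setIntegral_const, Tri.volume_interior, smul_eq_mul]
  have hsub : ∀ i, IntegrableOn (fun x => g x i - G i) (interior E.carrier) := fun i =>
    (hgi i).sub (integrable_const _)
  simp only [inner_pt, PiLp.sub_apply]
  rw [integral_add ((hsub 0).mul_const _) ((hsub 1).mul_const _), integral_mul_const, integral_mul_const,
    integral_sub (hgi 0) (integrable_const _), integral_sub (hgi 1) (integrable_const _), hc, hc]

/-- The gradient must be the mean of the weak gradient, and the additive constant is then fixed by
the mean over the boundary. This legitimates the choice made in `piNabla`. -/
theorem exists_isPiNabla (hE : E.D ≠ 0) {z : Pt → ℝ} (hz : ContinuousOn z E.carrier)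
    (hg : IntegrableOn (weakGrad (interior E.carrier) z) (interior E.carrier)) :
    ∃ p : P1, IsPiNabla E z p := by
  set g := weakGrad (interior E.carrier) z with hgdef
  set G : Pt := !₂[(∫ x in interior E.carrier, g x 0) / E.area,
    (∫ x in interior E.carrier, g x 1) / E.area] with hG
  have ha := Tri.area_pos hE
  have hm := Tri.measure_frontier_pos hE
  set m := (Measure.hausdorffMeasure 1 : Measure Pt).real (frontier E.carrier) with hmdef
  set c := (∫ x in frontier E.carrier, (z x - mkP1 G 0 x) ∂(Measure.hausdorffMeasure 1)) / m with hc
  refine ⟨mkP1 G c, fun q => ?_, ?_⟩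
  · rw [← hgdef, grad1_mkP1, integral_inner_sub hg]
    have h0 : E.area * G 0 = ∫ x in interior E.carrier, g x 0 := by
      simp only [hG, PiLp.toLp_apply, Matrix.cons_val_zero]; field_simp
    have h1 : E.area * G 1 = ∫ x in interior E.carrier, g x 1 := by
      simp only [hG, PiLp.toLp_apply, Matrix.cons_val_one, Matrix.cons_val_zero]; field_simp
    rw [h0, h1]
    ring
  · have hfin : IsFiniteMeasure ((Measure.hausdorffMeasure 1 : Measure Pt).restrict
        (frontier E.carrier)) :=
      ⟨by rw [Measure.restrict_apply_univ]; exact Tri.measure_frontier_lt_top hE⟩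
    have h : ∀ x, z x - mkP1 G c x = (z x - mkP1 G 0 x) - c := fun x => by
      rw [mkP1_apply, mkP1_apply]; ring
    simp only [h]
    rw [integral_sub (Tri.integrableOn_frontier hE (f := fun x => z x - mkP1 G 0 x)
      (hz.sub (P1_continuous _).continuousOn)) (integrable_const _), setIntegral_const, smul_eq_mul, ← hmdef, hc]
    field_simp
    ring

theorem isPiNabla_piNabla (hE : E.D ≠ 0) {z : Pt → ℝ} (hz : ContinuousOn z E.carrier)
    (hg : IntegrableOn (weakGrad (interior E.carrier) z) (interior E.carrier)) :
    IsPiNabla E z (piNabla E z) :=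
  Classical.epsilon_spec (exists_isPiNabla hE hz hg)

theorem IsPiNabla.area_mul_grad {z : Pt → ℝ} {p : P1} (hp : IsPiNabla E z p)
    (hg : IntegrableOn (weakGrad (interior E.carrier) z) (interior E.carrier)) (i : Fin 2) :
    E.area * grad1 p i = ∫ x in interior E.carrier, weakGrad (interior E.carrier) z x i := by
  have h := hp.1 (mkP1 (EuclideanSpace.single i 1) 0)
  rw [grad1_mkP1, integral_inner_sub hg] at h
  fin_cases i
  · simp at h ⊢
    linarith
  · simp at h ⊢
    linarith

theorem abs_segMean_le {z : Pt → ℝ} {a b : Pt} {M : ℝ} (h : ∀ x ∈ segment ℝ a b, |z x| ≤ M) :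
    |Tri.segMean z a b| ≤ M := by
  have := norm_setIntegral_le_of_norm_le_const (μ := volume) (s := Set.Icc (0 : ℝ) 1) (C := M)
    (f := fun t => z (AffineMap.lineMap a b t)) (by simp)
    (fun t ht => h _ (mem_segment_iff_lineMap.2 ⟨t, ht, rfl⟩))
  simpa [Tri.segMean] using this

theorem norm_le_abs_add_abs (x : Pt) : ‖x‖ ≤ |x 0| + |x 1| := by
  rw [← sq_le_sq₀ (norm_nonneg _) (by positivity), Tri.norm_sq_eq]
  nlinarith [sq_abs (x 0), sq_abs (x 1), abs_nonneg (x 0), abs_nonneg (x 1)]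

/-- There are three boundary terms, each at most `M` times the length of a side, and a side is no
longer than `2 √Q`. -/
theorem Tri.abs_green_le (hE : E.D ≠ 0) {z : Pt → ℝ} (hz : ContinuousOn z E.carrier) {g : Pt → Pt}
    (hg : IntegrableOn g (interior E.carrier)) (hw : HasWeakGrad (interior E.carrier) z g) {M : ℝ}
    (hM : ∀ x ∈ frontier E.carrier, |z x| ≤ M) (i : Fin 2) :
    |∫ x in interior E.carrier, g x i| ≤ 6 * Real.sqrt E.Q * M := by
  have hP : E.peak ∈ E.verts := Tri.mem_verts.2 (.inl rfl)
  have hL : E.left ∈ E.verts := Tri.mem_verts.2 (.inr (.inl rfl))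
  have hR : E.right ∈ E.verts := Tri.mem_verts.2 (.inr (.inr rfl))
  have hM0 : 0 ≤ M := (abs_nonneg _).trans (hM _ (Tri.verts_subset_frontier hE hP))
  have key : ∀ F : Tri, F.D ≠ 0 → F.left ∈ E.verts → F.right ∈ E.verts → |E.D| = |F.D| →
      |(|E.D| * (F.gP i * segMean z F.left F.right))| ≤ 2 * Real.sqrt E.Q * M := by
    intro F hF hl hr hD
    rw [← mul_assoc, abs_mul, abs_mul, abs_abs]
    have h1 : |E.D| * |F.gP i| ≤ 2 * Real.sqrt E.Q := by
      calc |E.D| * |F.gP i| ≤ |F.D| * ‖F.gP‖ := by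
            rw [hD]; gcongr; exact PiLp.norm_apply_le F.gP i
        _ = ‖F.left - F.right‖ := by rw [norm_gP hF, dist_eq_norm]
        _ ≤ _ := norm_sub_le (verts_subset_carrier hl) (verts_subset_carrier hr)
    exact mul_le_mul h1 (abs_segMean_le fun x hx => hM x (segment_subset_frontier hE hl hr hx))
      (abs_nonneg _) (by positivity)
  have hE' : E.rot.D ≠ 0 := by rwa [rot_D]
  have hE'' : E.rot.rot.D ≠ 0 := by rwa [rot_D]
  have k1 := key E hE hL hR rfl
  have k2 := key E.rot hE' hR hP (by rw [rot_D])
  have k3 := key E.rot.rot hE'' hP hL (by rw [rot_D, rot_D])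
  rw [rot_gP] at k2
  rw [rot_gP, rot_gL] at k3
  simp only [rot] at k2 k3
  rw [green hE hz hg hw i]
  rw [abs_le] at k1 k2 k3 ⊢
  constructor <;> linarith [k1.1, k1.2, k2.1, k2.2, k3.1, k3.2]

/-- The gradient of `p` is a mean of the weak gradient, thus controlled by boundary values of `z`;
shape regularity turns this into an oscillation at most `24 κ M` over `E`. The boundary mean of `p`
is that of `z`, of size at most `M`. -/
theorem IsPiNabla.abs_apply_le (hE : E.D ≠ 0) {z : Pt → ℝ} {p : P1} (hp : IsPiNabla E z p)
    (hz : ContinuousOn z E.carrier)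
    (hg : IntegrableOn (weakGrad (interior E.carrier) z) (interior E.carrier))
    (hw : HasWeakGrad (interior E.carrier) z (weakGrad (interior E.carrier) z)) {M κ : ℝ}
    (hM : ∀ x ∈ frontier E.carrier, |z x| ≤ M) (hκ : E.Q ≤ κ * E.area) {x : Pt}
    (hx : x ∈ E.carrier) : |p x| ≤ (1 + 24 * κ) * M := by
  have ha := Tri.area_pos hE
  have hM0 : 0 ≤ M := (abs_nonneg _).trans
    (hM _ (Tri.verts_subset_frontier hE (Tri.mem_verts.2 (.inl rfl))))
  have hgrad : E.area * ‖grad1 p‖ ≤ 12 * Real.sqrt E.Q * M := by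
    have h0 := Tri.abs_green_le hE hz hg hw hM 0
    have h1 := Tri.abs_green_le hE hz hg hw hM 1
    rw [← hp.area_mul_grad hg, abs_mul, abs_of_pos ha] at h0 h1
    have := mul_le_mul_of_nonneg_left (norm_le_abs_add_abs (grad1 p)) ha.le
    linarith
  have hosc : ∀ y ∈ E.carrier, |p x - p y| ≤ 24 * κ * M := by
    intro y hy
    rw [P1_sub]
    have h1 := abs_real_inner_le_norm (grad1 p) (x - y)
    have h2 := Tri.norm_sub_le hx hy
    have h3 : E.area * (‖grad1 p‖ * ‖x - y‖) ≤ E.area * (24 * κ * M) := by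
      calc E.area * (‖grad1 p‖ * ‖x - y‖) = (E.area * ‖grad1 p‖) * ‖x - y‖ := by ring
        _ ≤ (12 * Real.sqrt E.Q * M) * (2 * Real.sqrt E.Q) := by gcongr
        _ = 24 * M * (Real.sqrt E.Q * Real.sqrt E.Q) := by ring
        _ = 24 * M * E.Q := by rw [Real.mul_self_sqrt Tri.Q_nonneg]
        _ ≤ 24 * M * (κ * E.area) := by gcongr
        _ = _ := by ring
    exact h1.trans (le_of_mul_le_mul_left h3 ha)
  have hm := Tri.measure_frontier_pos hE
  have hfin : IsFiniteMeasure ((Measure.hausdorffMeasure 1 : Measure Pt).restrict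
      (frontier E.carrier)) :=
    ⟨by rw [Measure.restrict_apply_univ]; exact Tri.measure_frontier_lt_top hE⟩
  -- As `z - p` has zero mean on the boundary, `p x` is the boundary mean of `(p x - p y) + z y`:
  -- oscillation plus boundary value.
  have hint : ∫ y in frontier E.carrier, (p x + (z y - p y)) ∂(Measure.hausdorffMeasure 1) =
      (Measure.hausdorffMeasure 1 : Measure Pt).real (frontier E.carrier) * p x := by
    rw [integral_add (integrable_const _)
      (Tri.integrableOn_frontier hE (f := fun y => z y - p y)
        (hz.sub (P1_continuous p).continuousOn)), hp.2, setIntegral_const,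
      smul_eq_mul, add_zero]
  have hbound := norm_setIntegral_le_of_norm_le_const (C := (1 + 24 * κ) * M)
    (f := fun y => p x + (z y - p y)) (Tri.measure_frontier_lt_top hE) fun y hy => by
      have h1 := hosc y (Tri.frontier_subset hy)
      have h2 := hM y hy
      rw [Real.norm_eq_abs]
      rw [abs_le] at h1 h2 ⊢
      constructor <;> linarith [h1.1, h1.2, h2.1, h2.2]
  rw [hint, Real.norm_eq_abs, abs_mul, abs_of_pos hm, mul_comm] at hbound
  exact le_of_mul_le_mul_right hbound hm

theorem lagrange_apply (hE : E.D ≠ 0) (v : Pt → ℝ) {x : Pt} (hx : x ∈ E.verts) :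
    lagrange E v x = v x :=
  Classical.epsilon_spec (p := fun p : P1 => ∀ x ∈ E.verts, p x = v x) (Tri.exists_interp hE v) x hx

/-! ### The residual equation and its bound by the estimator -/

variable {Ω : Set Pt} {T₀ T H : Finset Tri} {E : Tri}

theorem IsLocalVEMSpace.isH1With {W : Submodule ℝ C(E.carrier, ℝ)} (hW : IsLocalVEMSpace T E W)
    {z : Pt → ℝ} (hz : RestrictsInto E W z) :
    IsH1With (interior E.carrier) z (weakGrad (interior E.carrier) z) := by
  have h := hW.memH1 z hz
  rw [weakGrad, dif_pos h]
  exact h.choose_spec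

theorem IsLocalVEMSpace.integrableOn_weakGrad {W : Submodule ℝ C(E.carrier, ℝ)}
    (hW : IsLocalVEMSpace T E W) {z : Pt → ℝ} (hz : RestrictsInto E W z) :
    IntegrableOn (weakGrad (interior E.carrier) z) (interior E.carrier) :=
  memLp_one_of_two le_rfl (hW.isH1With hz).2.1

/-- The stiffness term, as a sum over all the edges. -/
theorem aT_eq_sum_jump (hr : IsRefinement T₀ T H) (h₀ : IsConformingTriangulation Ω T₀)
    {V : (E : Tri) → Submodule ℝ C(E.carrier, ℝ)} (hV : ∀ E ∈ T, IsLocalVEMSpace T E (V E))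
    (DT : Tri → Coeff) (u : Pt → ℝ) {z : Pt → ℝ} (hz : MemVT Ω T V z) :
    aT T DT u z = ∑ e ∈ T.biUnion (edges T),
      jump Ω T DT e u * ∫ x in e, z x ∂(Measure.hausdorffMeasure 1) := by
  have h1 : aT T DT u z = ∑ E ∈ T, ∑ e ∈ edges T E,
      inner ℝ (Matrix.toEuclideanLin (DT E).A (grad1 (piNabla E u))) (outwardNormal E e) *
        ∫ x in e, z x ∂(Measure.hausdorffMeasure 1) := by
    refine Finset.sum_congr rfl fun E hE => ?_
    have hD := hr.D_ne h₀ hE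
    have hg := (hV E hE).integrableOn_weakGrad (hz.2 E hE)
    have hc := (hz.2 E hE).continuousOn
    have hP := isPiNabla_piNabla hD hc hg
    -- The fluxes are constant on `E`, so only the mean of ∇z matters, and Green's formula expresses
    -- it by integrals of `z` itself, not of its projection, over the edges.
    have hG : ∀ i, E.area * grad1 (piNabla E z) i = ∑ e ∈ edges T E,
        outwardNormal E e i * ∫ x in e, z x ∂(Measure.hausdorffMeasure 1) := fun i => by
      rw [hP.area_mul_grad hg, green_edges hD (fun x hx => mem_nodes.2 ⟨E, hE, hx⟩) hc hg
        ((hV E hE).isH1With (hz.2 E hE)).2.2]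
    rw [setIntegral_const, smul_eq_mul, inner_pt]
    change E.area * _ = _
    rw [mul_add, mul_left_comm, hG, mul_left_comm, hG, Finset.mul_sum, Finset.mul_sum,
      ← Finset.sum_add_distrib]
    refine Finset.sum_congr rfl fun e _ => ?_
    rw [inner_pt]
    ring
  -- Grouping by edges collects, for each edge, the fluxes of all the elements having it: this is
  -- the jump. On boundary edges both sides vanish, the jump by convention and `z` by its trace.
  rw [h1, Finset.sum_comm' (t' := T.biUnion (edges T)) (s' := fun e => T.filter fun E => e ∈ edges T E)]
  · refine Finset.sum_congr rfl fun e _ => ?_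
    rw [← Finset.sum_mul, jump]
    split_ifs with h
    · rw [setIntegral_eq_zero_of_forall_eq_zero fun x hx => hz.eq_zero_of_mem_frontier hr h₀ (h hx)]
      ring
    · rfl
  · intro E e
    simp only [Finset.mem_filter, Finset.mem_biUnion]
    exact ⟨fun h => ⟨h, E, h⟩, fun h => h.1⟩

theorem sum_biUnion_le_sum {ι κ : Type*} (s : Finset ι) (t : ι → Finset κ) {f : κ → ℝ}
    (hf : ∀ e, 0 ≤ f e) : ∑ e ∈ s.biUnion t, f e ≤ ∑ i ∈ s, ∑ e ∈ t i, f e := by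
  induction s using Finset.induction_on with
  | empty => simp
  | insert a s ha ih =>
    rw [Finset.biUnion_insert, Finset.sum_insert ha]
    have h1 := Finset.sum_union_inter (s₁ := t a) (s₂ := s.biUnion t) (f := f)
    have h2 : 0 ≤ ∑ e ∈ t a ∩ s.biUnion t, f e := Finset.sum_nonneg fun e _ => hf e
    linarith

theorem residual_identity (hr : IsRefinement T₀ T H) (h₀ : IsConformingTriangulation Ω T₀)
    {V : (E : Tri) → Submodule ℝ C(E.carrier, ℝ)} (hV : ∀ E ∈ T, IsLocalVEMSpace T E (V E))
    {DT : Tri → Coeff} {γ : ℝ} {u : Pt → ℝ} (hu : IsGalerkinSolution Ω T V DT γ u) {z : Pt → ℝ}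
    (hz : MemVT Ω T V z) :
    γ * stabT T u z = (∑ E ∈ T, ∫ x in E.carrier, residual DT E u x * piNabla E z x) -
      ∑ e ∈ T.biUnion (edges T), jump Ω T DT e u * ∫ x in e, z x ∂(Measure.hausdorffMeasure 1) := by
  have h := hu.2 z hz
  rw [BT] at h
  rw [← aT_eq_sum_jump hr h₀ hV DT u hz]
  have hres : ∑ E ∈ T, ∫ x in E.carrier, residual DT E u x * piNabla E z x =
      FT T DT z - mT T DT u z := by
    rw [FT, mT, ← Finset.sum_sub_distrib]
    refine Finset.sum_congr rfl fun E _ => ?_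
    have c1 := P1_continuous (piNabla E z)
    have c2 := P1_continuous (piNabla E u)
    rw [← integral_const_mul, ← integral_const_mul, ← integral_sub]
    · refine integral_congr_ae (.of_forall fun x => ?_)
      simp only [residual]
      ring
    · exact (c1.const_mul _ |>.continuousOn).integrableOn_compact E.isCompact_carrier
    · exact ((c2.mul c1).const_mul _ |>.continuousOn).integrableOn_compact E.isCompact_carrier
  linarith

/-- Interpolation at the vertices reproduces affine polynomials, so subtracting `p E` leaves the
interpolation error unchanged at the nodes of `E`. -/
theorem sub_lagrange_eq (hr : IsRefinement T₀ T H) (h₀ : IsConformingTriangulation Ω T₀)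
    {u z : Pt → ℝ} {p : Tri → P1} (h : ∀ E ∈ T, ∀ x ∈ E.carrier, z x = u x - p E x) {x : Pt}
    (hE : E ∈ T) (hx : x ∈ nodesOn T E) : z x - lagrange E z x = u x - lagrange E u x := by
  have hD := hr.D_ne h₀ hE
  have := Tri.P1_ext hD (p := lagrange E z) (q := lagrange E u - p E) (fun v hv => by
    rw [lagrange_apply hD _ hv, h E hE v (Tri.verts_subset_carrier hv)]
    simp [lagrange_apply hD _ hv]) x
  rw [this, h E hE x (Tri.frontier_subset (mem_nodesOn.1 hx).2)]
  simp

theorem stabT_nonneg (T : Finset Tri) (u : Pt → ℝ) : 0 ≤ stabT T u u :=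
  Finset.sum_nonneg fun _ _ => Finset.sum_nonneg fun _ _ => mul_self_nonneg _

/-- Cauchy–Schwarz against the constant 1, obtained by expanding the integral of the squared
deviation of `|f|` from its mean. -/
theorem sq_integral_abs_le (hE : E.D ≠ 0) {f : Pt → ℝ} (hf : Continuous f) :
    (∫ x in E.carrier, |f x|) ^ 2 ≤ E.area * ∫ x in E.carrier, f x ^ 2 := by
  have ha := Tri.area_pos hE
  set m := ∫ x in E.carrier, |f x| with hm
  have i1 : IntegrableOn (fun x => f x ^ 2) E.carrier :=
    (hf.pow 2).continuousOn.integrableOn_compact E.isCompact_carrier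
  have i2 : IntegrableOn (fun x => 2 * (m / E.area) * |f x|) E.carrier :=
    (hf.abs.const_mul _).continuousOn.integrableOn_compact E.isCompact_carrier
  have i3 : IntegrableOn (fun _ : Pt => (m / E.area) ^ 2) E.carrier :=
    continuousOn_const.integrableOn_compact E.isCompact_carrier
  have h0 : 0 ≤ ∫ x in E.carrier, (|f x| - m / E.area) ^ 2 :=
    integral_nonneg fun x => sq_nonneg _
  have h1 : ∫ x in E.carrier, (|f x| - m / E.area) ^ 2 =
      (∫ x in E.carrier, f x ^ 2) - 2 * (m / E.area) * m + E.area * (m / E.area) ^ 2 := by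
    have : ∀ x, (|f x| - m / E.area) ^ 2 = (f x ^ 2 - 2 * (m / E.area) * |f x|) + (m / E.area) ^ 2 :=
      fun x => by rw [sub_sq, sq_abs]; ring
    simp only [this]
    have i12 : IntegrableOn (fun x => f x ^ 2 - 2 * (m / E.area) * |f x|) E.carrier := i1.sub i2
    rw [integral_add i12 i3, integral_sub i1 i2, integral_const_mul, setIntegral_const,
      smul_eq_mul, ← hm]
    rfl
  rw [h1] at h0
  have h2 : (∫ x in E.carrier, f x ^ 2) - 2 * (m / E.area) * m + E.area * (m / E.area) ^ 2 =
      ((E.area * ∫ x in E.carrier, f x ^ 2) - m ^ 2) / E.area := by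
    field_simp
    ring
  rw [h2] at h0
  have := (div_nonneg_iff.1 h0).resolve_right fun h => absurd h.2 (not_le.2 ha)
  linarith [this.1]

theorem card_edges_le (E : Tri) : (edges T E).card ≤ (nodesOn T E).card * (nodesOn T E).card := by
  rw [← Finset.card_product]
  exact Finset.card_image_le.trans (Finset.card_filter_le _ _)

/-- Local bound of the residual tested with a discrete function. -/
theorem local_residual_sq_le (hE : E ∈ T) (hD : E.D ≠ 0) {W : Submodule ℝ C(E.carrier, ℝ)}
    (hW : IsLocalVEMSpace T E W) {z : Pt → ℝ} (hz : RestrictsInto E W z) (DT : Tri → Coeff)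
    (u : Pt → ℝ) {κ : ℝ} (hκ0 : 0 ≤ κ) (hκ : E.Q ≤ κ * E.area) {B : ℕ}
    (hB : (nodesOn T E).card ≤ B) :
    (|∫ x in E.carrier, residual DT E u x * piNabla E z x| +
      ∑ e ∈ edges T E, |jump Ω T DT e u * ∫ x in e, z x ∂(Measure.hausdorffMeasure 1)|) ^ 2 ≤
    2 * ((1 + 24 * κ) ^ 2 + 4 * (B * B) * Real.sqrt κ) * (∑ x ∈ nodesOn T E, z x ^ 2) *
      etaLocSq Ω T DT E u := by
  have hN : ∀ x ∈ E.verts, x ∈ nodes T := fun x hx => mem_nodes.2 ⟨E, hE, hx⟩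
  set S := ∑ x ∈ nodesOn T E, z x ^ 2 with hS
  have hS0 : 0 ≤ S := Finset.sum_nonneg fun _ _ => sq_nonneg _
  set M := Real.sqrt S with hM
  have hM0 : 0 ≤ M := Real.sqrt_nonneg _
  have hMS : M ^ 2 = S := Real.sq_sqrt hS0
  have hg := hW.integrableOn_weakGrad hz
  have hc := hz.continuousOn
  have hbf : IsBoundaryFunction T E z := (hW.trace_eq z).2 ⟨z, hz, fun _ _ => rfl⟩
  -- The ℓ² norm `M` of the nodal values bounds each of them, hence `z` on the whole boundary.
  have hbd : ∀ x ∈ frontier E.carrier, |z x| ≤ M := abs_le_of_nodesOn hD hN hbf.2 fun x hx =>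
    Real.abs_le_sqrt (Finset.single_le_sum (f := fun x => z x ^ 2) (fun _ _ => sq_nonneg _) hx)
  have hP := isPiNabla_piNabla hD hc hg
  have hpi : ∀ x ∈ E.carrier, |piNabla E z x| ≤ (1 + 24 * κ) * M := fun x hx =>
    hP.abs_apply_le hD hc hg (hW.isH1With hz).2.2 hbd hκ hx
  have hrc : Continuous (residual DT E u) := by
    unfold residual
    exact continuous_const.sub ((P1_continuous _).const_mul _)
  set R := E.h ^ 2 * ∫ x in E.carrier, residual DT E u x ^ 2 with hR
  set J := ∑ e ∈ edges T E, E.h * ∫ _x in e, jump Ω T DT e u ^ 2 ∂(Measure.hausdorffMeasure 1) with hJ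
  have hh := Tri.h_pos hD
  have hR0 : 0 ≤ R := mul_nonneg (sq_nonneg _) (integral_nonneg fun _ => sq_nonneg _)
  have hJ0 : 0 ≤ J := Finset.sum_nonneg fun e _ =>
    mul_nonneg hh.le (integral_nonneg fun _ => sq_nonneg _)
  have hint : (∫ x in E.carrier, residual DT E u x * piNabla E z x) ^ 2 ≤
      (1 + 24 * κ) ^ 2 * S * R := by
    have h1 : |∫ x in E.carrier, residual DT E u x * piNabla E z x| ≤
        (1 + 24 * κ) * M * ∫ x in E.carrier, |residual DT E u x| := by
      rw [← integral_const_mul, ← Real.norm_eq_abs]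
      refine norm_integral_le_of_norm_le
        ((hrc.abs.const_mul _).continuousOn.integrableOn_compact E.isCompact_carrier) ?_
      filter_upwards [ae_restrict_mem E.isCompact_carrier.measurableSet] with x hx
      rw [Real.norm_eq_abs, abs_mul, mul_comm]
      exact mul_le_mul_of_nonneg_right (hpi x hx) (abs_nonneg _)
    have h2 := sq_integral_abs_le hD hrc
    rw [← Tri.h_sq hD, ← hR] at h2
    calc _ = |∫ x in E.carrier, residual DT E u x * piNabla E z x| ^ 2 := (sq_abs _).symm
      _ ≤ ((1 + 24 * κ) * M * ∫ x in E.carrier, |residual DT E u x|) ^ 2 := by gcongr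
      _ = (1 + 24 * κ) ^ 2 * S * (∫ x in E.carrier, |residual DT E u x|) ^ 2 := by rw [← hMS]; ring
      _ ≤ _ := by gcongr
  have hQh : Real.sqrt E.Q ≤ Real.sqrt κ * E.h := by
    rw [Tri.h, ← Real.sqrt_mul hκ0]
    exact Real.sqrt_le_sqrt hκ
  -- With `l` the length of the edge, `|∫_e z| ≤ M l`. One factor `l` is kept for the integral of
  -- `j²` over the edge; the other is at most `2 √κ h_E` and supplies the weight of the estimator.
  have hedge : ∀ e ∈ edges T E, |jump Ω T DT e u * ∫ x in e, z x ∂(Measure.hausdorffMeasure 1)| ^ 2 ≤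
      2 * Real.sqrt κ * S * (E.h * ∫ _x in e, jump Ω T DT e u ^ 2 ∂(Measure.hausdorffMeasure 1)) := by
    intro e he
    obtain ⟨p, hp, q, hq, -, hsub, -, rfl⟩ := mem_edges.1 he
    have hpc := Tri.frontier_subset (hsub (left_mem_segment ℝ p q))
    have hqc := Tri.frontier_subset (hsub (right_mem_segment ℝ p q))
    have hl : (Measure.hausdorffMeasure 1 : Measure Pt) (segment ℝ p q) < ⊤ := by
      rw [hausdorffMeasure_segment]; exact edist_lt_top _ _
    set l := (Measure.hausdorffMeasure 1 : Measure Pt).real (segment ℝ p q) with hldef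
    have hl0 : 0 ≤ l := measureReal_nonneg
    have hl1 : l ≤ 2 * (Real.sqrt κ * E.h) := by
      rw [hldef, measureReal_def, hausdorffMeasure_segment, ← dist_edist, dist_eq_norm]
      exact (Tri.norm_sub_le hpc hqc).trans (by gcongr)
    have hzl : |∫ x in segment ℝ p q, z x ∂(Measure.hausdorffMeasure 1)| ≤ M * l := by
      rw [← Real.norm_eq_abs]
      exact norm_setIntegral_le_of_norm_le_const hl fun x hx => hbd x (hsub hx)
    rw [setIntegral_const, smul_eq_mul, ← hldef, abs_mul, mul_pow, sq_abs]
    set j := jump Ω T DT (segment ℝ p q) u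
    calc j ^ 2 * |∫ x in segment ℝ p q, z x ∂(Measure.hausdorffMeasure 1)| ^ 2
        ≤ j ^ 2 * (M * l) ^ 2 := by gcongr
      _ = (j ^ 2 * S * l) * l := by rw [← hMS]; ring
      _ ≤ (j ^ 2 * S * l) * (2 * (Real.sqrt κ * E.h)) := by gcongr
      _ = _ := by ring
  have hsum : (∑ e ∈ edges T E, |jump Ω T DT e u * ∫ x in e, z x ∂(Measure.hausdorffMeasure 1)|) ^ 2 ≤
      (B * B) * (2 * Real.sqrt κ * S * J) := by
    refine sq_sum_le_card_mul_sum_sq.trans ?_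
    have hcard : ((edges T E).card : ℝ) ≤ B * B := by
      exact_mod_cast (card_edges_le E).trans (Nat.mul_le_mul hB hB)
    have hle := Finset.sum_le_sum hedge
    rw [← Finset.mul_sum, ← hJ] at hle
    exact mul_le_mul hcard hle (Finset.sum_nonneg fun _ _ => sq_nonneg _)
      (by positivity)
  have heta : etaLocSq Ω T DT E u = R + 1 / 2 * J := rfl
  have hs := Real.sqrt_nonneg κ
  rw [heta]
  set X := ∫ x in E.carrier, residual DT E u x * piNabla E z x
  set Y := ∑ e ∈ edges T E, |jump Ω T DT e u * ∫ x in e, z x ∂(Measure.hausdorffMeasure 1)|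
  calc (|X| + Y) ^ 2 ≤ 2 * X ^ 2 + 2 * Y ^ 2 := by
        rw [← sq_abs X]; nlinarith [sq_nonneg (|X| - Y)]
    _ ≤ 2 * ((1 + 24 * κ) ^ 2 * S * R) + 2 * ((B * B) * (2 * Real.sqrt κ * S * J)) := by gcongr
    -- The missing nonnegative cross terms are added so that the right-hand side factors through `R
    -- + J / 2`.
    _ ≤ 2 * ((1 + 24 * κ) ^ 2 * S * R) + 2 * ((B * B) * (2 * Real.sqrt κ * S * J)) +
        ((1 + 24 * κ) ^ 2 * S * J + 8 * (B * B) * Real.sqrt κ * S * R) :=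
      le_add_of_nonneg_right (by positivity)
    _ = _ := by ring

theorem etaLocSq_nonneg (DT : Tri → Coeff) (E : Tri) (u : Pt → ℝ) : 0 ≤ etaLocSq Ω T DT E u :=
  add_nonneg (mul_nonneg (sq_nonneg _) (integral_nonneg fun _ => sq_nonneg _))
    (mul_nonneg (by norm_num) (Finset.sum_nonneg fun _ _ =>
      mul_nonneg (Real.sqrt_nonneg _) (integral_nonneg fun _ => sq_nonneg _)))

/-- The shape regularity constant with respect to the area. -/
def areaShape (T₀ : Finset Tri) : ℝ := shape T₀ / refArea

theorem areaShape_pos (T₀ : Finset Tri) : 0 < areaShape T₀ := div_pos (shape_pos T₀) refArea_pos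

theorem IsRefinement.Q_le_area (hr : IsRefinement T₀ T H) (h₀ : IsConformingTriangulation Ω T₀)
    (hE : E ∈ T) : E.Q ≤ areaShape T₀ * E.area := by
  have := refArea_pos
  rw [Tri.area_eq (hr.D_ne h₀ hE), areaShape]
  refine (hr.Q_le h₀ hE).trans (le_of_eq ?_)
  field_simp

/-- The constant in the bound of the residual by the estimator. -/
def residualConst (T₀ : Finset Tri) (Λ : ℕ) : ℝ :=
  2 * ((1 + 24 * areaShape T₀) ^ 2 +
    4 * ((closureBound Λ : ℝ) * closureBound Λ) * Real.sqrt (areaShape T₀))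

theorem residualConst_nonneg (T₀ : Finset Tri) (Λ : ℕ) : 0 ≤ residualConst T₀ Λ := by
  have := Real.sqrt_nonneg (areaShape T₀)
  unfold residualConst
  positivity

/-- The local bounds are summed by Cauchy–Schwarz over the elements. The residual equation counts
each edge once, while the sum over the elements counts it at least once. -/
theorem sq_residual_le (hr : IsRefinement T₀ T H) (h₀ : IsConformingTriangulation Ω T₀) {Λ : ℕ}
    (hA : IsAdmissible Λ T H) {V : (E : Tri) → Submodule ℝ C(E.carrier, ℝ)}
    (hV : ∀ E ∈ T, IsLocalVEMSpace T E (V E)) {DT : Tri → Coeff} {γ : ℝ} {u : Pt → ℝ}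
    (hu : IsGalerkinSolution Ω T V DT γ u) {z : Pt → ℝ} (hz : MemVT Ω T V z) :
    (γ * stabT T u z) ^ 2 ≤ residualConst T₀ Λ * (∑ E ∈ T, ∑ x ∈ nodesOn T E, z x ^ 2) *
      etaSq Ω T DT u := by
  set a : Tri → ℝ := fun E => |∫ x in E.carrier, residual DT E u x * piNabla E z x| +
      ∑ e ∈ edges T E, |jump Ω T DT e u * ∫ x in e, z x ∂(Measure.hausdorffMeasure 1)| with ha
  have h1 : |γ * stabT T u z| ≤ ∑ E ∈ T, a E := by
    rw [residual_identity hr h₀ hV hu hz, ha, Finset.sum_add_distrib]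
    refine (abs_sub _ _).trans (add_le_add (Finset.abs_sum_le_sum_abs _ _) ?_)
    exact (Finset.abs_sum_le_sum_abs _ _).trans (sum_biUnion_le_sum _ _ fun _ => abs_nonneg _)
  have h2 : (∑ E ∈ T, a E) ^ 2 ≤
      (∑ E ∈ T, residualConst T₀ Λ * ∑ x ∈ nodesOn T E, z x ^ 2) * ∑ E ∈ T, etaLocSq Ω T DT E u := by
    refine Finset.sum_sq_le_sum_mul_sum_of_sq_le_mul _
      (fun E _ => mul_nonneg (residualConst_nonneg _ _) (Finset.sum_nonneg fun _ _ => sq_nonneg _))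
      (fun E _ => etaLocSq_nonneg DT E u) fun E hE => ?_
    exact local_residual_sq_le hE (hr.D_ne h₀ hE) (hV E hE) (hz.2 E hE) DT u (areaShape_pos T₀).le
      (hr.Q_le_area h₀ hE) (card_nodesOn_le hr h₀ hA hE)
  rw [← Finset.mul_sum] at h2
  calc (γ * stabT T u z) ^ 2 = |γ * stabT T u z| ^ 2 := (sq_abs _).symm
    _ ≤ (∑ E ∈ T, a E) ^ 2 := by gcongr
    _ ≤ _ := h2

end

end VEM

theorem proposition4p3 (Ω : Set Pt) (T₀ : Finset Tri) (hT₀ : IsConformingTriangulation Ω T₀)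
    (Λ : ℕ) (hΛ : 1 ≤ Λ) (c_s C_s : ℝ) (hc_s : 0 < c_s) (hC_s : c_s ≤ C_s) :
    ∃ C_B : ℝ, 0 < C_B ∧
      ∀ T H : Finset Tri, IsRefinement T₀ T H → IsAdmissible Λ T H →
      ∀ V : (E : Tri) → Submodule ℝ C(E.carrier, ℝ),
        (∀ E ∈ T, IsLocalVEMSpace T E (V E)) →
        (∀ E ∈ T, IsStable c_s C_s T E (V E)) →
      ∀ (D : Pt → Coeff) (DT : Tri → Coeff), IsData Ω D → IsPiecewiseConstant T D DT →
      ∀ γ : ℝ, 0 < γ →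
      ∀ u : Pt → ℝ, IsGalerkinSolution Ω T V DT γ u →
        γ ^ 2 * stabT T u u ≤ C_B * etaSq Ω T DT u := by
  set C := residualConst T₀ Λ *
    (overlapBound T₀ * nodalConst (closureBound Λ) (overlapBound T₀) Λ) with hC
  have hC0 : 0 ≤ C := mul_nonneg (residualConst_nonneg _ _) (mul_nonneg (overlapBound_nonneg T₀)
    (nodalConst_nonneg (Nat.cast_nonneg _) (overlapBound_nonneg T₀) Λ))
  -- `C` is only known to be nonnegative; adding one makes the constant positive.
  refine ⟨C + 1, by linarith, fun T H hr hA V hV _ D DT _ _ γ _ u hu => ?_⟩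
  obtain ⟨z, p, hz, hz0, hzp⟩ := hu.1.exists_sub_conforming hr hT₀ hA hV
  have hsub : ∀ E ∈ T, ∀ x ∈ nodesOn T E, z x - lagrange E z x = u x - lagrange E u x :=
    fun E hE x hx => sub_lagrange_eq hr hT₀ hzp hE hx
  have hSz : stabT T u z = stabT T u u :=
    Finset.sum_congr rfl fun E hE => Finset.sum_congr rfl fun x hx => by
      simp only [hsub E hE x hx]
  -- The nodal inequality holds for any affine pieces; with the interpolants of `z` its right-hand
  -- side is the stabilization of `u`.
  have hnodes := sum_sq_nodes_le hr hT₀ hA hz0 fun E => lagrange E z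
  have hS : ∑ E ∈ T, ∑ x ∈ nodesOn T E, (z x - lagrange E z x) ^ 2 = stabT T u u :=
    Finset.sum_congr rfl fun E hE => Finset.sum_congr rfl fun x hx => by rw [hsub E hE x hx, sq]
  rw [hS] at hnodes
  have heta : 0 ≤ etaSq Ω T DT u := Finset.sum_nonneg fun E _ => etaLocSq_nonneg DT E u
  have key : (γ * stabT T u u) ^ 2 ≤ C * stabT T u u * etaSq Ω T DT u := by
    have h := sq_residual_le hr hT₀ hA hV hu hz
    rw [hSz] at h
    refine h.trans (mul_le_mul_of_nonneg_right ?_ heta)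
    rw [hC, mul_assoc]
    exact mul_le_mul_of_nonneg_left hnodes (residualConst_nonneg _ _)
  -- The inequality is quadratic in S(u,u) on the left and linear on the right: one factor is
  -- cancelled, unless it is zero and the claim is trivial.
  rcases (stabT_nonneg T u).eq_or_lt with h0 | hpos
  · rw [← h0, mul_zero]
    positivity
  · refine le_of_mul_le_mul_left ?_ hpos
    calc stabT T u u * (γ ^ 2 * stabT T u u) = (γ * stabT T u u) ^ 2 := by ring
      _ ≤ C * stabT T u u * etaSq Ω T DT u := key
      _ ≤ (C * stabT T u u + stabT T u u) * etaSq Ω T DT u := by gcongr; linarith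
      _ = stabT T u u * ((C + 1) * etaSq Ω T DT u) := by ring
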